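/- Let $\mathbb{K}$ be a field; all graded modules are $\mathbb{Z}$-graded $\mathbb{K}$-modules, and Koszul signs are used throughout. Let $\mathscr{C}=(\mathcal{C},\Delta,\epsilon,1,d,\theta)$ be a curved conilpotent cooperad: $(\mathcal{C},\Delta,\epsilon,1)$ is a coaugmented conilpotent cooperad in graded symmetric modules (a comonoid for the composition product $\circ$, formed with coinvariants, such that the successive decompositions of any element stop), $d$ is a coderivation of degree $-1$ with $d(1)=0$, and $\theta:\mathcal{C}(1)\to\mathbb{K}$ is a map of degree $-2$ with $\theta d=0$ and $d^2=(\theta\otimes \mathrm{Id}-\mathrm{Id}\otimes\theta)\Delta_2$, where $\Delta_2$ is the part of the decomposition given by trees with two vertices. A $\mathscr{C}$-coalgebra is a graded module $\mathcal{D}$ with a coassociative and counital map $\Delta_{\mathscr{D}}:\mathcal{D}\to\mathcal{C}\circ\mathcal{D}=\bigoplus_n\mathcal{C}(n)\otimes_{\mathbb{S}_n}\mathcal{D}^{\otimes n}$ and a degree $-1$ coderivation $d_{\mathcal{D}}$ (relative to $d$) such that $d_{\mathcal{D}}^2=(\theta\circ\mathrm{Id})\Delta_{\mathscr{D}}$;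 morphisms are the degree $0$ maps commuting with $\Delta_{\mathscr D}$ and $d_{\mathcal D}$. Let $\mathscr{C}\text{-}\mathsf{cog}$ be the category of $\mathscr{C}$-coalgebras, and let $\mathsf{uCocom}$ be the monoidal category of coassociative, counital, cocommutative coalgebras in chain complexes over $\mathbb{K}$, with the tensor product of chain complexes. For a $\mathscr{C}$-coalgebra $\mathscr{D}$ and $\mathscr{E}\in\mathsf{uCocom}$, the tensor product $\mathcal{D}\otimes\mathcal{E}$, with the differential $d_{\mathcal{D}}\otimes\mathrm{Id}+\mathrm{Id}\otimes d_{\mathcal{E}}$ and the decomposition map $$\mathcal{D}\otimes\mathcal{E}\longrightarrow\bigoplus_n(\mathcal{C}(n)\otimes_{\mathbb{S}_n}\mathcal{D}^{\otimes n})\otimes\mathcal{E}^{\otimes n}\longrightarrow\bigoplus_n\mathcal{C}(n)\otimes_{\mathbb{S}_n}(\mathcal{D}\otimes\mathcal{E})^{\otimes n}$$ given by $\Delta_{\mathscr{D}}$, the iterated coproducts of $\mathscr{E}$ (the counit for $n=0$) and the reordering of the factors, is a $\mathscr{C}$-coalgebra $\mathscr{D}\otimes\mathscr{E}$. **Theorem.**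 The category $\mathscr{C}\text{-}\mathsf{cog}$ is tensored, cotensored and enriched over $\mathsf{uCocom}$, with the right action given by $-\otimes-$. That is, the functor $-\otimes-:\mathscr{C}\text{-}\mathsf{cog}\times\mathsf{uCocom}\to\mathscr{C}\text{-}\mathsf{cog}$, with the associativity and unit isomorphisms of the tensor product, is a right action of the monoidal category $\mathsf{uCocom}$ on $\mathscr{C}\text{-}\mathsf{cog}$, and there are functors $$\{-,-\}:\mathscr{C}\text{-}\mathsf{cog}^{op}\times\mathscr{C}\text{-}\mathsf{cog}\to\mathsf{uCocom},\qquad \langle-,-\rangle:\mathsf{uCocom}^{op}\times\mathscr{C}\text{-}\mathsf{cog}\to\mathscr{C}\text{-}\mathsf{cog}$$ with isomorphisms, natural in $\mathscr{D}$, $\mathscr{E}$ and $\mathscr{D}'$, $$\hom_{\mathscr{C}\text{-}\mathsf{cog}}(\mathscr{D}\otimes\mathscr{E},\mathscr{D}')\simeq\hom_{\mathsf{uCocom}}(\mathscr{E},\{\mathscr{D},\mathscr{D}'\})\simeq\hom_{\mathscr{C}\text{-}\mathsf{cog}}(\mathscr{D},\langle\mathscr{E},\mathscr{D}'\rangle).$$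 Moreover, for all $\mathscr{C}$-coalgebras $\mathscr{D}$ and $\mathscr{D}'$, let $\mathrm{ev}:\mathscr{D}\otimes\{\mathscr{D},\mathscr{D}'\}\to\mathscr{D}'$ be the morphism corresponding to the identity of $\{\mathscr{D},\mathscr{D}'\}$. Then $a\mapsto\mathrm{ev}(-\otimes a)$ is a bijection from the set of dg atoms of $\{\mathscr{D},\mathscr{D}'\}$ (the nonzero elements $a$ with $\Delta a=a\otimes a$ and $da=0$) onto the set of morphisms of $\mathscr{C}$-coalgebras from $\mathscr{D}$ to $\mathscr{D}'$. -/

import Mathlib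

open CategoryTheory MonoidalCategory
open scoped TensorProduct DirectSum

universe u

/-- The sign `(-1) ^ n`, as a scalar of `K`. -/
def ksgn (K : Type u) [Field K] (n : ℤ) : K := ((n.negOnePow : ℤ) : K)

theorem ksgn_add (K : Type u) [Field K] (m n : ℤ) : ksgn K (m + n) = ksgn K m * ksgn K n := by
  simp [ksgn, Int.negOnePow_add]

theorem ksgn_zero (K : Type u) [Field K] : ksgn K 0 = 1 := by simp [ksgn]

theorem ksgn_even (K : Type u) [Field K] {n : ℤ} (h : Even n) : ksgn K n = 1 := by
  simp [ksgn, Int.negOnePow_even n h]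

theorem ksgn_mul_self (K : Type u) [Field K] (n : ℤ) : ksgn K n * ksgn K n = 1 := by
  rw [← ksgn_add]; exact ksgn_even K ⟨n, rfl⟩

theorem ksgn_sub_one (K : Type u) [Field K] (n : ℤ) : ksgn K (n - 1) = - ksgn K n := by
  simp [ksgn, Int.negOnePow_sub]

/-- A `K`-module with a family of submodules of "homogeneous elements of degree `n`". It is a
graded module when it satisfies `GMod.IsGraded`. -/
structure GMod (K : Type u) [Field K] where
  carrier : Type u
  [addCommGroup : AddCommGroup carrier]
  [module : Module K carrier]
  gr : ℤ → Submodule K carrier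

namespace GMod

variable {K : Type u} [Field K]

instance : CoeSort (GMod K) (Type u) := ⟨GMod.carrier⟩

attribute [instance] GMod.addCommGroup GMod.module

/-- The module is the direct sum of its homogeneous parts. -/
abbrev IsGraded (D : GMod K) : Prop := DirectSum.IsInternal D.gr

/-- Linear maps preserving the degree. -/
@[ext]
structure Hom (D E : GMod K) where
  lin : D →ₗ[K] E
  map_gr : ∀ n x, x ∈ D.gr n → lin x ∈ E.gr n

/-- The linear map which is `f n` on the homogeneous part of degree `n`. -/
noncomputable def glue {D : GMod K} (hD : D.IsGraded) {M : Type u} [AddCommMonoid M] [Module K M]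
    (f : ℤ → (D →ₗ[K] M)) : D →ₗ[K] M :=
  (DirectSum.toModule K ℤ M fun n => f n ∘ₗ (D.gr n).subtype) ∘ₗ
    (LinearEquiv.ofBijective (DirectSum.coeLinearMap D.gr) hD).symm.toLinearMap

theorem glue_apply {D : GMod K} (hD : D.IsGraded) {M : Type u} [AddCommMonoid M] [Module K M]
    (f : ℤ → (D →ₗ[K] M)) {n : ℤ} {x : D} (hx : x ∈ D.gr n) : glue hD f x = f n x := by
  have h : (LinearEquiv.ofBijective (DirectSum.coeLinearMap D.gr) hD).symm x =
      DirectSum.lof K ℤ (fun n => D.gr n) n ⟨x, hx⟩ := by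
    rw [LinearEquiv.symm_apply_eq]
    exact (DirectSum.coeLinearMap_lof D.gr n ⟨x, hx⟩).symm
  simp only [glue, LinearMap.comp_apply, LinearEquiv.coe_coe, h, DirectSum.toModule_lof,
    Submodule.subtype_apply]

theorem iSup_gr {D : GMod K} (hD : D.IsGraded) : iSup D.gr = ⊤ := hD.submodule_iSup_eq_top

theorem hom_induction {D : GMod K} (hD : D.IsGraded) {p : D → Prop}
    (hom : ∀ n x, x ∈ D.gr n → p x) (zero : p 0) (add : ∀ x y, p x → p y → p (x + y)) (x : D) :
    p x := by
  have hx : x ∈ iSup D.gr := by rw [iSup_gr hD]; trivial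
  exact Submodule.iSup_induction D.gr (motive := p) hx hom zero add

theorem isGraded_of_proj {D : GMod K} (h : iSup D.gr = ⊤) (P : ℤ → (D →ₗ[K] D))
    (h1 : ∀ n x, x ∈ D.gr n → P n x = x) (h2 : ∀ m n x, m ≠ n → x ∈ D.gr n → P m x = 0) :
    D.IsGraded := by
  rw [IsGraded, DirectSum.isInternal_submodule_iff_iSupIndep_and_iSup_eq_top]
  refine ⟨fun n => ?_, h⟩
  rw [Submodule.disjoint_def]
  intro x hx hx'
  have : (⨆ j, ⨆ (_ : j ≠ n), D.gr j) ≤ LinearMap.ker (P n) := by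
    refine iSup_le fun j => iSup_le fun hj => fun y hy => ?_
    exact h2 n j y hj.symm hy
  rw [← h1 n x hx]
  exact this hx'

/-- The operator `x ↦ (-1) ^ (k * |x|) x`. -/
noncomputable def sgn {D : GMod K} (hD : D.IsGraded) (k : ℤ) : D →ₗ[K] D :=
  glue hD fun n => ksgn K (k * n) • LinearMap.id

theorem sgn_apply {D : GMod K} (hD : D.IsGraded) (k : ℤ) {n : ℤ} {x : D} (hx : x ∈ D.gr n) :
    sgn hD k x = ksgn K (k * n) • x := by
  simp [sgn, glue_apply hD _ hx]

/-- The tensor product of graded modules, with `|x ⊗ y| = |x| + |y|`. -/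
abbrev tensor (D E : GMod K) : GMod K where
  carrier := D ⊗[K] E
  gr n := Submodule.span K {t | ∃ i j, ∃ x ∈ D.gr i, ∃ y ∈ E.gr j, i + j = n ∧ t = x ⊗ₜ[K] y}

theorem tmul_mem {D E : GMod K} {i j n : ℤ} {x : D} {y : E} (hx : x ∈ D.gr i) (hy : y ∈ E.gr j)
    (h : i + j = n) : (x ⊗ₜ[K] y : D ⊗[K] E) ∈ (tensor D E).gr n :=
  Submodule.subset_span ⟨i, j, x, hx, y, hy, h, rfl⟩

/-- Induction principle: additive predicates on a tensor product of graded modules are checked on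
tensors of homogeneous elements. -/
theorem tensor_induction {D E : GMod K} (hD : D.IsGraded) (hE : E.IsGraded)
    {p : D ⊗[K] E → Prop}
    (hom : ∀ i j x y, x ∈ D.gr i → y ∈ E.gr j → p (x ⊗ₜ y)) (zero : p 0)
    (add : ∀ s t, p s → p t → p (s + t)) (t : D ⊗[K] E) : p t := by
  induction t using TensorProduct.induction_on with
  | zero => exact zero
  | add s t hs ht => exact add s t hs ht
  | tmul x y =>
    refine hom_induction hD (p := fun x => p (x ⊗ₜ y)) ?_ (by simpa using zero) ?_ x
    · intro i x hx
      refine hom_induction hE (p := fun y => p (x ⊗ₜ y)) ?_ (by simpa using zero) ?_ y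
      · intro j y hy
        exact hom i j x y hx hy
      · intro y y' h h'
        rw [TensorProduct.tmul_add]; exact add _ _ h h'
    · intro x x' h h'
      rw [TensorProduct.add_tmul]; exact add _ _ h h'

theorem tensor_isGraded {D E : GMod K} (hD : D.IsGraded) (hE : E.IsGraded) :
    (tensor D E).IsGraded := by
  let Q : ℤ → (E →ₗ[K] E) := fun n => glue hE fun m => if m = n then LinearMap.id else 0
  have hQ : ∀ n m y, y ∈ E.gr m → Q n y = if m = n then y else 0 := by
    intro n m y hy
    simp only [Q, glue_apply hE _ hy]
    split <;> simp
  let P : ℤ → (tensor D E →ₗ[K] tensor D E) := fun n =>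
    TensorProduct.lift (glue hD (M := E →ₗ[K] D ⊗[K] E)
      fun i => (TensorProduct.mk K D E).compl₂ (Q (n - i)))
  have hP : ∀ n i j (x : D) (y : E), x ∈ D.gr i → y ∈ E.gr j →
      P n (x ⊗ₜ[K] y : D ⊗[K] E) = if i + j = n then (x ⊗ₜ[K] y : D ⊗[K] E) else 0 := by
    intro n i j x y hx hy
    have : P n (x ⊗ₜ[K] y : D ⊗[K] E) = (x ⊗ₜ[K] (Q (n - i) y) : D ⊗[K] E) := by
      simp only [P]
      erw [TensorProduct.lift.tmul]
      rw [glue_apply hD _ hx]; rfl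
    rw [this, hQ _ _ _ hy]
    by_cases h : i + j = n
    · rw [if_pos h, if_pos (by omega)]
    · rw [if_neg h, if_neg (by omega)]; simp
  refine isGraded_of_proj ?_ P ?_ ?_
  · rw [eq_top_iff]
    rintro t -
    refine tensor_induction hD hE (p := fun t => t ∈ iSup (tensor D E).gr) ?_ ?_ ?_ t
    · intro i j x y hx hy
      exact (le_iSup (tensor D E).gr (i + j)) (tmul_mem hx hy rfl)
    · exact Submodule.zero_mem _
    · intro s t hs ht; exact Submodule.add_mem _ hs ht
  · intro n t ht
    change t ∈ LinearMap.eqLocus (P n) LinearMap.id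
    refine (Submodule.span_le.2 ?_) ht
    rintro _ ⟨i, j, x, hx, y, hy, h, rfl⟩
    simp only [SetLike.mem_coe, LinearMap.mem_eqLocus]
    rw [hP n i j x y hx hy, if_pos h]; rfl
  · intro m n t hmn ht
    change t ∈ LinearMap.ker (P m)
    refine (Submodule.span_le.2 ?_) ht
    rintro _ ⟨i, j, x, hx, y, hy, h, rfl⟩
    simp only [SetLike.mem_coe, LinearMap.mem_ker]
    rw [hP m i j x y hx hy, if_neg (by omega)]

/-- The tensor product of two degree preserving maps. -/
def Hom.tensor {D D' E E' : GMod K} (f : Hom D D') (g : Hom E E') :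
    Hom (D.tensor E) (D'.tensor E') where
  lin := TensorProduct.map f.lin g.lin
  map_gr n t ht := by
    have : Submodule.map (TensorProduct.map f.lin g.lin) ((D.tensor E).gr n) ≤
        (D'.tensor E').gr n := by
      rw [Submodule.map_span_le]
      rintro _ ⟨i, j, x, hx, y, hy, h, rfl⟩
      exact tmul_mem (f.map_gr _ _ hx) (g.map_gr _ _ hy) h
    exact this (Submodule.mem_map_of_mem ht)

/-- The operator `x ⊗ y ↦ dx ⊗ y + (-1) ^ |x| x ⊗ dy`. -/
noncomputable def tensorD {D E : GMod K} (hD : D.IsGraded) (d : D →ₗ[K] D) (d' : E →ₗ[K] E) :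
    D ⊗[K] E →ₗ[K] D ⊗[K] E :=
  TensorProduct.map d LinearMap.id + TensorProduct.map (sgn hD 1) d'

theorem tensorD_tmul {D E : GMod K} (hD : D.IsGraded) (d : D →ₗ[K] D) (d' : E →ₗ[K] E) {i : ℤ}
    {x : D} (hx : x ∈ D.gr i) (y : E) :
    tensorD hD d d' (x ⊗ₜ y) = d x ⊗ₜ y + ksgn K i • (x ⊗ₜ d' y) := by
  simp [tensorD, sgn_apply hD 1 hx, TensorProduct.smul_tmul']

/-- The Koszul symmetry `x ⊗ y ↦ (-1) ^ (|x| |y|) y ⊗ x`. -/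
noncomputable def swap {D E : GMod K} (hD : D.IsGraded) (hE : E.IsGraded) :
    D ⊗[K] E →ₗ[K] E ⊗[K] D :=
  TensorProduct.lift (glue hD fun i => (TensorProduct.mk K E D).flip.compl₂ (sgn hE i))

theorem swap_tmul {D E : GMod K} (hD : D.IsGraded) (hE : E.IsGraded) {i j : ℤ} {x : D} {y : E}
    (hx : x ∈ D.gr i) (hy : y ∈ E.gr j) :
    swap hD hE (x ⊗ₜ y) = ksgn K (i * j) • (y ⊗ₜ x) := by
  simp [swap, glue_apply hD _ hx, sgn_apply hE i hy, TensorProduct.smul_tmul']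

/-- The ground field, in degree `0`. -/
abbrev unit (K : Type u) [Field K] : GMod K where
  carrier := K
  gr n := if n = 0 then ⊤ else ⊥

theorem unit_isGraded : (unit K).IsGraded := by
  refine isGraded_of_proj ?_ (fun n => if n = 0 then LinearMap.id else 0) ?_ ?_
  · rw [eq_top_iff]
    exact le_trans (by simp [unit]) (le_iSup (unit K).gr 0)
  · intro n x hx
    by_cases h : n = 0
    · simp [h]
    · have : x = 0 := by simpa [unit, h] using hx
      simp [this]
  · intro m n x hmn hx
    by_cases h : n = 0
    · have : m ≠ 0 := by omega
      simp [this]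
    · have : x = 0 := by simpa [unit, h] using hx
      simp [this]

end GMod

/-- Chain complexes of `K`-modules: graded modules with a degree `-1` map of square zero. -/
structure DGMod (K : Type u) [Field K] extends GMod K where
  isGraded : toGMod.IsGraded
  d : toGMod →ₗ[K] toGMod
  d_gr : ∀ n x, x ∈ gr n → d x ∈ gr (n - 1)
  d_d : ∀ x, d (d x) = 0

namespace DGMod

variable {K : Type u} [Field K]

/-- Chain maps. -/
@[ext]
structure Hom (X Y : DGMod K) extends GMod.Hom X.toGMod Y.toGMod where
  comm : ∀ x, lin (X.d x) = Y.d (lin x)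

instance : Category (DGMod K) where
  Hom X Y := Hom X Y
  id X := ⟨⟨LinearMap.id, fun _ _ h => h⟩, fun _ => rfl⟩
  comp f g := ⟨⟨g.lin ∘ₗ f.lin, fun n x h => g.map_gr n _ (f.map_gr n x h)⟩,
    fun x => by simp [f.comm, g.comm]⟩

@[ext]
theorem hom_ext {X Y : DGMod K} {f g : X ⟶ Y} (h : f.lin = g.lin) : f = g := Hom.ext h

@[simp] theorem id_lin (X : DGMod K) : (𝟙 X : X ⟶ X).lin = LinearMap.id := rfl
@[simp] theorem comp_lin {X Y Z : DGMod K} (f : X ⟶ Y) (g : Y ⟶ Z) :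
    (f ≫ g).lin = g.lin ∘ₗ f.lin := rfl

/-- An isomorphism of complexes from a linear equivalence that is a chain map. -/
def mkIso {X Y : DGMod K} (e : X.toGMod ≃ₗ[K] Y.toGMod)
    (h : ∀ n x, x ∈ X.gr n → e x ∈ Y.gr n) (h' : ∀ n y, y ∈ Y.gr n → e.symm y ∈ X.gr n)
    (hd : ∀ x, e (X.d x) = Y.d (e x)) : X ≅ Y where
  hom := ⟨⟨e.toLinearMap, h⟩, hd⟩
  inv := ⟨⟨e.symm.toLinearMap, h'⟩, fun y => by
    apply e.injective; simp [hd]⟩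
  hom_inv_id := by ext x; simp
  inv_hom_id := by ext x; simp

/-- The tensor product of complexes. -/
noncomputable abbrev tensor (X Y : DGMod K) : DGMod K where
  toGMod := X.toGMod.tensor Y.toGMod
  isGraded := GMod.tensor_isGraded X.isGraded Y.isGraded
  d := GMod.tensorD X.isGraded X.d Y.d
  d_gr n t ht := by
    have : Submodule.map (GMod.tensorD X.isGraded X.d Y.d) ((X.toGMod.tensor Y.toGMod).gr n) ≤
        (X.toGMod.tensor Y.toGMod).gr (n - 1) := by
      rw [Submodule.map_span_le]
      rintro _ ⟨i, j, x, hx, y, hy, h, rfl⟩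
      rw [GMod.tensorD_tmul _ _ _ hx]
      exact Submodule.add_mem _ (GMod.tmul_mem (X.d_gr _ _ hx) hy (by omega))
        (Submodule.smul_mem _ _ (GMod.tmul_mem hx (Y.d_gr _ _ hy) (by omega)))
    exact this (Submodule.mem_map_of_mem ht)
  d_d t := by
    refine GMod.tensor_induction X.isGraded Y.isGraded
      (p := fun t => GMod.tensorD X.isGraded X.d Y.d (GMod.tensorD X.isGraded X.d Y.d t) = 0)
      ?_ (by simp) (fun s t hs ht => by simp only [map_add, hs, ht, add_zero]) t
    intro i j x y hx hy
    rw [GMod.tensorD_tmul _ _ _ hx, map_add, map_smul,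
      GMod.tensorD_tmul _ _ _ (X.d_gr _ _ hx), GMod.tensorD_tmul _ _ _ hx, X.d_d, Y.d_d,
      ksgn_sub_one]
    simp

/-- The complex `K`, in degree `0`. -/
abbrev unit (K : Type u) [Field K] : DGMod K where
  toGMod := GMod.unit K
  isGraded := GMod.unit_isGraded
  d := 0
  d_gr _ _ _ := Submodule.zero_mem _
  d_d _ := rfl

/-- The tensor product of chain maps. -/
noncomputable def tensorMap {X X' Y Y' : DGMod K} (f : X ⟶ X') (g : Y ⟶ Y') :
    tensor X Y ⟶ tensor X' Y' where
  toHom := GMod.Hom.tensor f.toHom g.toHom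
  comm t := by
    refine GMod.tensor_induction X.isGraded Y.isGraded (p := fun t =>
      TensorProduct.map f.lin g.lin (GMod.tensorD X.isGraded X.d Y.d t) =
        GMod.tensorD X'.isGraded X'.d Y'.d (TensorProduct.map f.lin g.lin t))
      ?_ (by simp) (fun s t hs ht => by simp only [map_add, hs, ht]) t
    intro i j x y hx hy
    rw [GMod.tensorD_tmul _ _ _ hx, TensorProduct.map_tmul,
      GMod.tensorD_tmul _ _ _ (f.map_gr _ _ hx)]
    simp [f.comm, g.comm]


theorem tensor_gr_le {D E : GMod K} {M : Type u} [AddCommGroup M] [Module K M]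
    (f : D ⊗[K] E →ₗ[K] M) (S : Submodule K M) {n : ℤ}
    (h : ∀ i j x y, x ∈ D.gr i → y ∈ E.gr j → i + j = n → f (x ⊗ₜ y) ∈ S) {t : D ⊗[K] E}
    (ht : t ∈ (D.tensor E).gr n) : f t ∈ S := by
  have : Submodule.map f ((D.tensor E).gr n) ≤ S := by
    rw [Submodule.map_span_le]
    rintro _ ⟨i, j, x, hx, y, hy, hn, rfl⟩
    exact h i j x y hx hy hn
  exact this (Submodule.mem_map_of_mem ht)


theorem tensor_induction₃ {X Y Z : GMod K} (hX : X.IsGraded) (hY : Y.IsGraded) (hZ : Z.IsGraded)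
    {p : (X ⊗[K] Y) ⊗[K] Z → Prop}
    (hom : ∀ i j k x y z, x ∈ X.gr i → y ∈ Y.gr j → z ∈ Z.gr k → p ((x ⊗ₜ y) ⊗ₜ z)) (zero : p 0)
    (add : ∀ s t, p s → p t → p (s + t)) (t : (X ⊗[K] Y) ⊗[K] Z) : p t := by
  induction t using TensorProduct.induction_on with
  | zero => exact zero
  | add s t hs ht => exact add s t hs ht
  | tmul s z =>
    refine GMod.hom_induction hZ (p := fun z => p (s ⊗ₜ z)) ?_ (by simpa using zero) ?_ z
    · intro k z hz
      refine GMod.tensor_induction hX hY (p := fun s => p (s ⊗ₜ z)) ?_ (by simpa using zero) ?_ s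
      · intro i j x y hx hy
        exact hom i j k x y z hx hy hz
      · intro s s' h h'
        rw [TensorProduct.add_tmul]; exact add _ _ h h'
    · intro y y' h h'
      rw [TensorProduct.tmul_add]; exact add _ _ h h'

/-- The associativity isomorphism of the tensor product. -/
noncomputable def assocIso (X Y Z : DGMod K) :
    tensor (tensor X Y) Z ≅ tensor X (tensor Y Z) :=
  mkIso (TensorProduct.assoc K X.carrier Y.carrier Z.carrier)
    (fun n t ht => by
      refine tensor_gr_le (D := X.toGMod.tensor Y.toGMod) (E := Z.toGMod)
        (TensorProduct.assoc K X.carrier Y.carrier Z.carrier).toLinearMap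
        _ (fun i j s z hs hz hn => ?_) ht
      refine tensor_gr_le (D := X.toGMod) (E := Y.toGMod)
        ((TensorProduct.assoc K X.carrier Y.carrier Z.carrier).toLinearMap ∘ₗ
          (TensorProduct.mk K (X.carrier ⊗[K] Y.carrier) Z.carrier).flip z)
        _ (fun i' j' x y hx hy hn' => ?_) hs
      exact GMod.tmul_mem hx (GMod.tmul_mem hy hz rfl) (by omega))
    (fun n t ht => by
      refine tensor_gr_le (D := X.toGMod) (E := Y.toGMod.tensor Z.toGMod)
        (TensorProduct.assoc K X.carrier Y.carrier Z.carrier).symm.toLinearMap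
        _ (fun i j x s hx hs hn => ?_) ht
      refine tensor_gr_le (D := Y.toGMod) (E := Z.toGMod)
        ((TensorProduct.assoc K X.carrier Y.carrier Z.carrier).symm.toLinearMap ∘ₗ
          (TensorProduct.mk K X.carrier (Y.carrier ⊗[K] Z.carrier)) x)
        _ (fun i' j' y z hy hz hn' => ?_) hs
      exact GMod.tmul_mem (GMod.tmul_mem hx hy rfl) hz (by omega))
    (fun t => by
      refine tensor_induction₃ X.isGraded Y.isGraded Z.isGraded (p := fun t =>
        TensorProduct.assoc K X.carrier Y.carrier Z.carrier ((tensor (tensor X Y) Z).d t) =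
          (tensor X (tensor Y Z)).d (TensorProduct.assoc K X.carrier Y.carrier Z.carrier t))
        ?_ (by simp) (fun s t hs ht => by simp only [map_add, hs, ht]) t
      intro i j k x y z hx hy hz
      change TensorProduct.assoc K X.carrier Y.carrier Z.carrier
          (GMod.tensorD (GMod.tensor_isGraded X.isGraded Y.isGraded)
            (GMod.tensorD X.isGraded X.d Y.d) Z.d ((x ⊗ₜ y) ⊗ₜ z)) =
        GMod.tensorD (E := Y.toGMod.tensor Z.toGMod) X.isGraded X.d
          (GMod.tensorD Y.isGraded Y.d Z.d) (x ⊗ₜ (y ⊗ₜ z))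
      rw [GMod.tensorD_tmul _ _ _ (GMod.tmul_mem hx hy rfl), GMod.tensorD_tmul _ _ _ hx,
        GMod.tensorD_tmul _ _ _ hx, GMod.tensorD_tmul _ _ _ hy, ksgn_add]
      simp only [TensorProduct.add_tmul, TensorProduct.tmul_add, ← TensorProduct.smul_tmul',
        TensorProduct.tmul_smul, TensorProduct.assoc_tmul, map_add, map_smul, smul_smul, smul_add,
        add_assoc])


/-- The left unit isomorphism. -/
noncomputable def leftUnitIso (X : DGMod K) : tensor (unit K) X ≅ X :=
  mkIso (TensorProduct.lid K X.carrier)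
    (fun n t ht => by
      refine tensor_gr_le (D := GMod.unit K) (E := X.toGMod)
        (TensorProduct.lid K X.carrier).toLinearMap _ (fun i j a x ha hx hn => ?_) ht
      by_cases hi : i = 0
      · obtain rfl : j = n := by omega
        exact Submodule.smul_mem _ a hx
      · have : a = 0 := by simpa [hi] using ha
        subst this
        simp)
    (fun n x hx => GMod.tmul_mem (D := GMod.unit K) (i := 0) (by simp) hx (by omega))
    (fun t => by
      refine GMod.tensor_induction (D := GMod.unit K) GMod.unit_isGraded X.isGraded (p := fun t =>
        TensorProduct.lid K X.carrier ((tensor (unit K) X).d t) =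
          X.d (TensorProduct.lid K X.carrier t))
        ?_ (by simp) (fun s t hs ht => by simp only [map_add, hs, ht]) t
      intro i j a x ha hx
      rw [GMod.tensorD_tmul _ _ _ ha]
      by_cases hi : i = 0
      · subst hi
        simp [ksgn_zero]
      · have : a = 0 := by simpa [hi] using ha
        subst this
        simp)

/-- The right unit isomorphism. -/
noncomputable def rightUnitIso (X : DGMod K) : tensor X (unit K) ≅ X :=
  mkIso (TensorProduct.rid K X.carrier)
    (fun n t ht => by
      refine tensor_gr_le (D := X.toGMod) (E := GMod.unit K)
        (TensorProduct.rid K X.carrier).toLinearMap _ (fun i j x a hx ha hn => ?_) ht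
      by_cases hi : j = 0
      · obtain rfl : i = n := by omega
        exact Submodule.smul_mem _ a hx
      · have : a = 0 := by simpa [hi] using ha
        subst this
        simp)
    (fun n x hx => GMod.tmul_mem (E := GMod.unit K) (j := 0) hx (by simp) (by omega))
    (fun t => by
      refine GMod.tensor_induction (E := GMod.unit K) X.isGraded GMod.unit_isGraded (p := fun t =>
        TensorProduct.rid K X.carrier ((tensor X (unit K)).d t) =
          X.d (TensorProduct.rid K X.carrier t))
        ?_ (by simp) (fun s t hs ht => by simp only [map_add, hs, ht]) t
      intro i j x a hx ha
      rw [GMod.tensorD_tmul _ _ _ hx]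
      simp)

noncomputable instance : MonoidalCategoryStruct (DGMod K) where
  tensorObj := tensor
  whiskerLeft X _ _ f := tensorMap (𝟙 X) f
  whiskerRight f Y := tensorMap f (𝟙 Y)
  tensorHom := tensorMap
  tensorUnit := unit K
  associator := assocIso
  leftUnitor := leftUnitIso
  rightUnitor := rightUnitIso

noncomputable instance : MonoidalCategory (DGMod K) :=
  MonoidalCategory.ofTensorHom
    (id_tensorHom_id := fun X Y => hom_ext TensorProduct.map_id)
    (id_tensorHom := fun _ _ _ _ => rfl)
    (tensorHom_id := fun _ _ => rfl)
    (tensorHom_comp_tensorHom := fun f₁ f₂ g₁ g₂ =>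
      hom_ext (TensorProduct.map_comp g₁.lin g₂.lin f₁.lin f₂.lin).symm)
    (associator_naturality := fun {X₁ X₂ X₃ _ _ _} f₁ f₂ f₃ => hom_ext
      (TensorProduct.ext_threefold fun x y z => rfl))
    (leftUnitor_naturality := fun f => hom_ext
      (TensorProduct.ext' fun a x => (f.lin.map_smul a x).symm))
    (rightUnitor_naturality := fun f => hom_ext
      (TensorProduct.ext' fun x a => (f.lin.map_smul a x).symm))
    (pentagon := fun W X Y Z => hom_ext
      (TensorProduct.ext_fourfold fun w x y z => rfl))
    (triangle := fun X Y => hom_ext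
      (TensorProduct.ext_threefold fun x a y => by
        change x ⊗ₜ[K] (a • y) = (a • x) ⊗ₜ[K] y
        exact (TensorProduct.smul_tmul _ _ _).symm))

theorem swap_swap {X Y : GMod K} (hX : X.IsGraded) (hY : Y.IsGraded) (t : X ⊗[K] Y) :
    GMod.swap hY hX (GMod.swap hX hY t) = t := by
  refine GMod.tensor_induction hX hY
    (p := fun t => GMod.swap hY hX (GMod.swap hX hY t) = t)
    ?_ (by simp) (fun s t hs ht => by simp only [map_add, hs, ht]) t
  intro i j x y hx hy
  rw [GMod.swap_tmul _ _ hx hy, map_smul, GMod.swap_tmul _ _ hy hx, smul_smul, mul_comm j i,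
    ksgn_mul_self, one_smul]

/-- The Koszul symmetry, as a linear equivalence. -/
noncomputable def swapEquiv (X Y : DGMod K) :
    (X.carrier ⊗[K] Y.carrier) ≃ₗ[K] (Y.carrier ⊗[K] X.carrier) :=
  LinearEquiv.ofLinearMap (GMod.swap X.isGraded Y.isGraded) (GMod.swap Y.isGraded X.isGraded)
    (LinearMap.ext fun t => swap_swap _ _ t) (LinearMap.ext fun t => swap_swap _ _ t)

theorem swap_gr {X Y : DGMod K} {n : ℤ} {t : X.carrier ⊗[K] Y.carrier}
    (ht : t ∈ (X.toGMod.tensor Y.toGMod).gr n) :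
    GMod.swap X.isGraded Y.isGraded t ∈ (Y.toGMod.tensor X.toGMod).gr n := by
  refine tensor_gr_le (D := X.toGMod) (E := Y.toGMod) (GMod.swap X.isGraded Y.isGraded) _
    (fun i j x y hx hy hn => ?_) ht
  rw [GMod.swap_tmul _ _ hx hy]
  exact Submodule.smul_mem _ _ (GMod.tmul_mem hy hx (by omega))

/-- The Koszul symmetry, as an isomorphism of complexes. -/
noncomputable def braidIso (X Y : DGMod K) : tensor X Y ≅ tensor Y X :=
  mkIso (swapEquiv X Y) (fun n t ht => swap_gr ht) (fun n t ht => swap_gr ht)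
    (fun t => by
      refine GMod.tensor_induction X.isGraded Y.isGraded (p := fun t =>
        GMod.swap X.isGraded Y.isGraded (GMod.tensorD X.isGraded X.d Y.d t) =
          GMod.tensorD Y.isGraded Y.d X.d (GMod.swap X.isGraded Y.isGraded t))
        ?_ (by simp) (fun s t hs ht => by simp only [map_add, hs, ht]) t
      intro i j x y hx hy
      rw [GMod.tensorD_tmul _ _ _ hx, map_add, map_smul,
        GMod.swap_tmul _ _ (X.d_gr _ _ hx) hy, GMod.swap_tmul _ _ hx (Y.d_gr _ _ hy),
        GMod.swap_tmul _ _ hx hy, map_smul, GMod.tensorD_tmul _ _ _ hy, smul_add, smul_smul,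
        smul_smul, ← ksgn_add, ← ksgn_add, add_comm]
      congr 2
      · rw [show i + i * (j - 1) = i * j by ring]
      · rw [show (i - 1) * j = i * j + j - (j + j) by ring, sub_eq_add_neg, ksgn_add,
          ksgn_even K (n := -(j + j)) (by simp), mul_one])

theorem braid_natural {X X' Y Y' : DGMod K} (f : X ⟶ X') (g : Y ⟶ Y') :
    tensorMap f g ≫ (braidIso X' Y').hom = (braidIso X Y).hom ≫ tensorMap g f := by
  refine hom_ext (LinearMap.ext fun t => ?_)
  refine GMod.tensor_induction X.isGraded Y.isGraded (p := fun t =>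
    GMod.swap X'.isGraded Y'.isGraded (TensorProduct.map f.lin g.lin t) =
      TensorProduct.map g.lin f.lin (GMod.swap X.isGraded Y.isGraded t))
    ?_ (by simp) (fun s t hs ht => by simp only [map_add, hs, ht]) t
  intro i j x y hx hy
  rw [GMod.swap_tmul _ _ hx hy, TensorProduct.map_tmul,
    GMod.swap_tmul _ _ (f.map_gr _ _ hx) (g.map_gr _ _ hy), map_smul, TensorProduct.map_tmul]

noncomputable instance : BraidedCategory (DGMod K) where
  braiding := braidIso
  braiding_naturality_right X _ _ f := braid_natural (𝟙 X) f
  braiding_naturality_left f Z := braid_natural f (𝟙 Z)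
  hexagon_forward X Y Z := by
    refine hom_ext (LinearMap.ext fun t => ?_)
    refine tensor_induction₃ X.isGraded Y.isGraded Z.isGraded (p := fun t =>
      (TensorProduct.assoc K Y.carrier Z.carrier X.carrier) (GMod.swap X.isGraded
        (GMod.tensor_isGraded Y.isGraded Z.isGraded)
          (TensorProduct.assoc K X.carrier Y.carrier Z.carrier t)) =
      TensorProduct.map LinearMap.id (GMod.swap X.isGraded Z.isGraded)
        (TensorProduct.assoc K Y.carrier X.carrier Z.carrier
          (TensorProduct.map (GMod.swap X.isGraded Y.isGraded) LinearMap.id t)))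
      ?_ (by simp) (fun s t hs ht => by simp only [map_add, hs, ht]) t
    intro i j k x y z hx hy hz
    rw [TensorProduct.assoc_tmul, GMod.swap_tmul _ _ hx (GMod.tmul_mem hy hz rfl),
      TensorProduct.map_tmul, GMod.swap_tmul _ _ hx hy, mul_add, ksgn_add]
    simp only [← TensorProduct.smul_tmul', TensorProduct.tmul_smul, map_smul,
      TensorProduct.assoc_tmul, TensorProduct.map_tmul, LinearMap.id_apply,
      GMod.swap_tmul _ _ hx hz, smul_smul]
  hexagon_reverse X Y Z := by
    refine hom_ext (LinearMap.ext fun t => ?_)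
    obtain ⟨t, rfl⟩ := (TensorProduct.assoc K X.carrier Y.carrier Z.carrier).surjective t
    refine tensor_induction₃ X.isGraded Y.isGraded Z.isGraded (p := fun t =>
      (TensorProduct.assoc K Z.carrier X.carrier Y.carrier).symm (GMod.swap
        (GMod.tensor_isGraded X.isGraded Y.isGraded) Z.isGraded
          ((TensorProduct.assoc K X.carrier Y.carrier Z.carrier).symm
            (TensorProduct.assoc K X.carrier Y.carrier Z.carrier t))) =
      TensorProduct.map (GMod.swap X.isGraded Z.isGraded) LinearMap.id
        ((TensorProduct.assoc K X.carrier Z.carrier Y.carrier).symm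
          (TensorProduct.map LinearMap.id (GMod.swap Y.isGraded Z.isGraded)
            (TensorProduct.assoc K X.carrier Y.carrier Z.carrier t))))
      ?_ (by simp) (fun s t hs ht => by simp only [map_add, hs, ht]) t
    intro i j k x y z hx hy hz
    rw [LinearEquiv.symm_apply_apply, TensorProduct.assoc_tmul,
      GMod.swap_tmul _ _ (GMod.tmul_mem hx hy rfl) hz,
      TensorProduct.map_tmul, GMod.swap_tmul _ _ hy hz, add_mul, ksgn_add]
    simp only [← TensorProduct.smul_tmul', TensorProduct.tmul_smul, map_smul,
      TensorProduct.assoc_symm_tmul, TensorProduct.map_tmul, LinearMap.id_apply,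
      GMod.swap_tmul _ _ hx hz, smul_smul, mul_comm]

noncomputable instance : SymmetricCategory (DGMod K) where
  symmetry _ _ := hom_ext (LinearMap.ext fun t => swap_swap _ _ t)

end DGMod

/-- The property of being cocommutative, for counital coassociative dg coalgebras. -/
def IsCocommutative (K : Type u) [Field K] : ObjectProperty (Comon (DGMod K)) :=
  fun E => IsCommComonObj E.X

instance (K : Type u) [Field K] : (IsCocommutative K).IsMonoidal where
  prop_unit := by
    let _ := ComonObj.instTensorUnit (DGMod K)
    exact (CommComon.instCommComonObjUnit : IsCommComonObj (𝟙_ (DGMod K)))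
  prop_tensor E F hE hF := by
    have : IsCommComonObj E.X := hE
    have : IsCommComonObj F.X := hF
    exact (inferInstance : IsCommComonObj (E.X ⊗ F.X))

/-- The monoidal category of counital cocommutative coalgebras in chain complexes. -/
abbrev UCocom (K : Type u) [Field K] := (IsCocommutative K).FullSubcategory


/-! ### Symmetric modules and their composition product -/

/-- The sign by which homogeneous elements `x i` of degrees `d i` are permuted, when `x i` is moved
from position `i` to position `σ i`. -/
def koszulSign (K : Type u) [Field K] {n : ℕ} (σ : Equiv.Perm (Fin n)) (d : Fin n → ℤ) : K :=
  ∏ i, ∏ j, if i < j ∧ σ j < σ i then ksgn K (d i * d j) else 1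

/-- A family of graded modules `V(n)` with operators `c ↦ c · σ`, for `σ` in the symmetric group
`S_n`. It is a symmetric module when it satisfies `SMod.IsSMod`. -/
structure SMod (K : Type u) [Field K] where
  obj : ℕ → GMod K
  act : ∀ n, Equiv.Perm (Fin n) → (obj n →ₗ[K] obj n)

namespace SMod

variable {K : Type u} [Field K]

/-- `V(n)` is a graded right module over the symmetric group `S_n`, for every `n`. -/
structure IsSMod (V : SMod K) : Prop where
  isGraded : ∀ n, (V.obj n).IsGraded
  act_one : ∀ n c, V.act n 1 c = c
  act_mul : ∀ n σ τ c, V.act n (σ * τ) c = V.act n τ (V.act n σ c)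
  act_gr : ∀ n σ e c, c ∈ (V.obj n).gr e → V.act n σ c ∈ (V.obj n).gr e

/-- Morphisms of symmetric modules. -/
structure Hom (V W : SMod K) where
  app : ∀ n, GMod.Hom (V.obj n) (W.obj n)
  equivariant : ∀ n σ c, (app n).lin (V.act n σ c) = W.act n σ ((app n).lin c)

/-- The identity morphism. -/
def Hom.id (V : SMod K) : Hom V V := ⟨fun _ => ⟨LinearMap.id, fun _ _ h => h⟩, fun _ _ _ => rfl⟩

/-- The shapes of the two-level trees with `n` labelled inputs: the root has `k` inputs, its `i`-th
child has `m i` inputs, and these inputs are labelled bijectively by `Fin n`. -/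
abbrev CompIdx (n : ℕ) := Σ k : ℕ, Σ m : Fin k → ℕ, ((Σ i, Fin (m i)) ≃ Fin n)

/-- The direct sum of the modules `V(k) ⊗ W(m 1) ⊗ ⋯ ⊗ W(m k)` over all shapes. -/
abbrev CompPre (V W : SMod K) (n : ℕ) : Type u :=
  ⨁ p : CompIdx n, V.obj p.1 ⊗[K] (⨂[K] i, W.obj (p.2.1 i))

/-- The generator `v ⊗ w 1 ⊗ ⋯ ⊗ w k`, in the summand of the given shape. -/
noncomputable def preMk (V W : SMod K) {n k : ℕ} (m : Fin k → ℕ) (β : (Σ i, Fin (m i)) ≃ Fin n)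
    (v : V.obj k) (w : ∀ i, W.obj (m i)) : CompPre V W n :=
  DirectSum.lof K (CompIdx n) (fun p => V.obj p.1 ⊗[K] (⨂[K] i, W.obj (p.2.1 i))) ⟨k, m, β⟩
    (v ⊗ₜ[K] PiTensorProduct.tprod K w)

/-- The relations of the composition product: the symmetric groups acting on the children of the
root are identified with relabellings, and the action of `S_k` on `V(k)` with permutations of the
children, with the Koszul sign. -/
noncomputable def compRel (V W : SMod K) (n : ℕ) : Submodule K (CompPre V W n) :=
  Submodule.span K
    ({z | ∃ (k : ℕ) (m : Fin k → ℕ) (β : (Σ i, Fin (m i)) ≃ Fin n) (v : V.obj k)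
        (w : ∀ i, W.obj (m i)) (σ : ∀ i, Equiv.Perm (Fin (m i))),
        z = preMk V W m β v (fun i => W.act (m i) (σ i) (w i)) -
          preMk V W m ((Equiv.sigmaCongrRight fun i => (σ i).symm).trans β) v w} ∪
      {z | ∃ (k : ℕ) (m : Fin k → ℕ) (β : (Σ i, Fin (m i)) ≃ Fin n) (v : V.obj k)
        (w : ∀ i, W.obj (m i)) (σ : Equiv.Perm (Fin k)) (d : Fin k → ℤ),
        (∀ i, w i ∈ (W.obj (m i)).gr (d i)) ∧
        z = preMk V W m β (V.act k σ v) w -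
          koszulSign K σ d • preMk V W (fun i => m (σ.symm i))
            ((Equiv.sigmaCongrLeft (β := fun i => Fin (m i)) σ.symm).trans β) v
            (fun i => w (σ.symm i))})

/-- The class of a generator in the composition product. It is the operation
`y ↦ v (w 1 (y (β 1 1), …), …, w k (y (β k 1), …))` of `n` inputs `y 1, …, y n`. -/
noncomputable def compMk (V W : SMod K) {n k : ℕ} (m : Fin k → ℕ) (β : (Σ i, Fin (m i)) ≃ Fin n)
    (v : V.obj k) (w : ∀ i, W.obj (m i)) : CompPre V W n ⧸ compRel V W n :=
  (compRel V W n).mkQ (preMk V W m β v w)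

/-- Relabelling of the inputs, on the direct sum over all shapes. -/
noncomputable def preAct (V W : SMod K) (n : ℕ) (τ : Equiv.Perm (Fin n)) :
    CompPre V W n →ₗ[K] CompPre V W n :=
  DirectSum.toModule K (CompIdx n) _ fun p =>
    DirectSum.lof K (CompIdx n) (fun p => V.obj p.1 ⊗[K] (⨂[K] i, W.obj (p.2.1 i)))
      ⟨p.1, p.2.1, p.2.2.trans τ.symm⟩

theorem preAct_preMk (V W : SMod K) {n k : ℕ} (τ : Equiv.Perm (Fin n)) (m : Fin k → ℕ)
    (β : (Σ i, Fin (m i)) ≃ Fin n) (v : V.obj k) (w : ∀ i, W.obj (m i)) :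
    preAct V W n τ (preMk V W m β v w) = preMk V W m (β.trans τ.symm) v w := by
  simp only [preAct, preMk, DirectSum.toModule_lof]

theorem preAct_rel (V W : SMod K) (n : ℕ) (τ : Equiv.Perm (Fin n)) :
    compRel V W n ≤ (compRel V W n).comap (preAct V W n τ) := by
  refine Submodule.span_le.2 ?_
  rintro _ (⟨k, m, β, v, w, σ, rfl⟩ | ⟨k, m, β, v, w, σ, d, hw, rfl⟩)
  · refine Submodule.subset_span (Or.inl ⟨k, m, β.trans τ.symm, v, w, σ, ?_⟩)
    rw [map_sub, preAct_preMk, preAct_preMk]; rfl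
  · refine Submodule.subset_span (Or.inr ⟨k, m, β.trans τ.symm, v, w, σ, d, hw, ?_⟩)
    rw [map_sub, map_smul, preAct_preMk, preAct_preMk]; rfl

/-- The composition product `V ∘ W` of symmetric modules. -/
noncomputable abbrev comp (V W : SMod K) : SMod K where
  obj n :=
    { carrier := CompPre V W n ⧸ compRel V W n
      gr := fun e => Submodule.span K {z | ∃ (k : ℕ) (m : Fin k → ℕ)
        (β : (Σ i, Fin (m i)) ≃ Fin n) (v : V.obj k) (w : ∀ i, W.obj (m i)) (e₀ : ℤ)
        (d : Fin k → ℤ), v ∈ (V.obj k).gr e₀ ∧ (∀ i, w i ∈ (W.obj (m i)).gr (d i)) ∧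
        e₀ + ∑ i, d i = e ∧ z = compMk V W m β v w} }
  act n τ := Submodule.mapQ _ _ (preAct V W n τ) (preAct_rel V W n τ)

theorem act_compMk (V W : SMod K) {n k : ℕ} (τ : Equiv.Perm (Fin n)) (m : Fin k → ℕ)
    (β : (Σ i, Fin (m i)) ≃ Fin n) (v : V.obj k) (w : ∀ i, W.obj (m i)) :
    (comp V W).act n τ (compMk V W m β v w) = compMk V W m (β.trans τ.symm) v w := by
  simp only [compMk, Submodule.mkQ_apply, Submodule.mapQ_apply, preAct_preMk]

/-- The map `f ∘ g` on the direct sum over all shapes. -/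
noncomputable def preMap {V V' W W' : SMod K} (f : Hom V V') (g : Hom W W') (n : ℕ) :
    CompPre V W n →ₗ[K] CompPre V' W' n :=
  DirectSum.toModule K (CompIdx n) _ fun p =>
    DirectSum.lof K (CompIdx n) (fun p => V'.obj p.1 ⊗[K] (⨂[K] i, W'.obj (p.2.1 i))) p ∘ₗ
      TensorProduct.map (f.app p.1).lin (PiTensorProduct.map fun i => (g.app (p.2.1 i)).lin)

theorem preMap_preMk {V V' W W' : SMod K} (f : Hom V V') (g : Hom W W') {n k : ℕ} (m : Fin k → ℕ)
    (β : (Σ i, Fin (m i)) ≃ Fin n) (v : V.obj k) (w : ∀ i, W.obj (m i)) :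
    preMap f g n (preMk V W m β v w) =
      preMk V' W' m β ((f.app k).lin v) (fun i => (g.app (m i)).lin (w i)) := by
  simp only [preMap, preMk, DirectSum.toModule_lof, LinearMap.comp_apply, TensorProduct.map_tmul,
    PiTensorProduct.map_tprod]

theorem preMap_rel {V V' W W' : SMod K} (f : Hom V V') (g : Hom W W') (n : ℕ) :
    compRel V W n ≤ (compRel V' W' n).comap (preMap f g n) := by
  refine Submodule.span_le.2 ?_
  rintro _ (⟨k, m, β, v, w, σ, rfl⟩ | ⟨k, m, β, v, w, σ, d, hw, rfl⟩)
  · refine Submodule.subset_span (Or.inl ⟨k, m, β, (f.app k).lin v,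
      fun i => (g.app (m i)).lin (w i), σ, ?_⟩)
    simp only [map_sub, preMap_preMk, g.equivariant]
  · refine Submodule.subset_span (Or.inr ⟨k, m, β, (f.app k).lin v,
      fun i => (g.app (m i)).lin (w i), σ, d, fun i => (g.app (m i)).map_gr _ _ (hw i), ?_⟩)
    simp only [map_sub, map_smul, preMap_preMk, f.equivariant]

/-- The map `f ∘ g : V ∘ W → V' ∘ W'`. -/
noncomputable def compMap {V V' W W' : SMod K} (f : Hom V V') (g : Hom W W') :
    Hom (comp V W) (comp V' W') where
  app n :=
    { lin := Submodule.mapQ _ _ (preMap f g n) (preMap_rel f g n)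
      map_gr := fun e z hz => by
        have : Submodule.map (Submodule.mapQ _ _ (preMap f g n) (preMap_rel f g n))
            (((comp V W).obj n).gr e) ≤ ((comp V' W').obj n).gr e := by
          rw [Submodule.map_span_le]
          rintro _ ⟨k, m, β, v, w, e₀, d, hv, hw, he, rfl⟩
          refine Submodule.subset_span ⟨k, m, β, (f.app k).lin v,
            fun i => (g.app (m i)).lin (w i), e₀, d, (f.app k).map_gr _ _ hv,
            fun i => (g.app (m i)).map_gr _ _ (hw i), he, ?_⟩
          simp only [compMk, Submodule.mkQ_apply, Submodule.mapQ_apply, preMap_preMk]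
        exact this (Submodule.mem_map_of_mem hz) }
  equivariant n σ z := by
    obtain ⟨z, rfl⟩ := Submodule.mkQ_surjective _ z
    simp only [Submodule.mkQ_apply, Submodule.mapQ_apply]
    congr 1
    have : preMap f g n ∘ₗ preAct V W n σ = preAct V' W' n σ ∘ₗ preMap f g n := by
      refine DirectSum.linearMap_ext _ fun p => LinearMap.ext fun t => ?_
      simp only [preMap, preAct, LinearMap.comp_apply, DirectSum.toModule_lof]
    exact LinearMap.congr_fun this z

/-! ### Values of symmetric modules on graded modules -/

/-- The direct sum of the modules `V(n) ⊗ D^{⊗ n}`. -/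
abbrev EvalPre (V : SMod K) (D : GMod K) : Type u :=
  ⨁ n : ℕ, V.obj n ⊗[K] (⨂[K] _ : Fin n, D)

/-- The generator `v ⊗ x 1 ⊗ ⋯ ⊗ x n`. -/
noncomputable def preEvalMk (V : SMod K) (D : GMod K) {n : ℕ} (v : V.obj n) (x : Fin n → D) :
    EvalPre V D :=
  DirectSum.lof K ℕ (fun n => V.obj n ⊗[K] (⨂[K] _ : Fin n, D)) n
    (v ⊗ₜ[K] PiTensorProduct.tprod K x)

/-- The relations identifying the action of `S_n` on `V(n)` with permutations of the factors of
`D^{⊗ n}`, with the Koszul sign. -/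
noncomputable def evalRel (V : SMod K) (D : GMod K) : Submodule K (EvalPre V D) :=
  Submodule.span K {z | ∃ (n : ℕ) (v : V.obj n) (x : Fin n → D) (σ : Equiv.Perm (Fin n))
    (d : Fin n → ℤ), (∀ i, x i ∈ D.gr (d i)) ∧
    z = preEvalMk V D (V.act n σ v) x -
      koszulSign K σ d • preEvalMk V D v (fun i => x (σ.symm i))}

/-- The class of a generator `v ⊗ x 1 ⊗ ⋯ ⊗ x n`. -/
noncomputable def evalMk (V : SMod K) (D : GMod K) {n : ℕ} (v : V.obj n) (x : Fin n → D) :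
    EvalPre V D ⧸ evalRel V D :=
  (evalRel V D).mkQ (preEvalMk V D v x)

/-- The graded module `V ∘ D = ⨁ n, V(n) ⊗_{S_n} D^{⊗ n}`, which is the composition product of `V`
with the symmetric module that is `D` in arity `0` and zero in the other arities. -/
noncomputable abbrev eval (V : SMod K) (D : GMod K) : GMod K where
  carrier := EvalPre V D ⧸ evalRel V D
  gr e := Submodule.span K {z | ∃ (n : ℕ) (v : V.obj n) (x : Fin n → D) (e₀ : ℤ) (d : Fin n → ℤ),
    v ∈ (V.obj n).gr e₀ ∧ (∀ i, x i ∈ D.gr (d i)) ∧ e₀ + ∑ i, d i = e ∧ z = evalMk V D v x}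

/-- The map `f ∘ g` before passing to the quotient. -/
noncomputable def preEvalMap {V V' : SMod K} {D D' : GMod K} (f : Hom V V') (g : GMod.Hom D D') :
    EvalPre V D →ₗ[K] EvalPre V' D' :=
  DirectSum.toModule K ℕ _ fun n =>
    DirectSum.lof K ℕ (fun n => V'.obj n ⊗[K] (⨂[K] _ : Fin n, D')) n ∘ₗ
      TensorProduct.map (f.app n).lin (PiTensorProduct.map fun _ => g.lin)

theorem preEvalMap_mk {V V' : SMod K} {D D' : GMod K} (f : Hom V V') (g : GMod.Hom D D') {n : ℕ}
    (v : V.obj n) (x : Fin n → D) :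
    preEvalMap f g (preEvalMk V D v x) =
      preEvalMk V' D' ((f.app n).lin v) (fun i => g.lin (x i)) := by
  simp only [preEvalMap, preEvalMk, DirectSum.toModule_lof, LinearMap.comp_apply,
    TensorProduct.map_tmul, PiTensorProduct.map_tprod]

theorem preEvalMap_rel {V V' : SMod K} {D D' : GMod K} (f : Hom V V') (g : GMod.Hom D D') :
    evalRel V D ≤ (evalRel V' D').comap (preEvalMap f g) := by
  refine Submodule.span_le.2 ?_
  rintro _ ⟨n, v, x, σ, d, hx, rfl⟩
  refine Submodule.subset_span ⟨n, (f.app n).lin v, fun i => g.lin (x i), σ, d,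
    fun i => g.map_gr _ _ (hx i), ?_⟩
  simp only [map_sub, map_smul, preEvalMap_mk, f.equivariant]

/-- The map `f ∘ g : V ∘ D → V' ∘ D'`. -/
noncomputable def evalMap {V V' : SMod K} {D D' : GMod K} (f : Hom V V') (g : GMod.Hom D D') :
    GMod.Hom (eval V D) (eval V' D') where
  lin := Submodule.mapQ _ _ (preEvalMap f g) (preEvalMap_rel f g)
  map_gr e z hz := by
    have : Submodule.map (Submodule.mapQ _ _ (preEvalMap f g) (preEvalMap_rel f g))
        ((eval V D).gr e) ≤ (eval V' D').gr e := by
      rw [Submodule.map_span_le]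
      rintro _ ⟨n, v, x, e₀, d, hv, hx, he, rfl⟩
      refine Submodule.subset_span ⟨n, (f.app n).lin v, fun i => g.lin (x i), e₀, d,
        (f.app n).map_gr _ _ hv, fun i => g.map_gr _ _ (hx i), he, ?_⟩
      simp only [evalMk, Submodule.mkQ_apply, Submodule.mapQ_apply, preEvalMap_mk]
    exact this (Submodule.mem_map_of_mem hz)

end SMod

namespace SMod

variable {K : Type u} [Field K]

theorem evalMap_id (V : SMod K) (D : GMod K) (z : eval V D) :
    (evalMap (Hom.id V) (D := D) ⟨LinearMap.id, fun _ _ h => h⟩).lin z = z := by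
  obtain ⟨z, rfl⟩ := Submodule.mkQ_surjective _ z
  have : preEvalMap (Hom.id V) (D := D) ⟨LinearMap.id, fun _ _ h => h⟩ = LinearMap.id := by
    refine DirectSum.linearMap_ext _ fun n => ?_
    simp only [preEvalMap, Hom.id, PiTensorProduct.map_id, TensorProduct.map_id]
    ext; simp
  simp only [evalMap, Submodule.mkQ_apply, Submodule.mapQ_apply, this, LinearMap.id_apply]

theorem evalMap_comp (V : SMod K) {D D' D'' : GMod K} (f : GMod.Hom D D') (g : GMod.Hom D' D'')
    (h : GMod.Hom D D'') (hh : h.lin = g.lin ∘ₗ f.lin) (z : eval V D) :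
    (evalMap (Hom.id V) h).lin z =
      (evalMap (Hom.id V) g).lin ((evalMap (Hom.id V) f).lin z) := by
  obtain ⟨z, rfl⟩ := Submodule.mkQ_surjective _ z
  have : preEvalMap (Hom.id V) h = preEvalMap (Hom.id V) g ∘ₗ preEvalMap (Hom.id V) f := by
    refine DirectSum.linearMap_ext _ fun n => LinearMap.ext fun t => ?_
    simp only [preEvalMap, LinearMap.comp_apply, DirectSum.toModule_lof, hh, Hom.id,
      PiTensorProduct.map_comp]
    rw [← LinearMap.comp_apply (TensorProduct.map _ _), ← TensorProduct.map_comp,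
      LinearMap.id_comp]
  simp only [evalMap, Submodule.mkQ_apply, Submodule.mapQ_apply, this, LinearMap.comp_apply]

/-! ### Structure maps of the composition product

The maps below, out of composition products, are given by their graphs: each graph is the linear
span of the pairs (generator, value on the generator), the generators being homogeneous when the
value involves Koszul signs. -/

/-- The Koszul sign by which `w 1, …, w k, u 1, …, u l`, of degrees `d` and `e`, are reordered into
`w 1, u (γ 1 1), u (γ 1 2), …, w 2, u (γ 2 1), …`. -/
noncomputable def assocSign (K : Type u) [Field K] {k l : ℕ} (m : Fin k → ℕ)
    (γ : (Σ i, Fin (m i)) ≃ Fin l) (d : Fin k → ℤ) (e : Fin l → ℤ) : K :=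
  (∏ p : Σ i, Fin (m i), ∏ i, if p.1 < i then ksgn K (e (γ p) * d i) else 1) *
    ∏ p : Σ i, Fin (m i), ∏ q : Σ i, Fin (m i),
      if (p.1 < q.1 ∨ (p.1 = q.1 ∧ (p.2 : ℕ) < q.2)) ∧ γ q < γ p then
        ksgn K (e (γ p) * e (γ q)) else 1

/-- The labelling of the inputs of a three-level tree, seen as a tree of two-level trees. -/
noncomputable def assocLabel {n k l : ℕ} {m : Fin k → ℕ} (γ : (Σ i, Fin (m i)) ≃ Fin l)
    {p : Fin l → ℕ} (β : (Σ a, Fin (p a)) ≃ Fin n) :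
    (Σ i, Fin (∑ j, p (γ ⟨i, j⟩))) ≃ Fin n :=
  (Equiv.sigmaCongrRight fun _ => finSigmaFinEquiv.symm).trans
    ((Equiv.sigmaAssoc fun i j => Fin (p (γ ⟨i, j⟩))).symm.trans
      ((Equiv.sigmaCongrLeft (β := fun a => Fin (p a)) γ).trans β))

/-- Graph of the associativity isomorphism `(V ∘ W) ∘ U ≃ V ∘ (W ∘ U)`. -/
noncomputable def assocGraph (V W U : SMod K) (n : ℕ) :
    Submodule K ((comp (comp V W) U).obj n × (comp V (comp W U)).obj n) :=
  Submodule.span K {z | ∃ (k l : ℕ) (m : Fin k → ℕ) (γ : (Σ i, Fin (m i)) ≃ Fin l)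
    (p : Fin l → ℕ) (β : (Σ a, Fin (p a)) ≃ Fin n) (v : V.obj k) (w : ∀ i, W.obj (m i))
    (u : ∀ a, U.obj (p a)) (d : Fin k → ℤ) (e : Fin l → ℤ),
    (∀ i, w i ∈ (W.obj (m i)).gr (d i)) ∧ (∀ a, u a ∈ (U.obj (p a)).gr (e a)) ∧
    z = (compMk (comp V W) U p β (compMk V W m γ v w) u,
      assocSign K m γ d e • compMk V (comp W U) (fun i => ∑ j, p (γ ⟨i, j⟩)) (assocLabel γ β) v
        (fun i => compMk W U (fun j => p (γ ⟨i, j⟩)) finSigmaFinEquiv (w i)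
          (fun j => u (γ ⟨i, j⟩))))}

/-- Graph of the isomorphism `(V ∘ W) ∘ D ≃ V ∘ (W ∘ D)` for a graded module `D`. -/
noncomputable def evalAssocGraph (V W : SMod K) (D : GMod K) :
    Submodule K (eval (comp V W) D × eval V (eval W D)) :=
  Submodule.span K {z | ∃ (k l : ℕ) (m : Fin k → ℕ) (γ : (Σ i, Fin (m i)) ≃ Fin l)
    (v : V.obj k) (w : ∀ i, W.obj (m i)) (x : Fin l → D) (d : Fin k → ℤ) (e : Fin l → ℤ),
    (∀ i, w i ∈ (W.obj (m i)).gr (d i)) ∧ (∀ a, x a ∈ D.gr (e a)) ∧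
    z = (evalMk (comp V W) D (compMk V W m γ v w) x,
      assocSign K m γ d e • evalMk V (eval W D) v
        (fun i => evalMk W D (w i) (fun j => x (γ ⟨i, j⟩))))}

/-- Graph of `φ ∘ Id : V ∘ W → W`, for a linear form `φ` on `V(1)`, extended by zero to the other
arities. -/
noncomputable def rootGraph (V W : SMod K) (φ : V.obj 1 →ₗ[K] K) (n : ℕ) :
    Submodule K ((comp V W).obj n × W.obj n) :=
  Submodule.span K
    ({z | ∃ (v : V.obj 1) (w : W.obj n),
        z = (compMk V W (fun _ : Fin 1 => n) (Equiv.uniqueSigma fun _ : Fin 1 => Fin n) v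
          (fun _ => w), φ v • w)} ∪
      {z | ∃ (k : ℕ) (m : Fin k → ℕ) (β : (Σ i, Fin (m i)) ≃ Fin n) (v : V.obj k)
        (w : ∀ i, W.obj (m i)), k ≠ 1 ∧ z = (compMk V W m β v w, 0)})

/-- Graph of `φ ∘ Id : V ∘ D → D`, for a linear form `φ` on `V(1)`, extended by zero to the other
arities. -/
noncomputable def evalRootGraph (V : SMod K) (D : GMod K) (φ : V.obj 1 →ₗ[K] K) :
    Submodule K (eval V D × D) :=
  Submodule.span K
    ({z | ∃ (v : V.obj 1) (x : Fin 1 → D), z = (evalMk V D v x, φ v • x 0)} ∪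
      {z | ∃ (n : ℕ) (v : V.obj n) (x : Fin n → D), n ≠ 1 ∧ z = (evalMk V D v x, 0)})

/-- Graph of the map `V ∘ W → V` which applies a multilinear form `Φ` to the elements of `W`, the
form being extended by zero to elements of `W` that are not all of arity `1`. -/
noncomputable def leafGraph (V W : SMod K) (n : ℕ) (Φ : (Fin n → W.obj 1) → K) :
    Submodule K ((comp V W).obj n × V.obj n) :=
  Submodule.span K
    ({z | ∃ (v : V.obj n) (w : Fin n → W.obj 1),
        z = (compMk V W (fun _ : Fin n => 1) (Equiv.sigmaUnique (Fin n) fun _ => Fin 1) v w,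
          Φ w • v)} ∪
      {z | ∃ (k : ℕ) (m : Fin k → ℕ) (β : (Σ i, Fin (m i)) ≃ Fin n) (v : V.obj k)
        (w : ∀ i, W.obj (m i)), (∃ i, m i ≠ 1) ∧ z = (compMk V W m β v w, 0)})

/-- Graph of `d ∘ Id + Id ∘' d'` on `V ∘ W`, for maps `d` of `V` and `d'` of `W` of degree `-1`. -/
noncomputable def coderGraph (V W : SMod K) (d : ∀ n, V.obj n →ₗ[K] V.obj n)
    (d' : ∀ n, W.obj n →ₗ[K] W.obj n) (n : ℕ) :
    Submodule K ((comp V W).obj n × (comp V W).obj n) :=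
  Submodule.span K {z | ∃ (k : ℕ) (m : Fin k → ℕ) (β : (Σ i, Fin (m i)) ≃ Fin n) (v : V.obj k)
    (w : ∀ i, W.obj (m i)) (e₀ : ℤ) (e : Fin k → ℤ), v ∈ (V.obj k).gr e₀ ∧
    (∀ i, w i ∈ (W.obj (m i)).gr (e i)) ∧
    z = (compMk V W m β v w, compMk V W m β (d k v) w +
      ∑ i, ksgn K (e₀ + ∑ j ∈ Finset.Iio i, e j) •
        compMk V W m β v (Function.update w i (d' (m i) (w i))))}

/-- Graph of `d ∘ Id + Id ∘' d'` on `V ∘ D`, for maps `d` of `V` and `d'` of `D` of degree `-1`. -/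
noncomputable def evalCoderGraph (V : SMod K) (D : GMod K) (d : ∀ n, V.obj n →ₗ[K] V.obj n) (d' : D →ₗ[K] D) :
    Submodule K (eval V D × eval V D) :=
  Submodule.span K {z | ∃ (n : ℕ) (v : V.obj n) (x : Fin n → D) (e₀ : ℤ) (e : Fin n → ℤ),
    v ∈ (V.obj n).gr e₀ ∧ (∀ i, x i ∈ D.gr (e i)) ∧
    z = (evalMk V D v x, evalMk V D (d n v) x +
      ∑ i, ksgn K (e₀ + ∑ j ∈ Finset.Iio i, e j) •
        evalMk V D v (Function.update x i (d' (x i))))}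

end SMod

/-! ### Curved conilpotent cooperads -/

/-- Coaugmented graded cooperads: comonoids for the composition product of graded symmetric modules,
with a morphism from the unit. -/
structure CoaugCooperad (K : Type u) [Field K] extends SMod K where
  isSMod : toSMod.IsSMod
  /-- the decomposition map -/
  Δ : SMod.Hom toSMod (SMod.comp toSMod toSMod)
  /-- the counit, in arity `1` -/
  ε : toSMod.obj 1 →ₗ[K] K
  ε_gr : ∀ e c, e ≠ 0 → c ∈ (toSMod.obj 1).gr e → ε c = 0
  coassoc : ∀ n c,
    (((SMod.compMap Δ (SMod.Hom.id toSMod)).app n).lin ((Δ.app n).lin c),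
      ((SMod.compMap (SMod.Hom.id toSMod) Δ).app n).lin ((Δ.app n).lin c)) ∈
      SMod.assocGraph toSMod toSMod toSMod n
  counit_root : ∀ n c, ((Δ.app n).lin c, c) ∈ SMod.rootGraph toSMod toSMod ε n
  counit_leaf : ∀ n c, ((Δ.app n).lin c, c) ∈
    SMod.leafGraph toSMod toSMod n fun w => ∏ i, ε (w i)
  /-- the image of the unit of `K` under the coaugmentation -/
  one : toSMod.obj 1
  one_gr : one ∈ (toSMod.obj 1).gr 0
  ε_one : ε one = 1
  Δ_one : (Δ.app 1).lin one = SMod.compMk toSMod toSMod (fun _ : Fin 1 => 1)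
    (Equiv.uniqueSigma fun _ : Fin 1 => Fin 1) one (fun _ => one)

namespace CoaugCooperad

variable {K : Type u} [Field K]

/-- The filtration by the number of successive decompositions: `radFil 0` is spanned by the
coaugmentation `1`, and `c` is in `radFil (r + 1)` if `Δ c` is the sum of a term with root `1` and of
terms whose non-root elements are all in `radFil r`. -/
noncomputable def radFil (C : CoaugCooperad K) : ℕ → ∀ n, Submodule K (C.obj n)
  | 0, n => Submodule.span K {c | ∃ h : 1 = n, c = h ▸ C.one}
  | r + 1, n => Submodule.comap (C.Δ.app n).lin (Submodule.span K
      ({z | ∃ (m : Fin 1 → ℕ) (β : (Σ i, Fin (m i)) ≃ Fin n) (w : ∀ i, C.obj (m i)),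
          z = SMod.compMk C.toSMod C.toSMod m β C.one w} ∪
        {z | ∃ (k : ℕ) (m : Fin k → ℕ) (β : (Σ i, Fin (m i)) ≃ Fin n) (v : C.obj k)
          (w : ∀ i, C.obj (m i)), (∀ i, w i ∈ radFil C r (m i)) ∧
          z = SMod.compMk C.toSMod C.toSMod m β v w}))

/-- The successive decompositions of any element stop. -/
def IsConilpotent (C : CoaugCooperad K) : Prop := ∀ n (c : C.obj n), ∃ r, c ∈ C.radFil r n

end CoaugCooperad

/-- Curved conilpotent cooperads. -/
structure CurvedCooperad (K : Type u) [Field K] extends CoaugCooperad K where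
  conilpotent : toCoaugCooperad.IsConilpotent
  /-- the coderivation, of degree `-1` -/
  d : ∀ n, toSMod.obj n →ₗ[K] toSMod.obj n
  d_gr : ∀ n e c, c ∈ (toSMod.obj n).gr e → d n c ∈ (toSMod.obj n).gr (e - 1)
  d_act : ∀ n σ c, d n (toSMod.act n σ c) = toSMod.act n σ (d n c)
  Δ_d : ∀ n c, ((Δ.app n).lin c, (Δ.app n).lin (d n c)) ∈ SMod.coderGraph toSMod toSMod d d n
  d_one : d 1 one = 0
  /-- the curvature, of degree `-2` -/
  θ : toSMod.obj 1 →ₗ[K] K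
  θ_gr : ∀ e c, e ≠ 2 → c ∈ (toSMod.obj 1).gr e → θ c = 0
  θ_d : ∀ c, θ (d 1 c) = 0
  /-- `d² = (θ ⊗ Id - Id ⊗ θ) Δ`, where the first term applies `θ` to the root, and the second one
  applies `θ` to one of the other elements and the counit to the remaining ones. -/
  d_d : ∀ n c, ∃ a b, ((Δ.app n).lin c, a) ∈ SMod.rootGraph toSMod toSMod θ n ∧
    ((Δ.app n).lin c, b) ∈ SMod.leafGraph toSMod toSMod n
      (fun w => ∑ i, θ (w i) * ∏ j ∈ Finset.univ.erase i, ε (w j)) ∧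
    d n (d n c) = a - b

/-! ### Coalgebras over a curved cooperad -/

/-- Coalgebras over the curved conilpotent cooperad `C`. -/
structure Cog {K : Type u} [Field K] (C : CurvedCooperad K) extends GMod K where
  isGraded : toGMod.IsGraded
  /-- the decomposition map -/
  Δ : GMod.Hom toGMod (C.toSMod.eval toGMod)
  coassoc : ∀ x,
    ((SMod.evalMap C.Δ ⟨LinearMap.id, fun _ _ h => h⟩).lin (Δ.lin x),
      (SMod.evalMap (SMod.Hom.id C.toSMod) Δ).lin (Δ.lin x)) ∈
      SMod.evalAssocGraph C.toSMod C.toSMod toGMod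
  counit : ∀ x, (Δ.lin x, x) ∈ SMod.evalRootGraph C.toSMod toGMod C.ε
  /-- the coderivation, of degree `-1` -/
  d : toGMod →ₗ[K] toGMod
  d_gr : ∀ n x, x ∈ gr n → d x ∈ gr (n - 1)
  Δ_d : ∀ x, (Δ.lin x, Δ.lin (d x)) ∈ SMod.evalCoderGraph C.toSMod toGMod C.d d
  /-- `d² = (θ ∘ Id) Δ` -/
  d_d : ∀ x, (Δ.lin x, d (d x)) ∈ SMod.evalRootGraph C.toSMod toGMod C.θ

namespace Cog

variable {K : Type u} [Field K] {C : CurvedCooperad K}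

/-- Morphisms of coalgebras over `C`. -/
@[ext]
structure Hom (D D' : Cog C) extends GMod.Hom D.toGMod D'.toGMod where
  comm_d : ∀ x, lin (D.d x) = D'.d (lin x)
  comm_Δ : ∀ x, D'.Δ.lin (lin x) =
    (SMod.evalMap (SMod.Hom.id C.toSMod) toHom).lin (D.Δ.lin x)

instance : Category (Cog C) where
  Hom D D' := Hom D D'
  id D := ⟨⟨LinearMap.id, fun _ _ h => h⟩, fun _ => rfl, fun x => (SMod.evalMap_id _ _ _).symm⟩
  comp f g := ⟨⟨g.lin ∘ₗ f.lin, fun n x h => g.map_gr n _ (f.map_gr n x h)⟩,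
    fun x => by simp [f.comm_d, g.comm_d],
    fun x => by
      rw [SMod.evalMap_comp _ f.toHom g.toHom _ rfl, ← f.comm_Δ, ← g.comm_Δ]; rfl⟩

end Cog

/-! ### The tensor product of a coalgebra over `C` with a cocommutative coalgebra -/

namespace UCocom

variable {K : Type u} [Field K]

/-- The underlying graded module. -/
abbrev toGMod (E : UCocom K) : GMod K := E.obj.X.toGMod

theorem isGraded (E : UCocom K) : E.toGMod.IsGraded := E.obj.X.isGraded

/-- The differential. -/
abbrev d (E : UCocom K) : E.toGMod →ₗ[K] E.toGMod := E.obj.X.d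

/-- The coproduct. -/
abbrev comul (E : UCocom K) : E.toGMod →ₗ[K] E.toGMod ⊗[K] E.toGMod := E.obj.comon.comul.lin

/-- The counit. -/
abbrev counit (E : UCocom K) : E.toGMod →ₗ[K] K := E.obj.comon.counit.lin

/-- The chain map underlying a morphism of coalgebras. -/
abbrev lin {E F : UCocom K} (f : E ⟶ F) : E.toGMod →ₗ[K] F.toGMod := f.hom.hom.lin

/-- The map `x ⊗ (x 1 ⊗ ⋯ ⊗ x n) ↦ x ⊗ x 1 ⊗ ⋯ ⊗ x n`. -/
noncomputable def consMap (M : Type u) [AddCommGroup M] [Module K M] (n : ℕ) :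
    M ⊗[K] (⨂[K] _ : Fin n, M) →ₗ[K] (⨂[K] _ : Fin (n + 1), M) :=
  TensorProduct.lift ((PiTensorProduct.lift (R := K) (s := fun _ : Fin n => M)
    (E := (⨂[K] _ : Fin (n + 1), M))).toLinearMap ∘ₗ
      (PiTensorProduct.tprod K (s := fun _ : Fin (n + 1) => M)).curryLeft)

theorem consMap_tmul (M : Type u) [AddCommGroup M] [Module K M] (n : ℕ) (x : M) (y : Fin n → M) :
    consMap M n (x ⊗ₜ[K] PiTensorProduct.tprod K y) =
      PiTensorProduct.tprod K (Fin.cons x y : Fin (n + 1) → M) := by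
  simp [consMap]

/-- The iterated coproduct `E → E^{⊗ n}`, which is the counit for `n = 0` and the identity for
`n = 1`. -/
noncomputable def iterComul (E : UCocom K) : ∀ n : ℕ, E.toGMod →ₗ[K] (⨂[K] _ : Fin n, E.toGMod)
  | 0 => E.counit.smulRight (PiTensorProduct.tprod K Fin.elim0)
  | n + 1 => consMap E.toGMod n ∘ₗ TensorProduct.map LinearMap.id (iterComul E n) ∘ₗ E.comul

/-- A dg atom of a coalgebra. -/
def IsDGAtom (E : UCocom K) (a : E.toGMod) : Prop :=
  a ≠ 0 ∧ E.comul a = a ⊗ₜ[K] a ∧ E.d a = 0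

end UCocom

namespace Cog

variable {K : Type u} [Field K] {C : CurvedCooperad K}

/-- For `x i` homogeneous of degree `d i`, the map
`e 1 ⊗ ⋯ ⊗ e n ↦ ± c ⊗ (x 1 ⊗ e 1) ⊗ ⋯ ⊗ (x n ⊗ e n)`, where the Koszul sign is that of
the reordering of `x 1, …, x n, e 1, …, e n` into `x 1, e 1, …, x n, e n`. -/
noncomputable def shuffle (V : SMod K) (D : GMod K) (E : UCocom K) {n : ℕ} (c : V.obj n)
    (x : Fin n → D) (d : Fin n → ℤ) :
    (⨂[K] _ : Fin n, E.toGMod) →ₗ[K] V.eval (D.tensor E.toGMod) :=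
  (SMod.evalRel V (D.tensor E.toGMod)).mkQ ∘ₗ
    DirectSum.lof K ℕ (fun n => V.obj n ⊗[K] (⨂[K] _ : Fin n, D.tensor E.toGMod)) n ∘ₗ
      TensorProduct.mk K (V.obj n) (⨂[K] _ : Fin n, D.tensor E.toGMod) c ∘ₗ
        PiTensorProduct.map fun i => TensorProduct.mk K D E.toGMod (x i) ∘ₗ
          GMod.sgn E.isGraded (∑ j ∈ Finset.Ioi i, d j)

/-- Graph of the map
`(V ∘ D) ⊗ E = ⨁ V(n) ⊗_{S_n} D^{⊗ n} ⊗ E → ⨁ V(n) ⊗_{S_n} (D ⊗ E)^{⊗ n} = V ∘ (D ⊗ E)` given by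
the iterated coproducts `E → E^{⊗ n}` and by the reordering of the factors. -/
noncomputable def shuffleGraph (V : SMod K) (D : GMod K) (E : UCocom K) :
    Submodule K ((V.eval D ⊗[K] E.toGMod) × V.eval (D.tensor E.toGMod)) :=
  Submodule.span K {z | ∃ (n : ℕ) (c : V.obj n) (x : Fin n → D) (d : Fin n → ℤ) (y : E.toGMod),
    (∀ i, x i ∈ D.gr (d i)) ∧
    z = (SMod.evalMk V D c x ⊗ₜ[K] y, shuffle V D E c x d (E.iterComul n y))}

/-- An isomorphism of the graded module underlying `T` with `D ⊗ E` exhibits the coalgebra `T` over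
`C` as the tensor product `D ⊗ E`: the coderivation of `T` is that of the tensor product, and its
decomposition map is the composite
`D ⊗ E → ⨁ C(n) ⊗_{S_n} D^{⊗ n} ⊗ E^{⊗ n} → ⨁ C(n) ⊗_{S_n} (D ⊗ E)^{⊗ n}`. -/
structure IsTensor (D : Cog C) (E : UCocom K) (T : Cog C)
    (φ : T.toGMod ≃ₗ[K] D.toGMod ⊗[K] E.toGMod) : Prop where
  map_gr : ∀ n t, t ∈ T.gr n ↔ φ t ∈ (D.toGMod.tensor E.toGMod).gr n
  map_d : ∀ t, φ (T.d t) = GMod.tensorD D.isGraded D.d E.d (φ t)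
  map_Δ : ∀ (x : D.toGMod) (y : E.toGMod),
    (D.Δ.lin x ⊗ₜ[K] y,
      (SMod.evalMap (SMod.Hom.id C.toSMod)
        (D := T.toGMod) (D' := D.toGMod.tensor E.toGMod)
        ⟨φ.toLinearMap, fun n t ht => (map_gr n t).1 ht⟩).lin (T.Δ.lin (φ.symm (x ⊗ₜ[K] y)))) ∈
      shuffleGraph C.toSMod D.toGMod E

end Cog

/-! ### Tensored, cotensored and enriched categories -/

open Opposite MonoidalRightAction

/-- A category `C` that is tensored, cotensored and enriched over a monoidal category `E`: a right
action `X ⊙ᵣ A` of `E` on `C`, functors `hom X Y` and `cot A Y`, and isomorphisms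
`Hom (X ⊙ᵣ A, Y) ≃ Hom (A, hom X Y)` and `Hom (X ⊙ᵣ A, Y) ≃ Hom (X, cot A Y)`, natural in `X`, `A`
and `Y`. -/
structure TensoredCotensoredEnriched (E : Type*) [Category* E] [MonoidalCategory E] (C : Type*)
    [Category* C] where
  action : MonoidalRightAction E C
  hom : Cᵒᵖ ⥤ C ⥤ E
  cot : Eᵒᵖ ⥤ C ⥤ C
  homEquiv : ∀ (X : C) (A : E) (Y : C), (X ⊙ᵣ A ⟶ Y) ≃ (A ⟶ (hom.obj (op X)).obj Y)
  cotEquiv : ∀ (X : C) (A : E) (Y : C), (X ⊙ᵣ A ⟶ Y) ≃ (X ⟶ (cot.obj (op A)).obj Y)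
  homEquiv_natural : ∀ {X X' : C} {A A' : E} {Y Y' : C} (f : X' ⟶ X) (a : A' ⟶ A) (g : Y ⟶ Y')
    (h : X ⊙ᵣ A ⟶ Y), homEquiv X' A' Y' ((f ⊙ᵣₘ a) ≫ h ≫ g) =
      a ≫ homEquiv X A Y h ≫ (hom.map f.op).app Y ≫ (hom.obj (op X')).map g
  cotEquiv_natural : ∀ {X X' : C} {A A' : E} {Y Y' : C} (f : X' ⟶ X) (a : A' ⟶ A) (g : Y ⟶ Y')
    (h : X ⊙ᵣ A ⟶ Y), cotEquiv X' A' Y' ((f ⊙ᵣₘ a) ≫ h ≫ g) =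
      f ≫ cotEquiv X A Y h ≫ (cot.map a.op).app Y ≫ (cot.obj (op A')).map g

/-- The evaluation morphism `X ⊙ᵣ hom X Y ⟶ Y`, which corresponds to the identity of `hom X Y`. -/
def TensoredCotensoredEnriched.ev {E : Type*} [Category* E] [MonoidalCategory E] {C : Type*}
    [Category* C] (T : TensoredCotensoredEnriched E C) (X Y : C) :
    T.action.actionObj X ((T.hom.obj (op X)).obj Y) ⟶ Y :=
  (T.homEquiv X _ Y).symm (𝟙 _)

namespace Cog

variable {K : Type u} [Field K] {C : CurvedCooperad K}

/-- A right action of cocommutative coalgebras on the coalgebras over `C` is given by the tensor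
product: `φ D E` identifies the result of the action with the coalgebra `D ⊗ E`, naturally, in such
a way that the associativity and unit isomorphisms of the action are those of the tensor product of
`K`-modules. -/
structure IsTensorAction (A : MonoidalRightAction (UCocom K) (Cog C))
    (φ : ∀ (D : Cog C) (E : UCocom K),
      (A.actionObj D E).toGMod ≃ₗ[K] D.toGMod ⊗[K] E.toGMod) : Prop where
  isTensor : ∀ D E, IsTensor D E (A.actionObj D E) (φ D E)
  map_actionHom : ∀ {D D' : Cog C} {E E' : UCocom K} (f : D ⟶ D') (g : E ⟶ E')
    (t : (A.actionObj D E).toGMod),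
    φ D' E' ((A.actionHom f g).lin t) = TensorProduct.map f.lin (UCocom.lin g) (φ D E t)
  map_assoc : ∀ (D : Cog C) (E F : UCocom K) (t : (A.actionObj D (E ⊗ F)).toGMod),
    TensorProduct.assoc K D.toGMod E.toGMod F.toGMod
      (TensorProduct.map (φ D E).toLinearMap LinearMap.id
        (φ (A.actionObj D E) F ((A.actionAssocIso D E F).hom.lin t))) = φ D (E ⊗ F) t
  map_unit : ∀ (D : Cog C) (t : (A.actionObj D (𝟙_ (UCocom K))).toGMod),
    (A.actionUnitIso D).hom.lin t = TensorProduct.rid K D.toGMod (φ D (𝟙_ (UCocom K)) t)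

end Cog

/-!
The tensor product `D ⊗ E` of a coalgebra over a curved cooperad with a dg cocommutative coalgebra
is constructed through a shuffle map `(V ∘ D) ⊗ E → V ∘ (D ⊗ E)`, which distributes the iterated
coproduct of an element of `E` over the inputs, with a Koszul sign. It is well defined on the
coinvariants because `E` is cocommutative (`SMod.shufTensor_act`). Each axiom for `D ⊗ E` is the
image of that for `D` under the shuffle map: the counit and the curvature by
`SMod.shuf_mem_rootGraph`, the coderivation property by `SMod.shuf_mem_coderGraph`, and
coassociativity by `SMod.shuf_mem_assocGraph`. The last one rests on `UCocom.iterComul_sum`, which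
says that an iterated coproduct of length `m 1 + ⋯ + m k` consists of iterated coproducts of lengths
`m 1, …, m k` of the factors of one of length `k`. In the convolution algebra of linear maps from
`E` to its tensor algebra, iterated coproducts are the powers of the inclusion, and the claim is the
rule for products of powers. The linear isomorphisms `D ⊗ (E ⊗ F) ≃ (D ⊗ E) ⊗ F` and `D ⊗ K ≃ D` are
morphisms of coalgebras by `SMod.shuf_assoc` and `SMod.shuf_unit`, and the axioms of an action hold
since they hold for vector spaces.

The functors `{-, -}` and `⟨-, -⟩` are right adjoints of `D ⊗ -` and `- ⊗ E`, and are obtained from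
the special adjoint functor theorem. Both categories of coalgebras consist of graded modules `X`
with a linear map from `X` to a functor of `X`, subject to axioms that are inherited by quotients of
sums; this is the notion `CoalgebraicFunctor`. In such a category colimits are those of the
underlying modules, so that epimorphisms are surjective and the category is well-copowered. Moreover
any element is contained in a subcoalgebra that is spanned by a countable set
(`Cog.exists_subcoalgebra`, `UCocom.exists_subcoalgebra`): a countable set of elements can be closed
under the homogeneous components, the differential, and the finitely many elements that are involved
in a decomposition and in its compatibility with the differential. Up to isomorphism there is only a
set of coalgebras spanned by countable sets, and they form a separating family. As tensor products
of vector spaces preserve colimits, `D ⊗ -` and `- ⊗ E` do so as well.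

Finally, the atoms of a dg cocommutative coalgebra are the images of `1` under the morphisms from
the unit `K` (`UCocom.atomEquiv`), because an atom has counit `1` and degree `0`. Therefore the
atoms of `{D, D'}` correspond to the morphisms `K → {D, D'}`, which are the morphisms `D ≃ D ⊗ K →
D'`.
-/

/-! ### Koszul signs -/

section Signs

variable (K : Type u) [Field K]

/-- A product over ordered pairs only depends on the diagonal terms and on the products of the two
terms attached to each unordered pair. -/
theorem prod_pairs_congr {ι : Type*} [Fintype ι] [LinearOrder ι] {M : Type*} [CommMonoid M]
    {f g : ι → ι → M} (hdiag : ∀ i, f i i = g i i)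
    (h : ∀ i j, i < j → f i j * f j i = g i j * g j i) : ∏ i, ∏ j, f i j = ∏ i, ∏ j, g i j := by
  have key : ∀ f : ι → ι → M, ∏ i, ∏ j, f i j =
      (∏ i, f i i) * ∏ i, ∏ j, if i < j then f i j * f j i else 1 := by
    intro f
    have h1 : ∀ i j, f i j = ((if i = j then f i j else 1) * (if i < j then f i j else 1)) *
        (if j < i then f i j else 1) := by
      intro i j
      rcases lt_trichotomy i j with h | h | h
      · simp [h, h.ne, h.not_gt]
      · simp [h]
      · simp [h, h.ne', h.not_gt]
    have h2 : ∏ i, ∏ j, (if j < i then f i j else 1) = ∏ i, ∏ j, if i < j then f j i else 1 :=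
      Finset.prod_comm
    calc ∏ i, ∏ j, f i j = ∏ i, ∏ j, (((if i = j then f i j else 1) *
          (if i < j then f i j else 1)) * (if j < i then f i j else 1)) :=
          Finset.prod_congr rfl fun i _ => Finset.prod_congr rfl fun j _ => h1 i j
      _ = _ := by
        simp only [Finset.prod_mul_distrib, h2, Finset.prod_ite_eq, Finset.mem_univ, if_true]
        rw [mul_assoc, ← Finset.prod_mul_distrib]
        congr 1
        refine Finset.prod_congr rfl fun i _ => ?_
        rw [← Finset.prod_mul_distrib]
        refine Finset.prod_congr rfl fun j _ => ?_
        split_ifs <;> simp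
  rw [key f, key g]
  congr 1
  · exact Finset.prod_congr rfl fun i _ => hdiag i
  · refine Finset.prod_congr rfl fun i _ => Finset.prod_congr rfl fun j _ => ?_
    split_ifs with hij
    · exact h i j hij
    · rfl

theorem ksgn_sum {ι : Type*} (s : Finset ι) (f : ι → ℤ) :
    ksgn K (∑ i ∈ s, f i) = ∏ i ∈ s, ksgn K (f i) := by
  classical
  induction s using Finset.induction_on with
  | empty => simp [ksgn_zero]
  | insert a s ha ih => rw [Finset.sum_insert ha, Finset.prod_insert ha, ksgn_add, ih]

theorem ksgn_congr {m n : ℤ} (h : Even (m - n)) : ksgn K m = ksgn K n := by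
  have := ksgn_add K (m - n) n
  rwa [sub_add_cancel, ksgn_even K h, one_mul] at this

/-- The Koszul sign of the reordering of `x 1, …, x n, y 1, …, y n`, of degrees `d` and `e`, into
`x 1, y 1, …, x n, y n`. -/
def shufSign {n : ℕ} (d e : Fin n → ℤ) : K :=
  ∏ i, ∏ j, if i < j then ksgn K (d j * e i) else 1

theorem shufSign_eq_right {n : ℕ} (d e : Fin n → ℤ) :
    shufSign K d e = ∏ i, ksgn K ((∑ j ∈ Finset.Ioi i, d j) * e i) := by
  refine Finset.prod_congr rfl fun i _ => ?_
  rw [Finset.sum_mul, ksgn_sum, ← Finset.prod_filter]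
  refine Finset.prod_congr ?_ fun _ _ => rfl
  ext; simp

theorem shufSign_eq_left {n : ℕ} (d e : Fin n → ℤ) :
    shufSign K d e = ∏ i, ksgn K ((∑ j ∈ Finset.Iio i, e j) * d i) := by
  rw [shufSign, Finset.prod_comm]
  refine Finset.prod_congr rfl fun i _ => ?_
  rw [Finset.sum_mul, ksgn_sum, ← Finset.prod_filter]
  refine Finset.prod_congr ?_ fun _ _ => by rw [mul_comm]
  ext; simp

theorem shufSign_add_left {n : ℕ} (d d' e : Fin n → ℤ) :
    shufSign K (fun i => d i + d' i) e = shufSign K d e * shufSign K d' e := by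
  simp only [shufSign, ← Finset.prod_mul_distrib]
  refine Finset.prod_congr rfl fun i _ => Finset.prod_congr rfl fun j _ => ?_
  split_ifs
  · rw [add_mul, ksgn_add]
  · simp

theorem shufSign_add_right {n : ℕ} (d e e' : Fin n → ℤ) :
    shufSign K d (fun i => e i + e' i) = shufSign K d e * shufSign K d e' := by
  simp only [shufSign, ← Finset.prod_mul_distrib]
  refine Finset.prod_congr rfl fun i _ => Finset.prod_congr rfl fun j _ => ?_
  split_ifs
  · rw [mul_add, ksgn_add]
  · simp

/-- The cocycle property of the Koszul sign. -/
theorem koszulSign_mul {n : ℕ} (σ τ : Equiv.Perm (Fin n)) (d : Fin n → ℤ) :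
    koszulSign K (σ * τ) d = koszulSign K τ d * koszulSign K σ (fun i => d (τ.symm i)) := by
  have h : koszulSign K σ (fun i => d (τ.symm i)) =
      ∏ i, ∏ j, if τ i < τ j ∧ σ (τ j) < σ (τ i) then ksgn K (d i * d j) else 1 := by
    rw [koszulSign, ← Equiv.prod_comp τ]
    refine Finset.prod_congr rfl fun i _ => ?_
    rw [← Equiv.prod_comp τ]
    simp
  rw [h, koszulSign, koszulSign, ← Finset.prod_mul_distrib]
  simp only [← Finset.prod_mul_distrib]
  refine prod_pairs_congr (fun i => by simp) fun i j hij => ?_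
  have h1 : ¬ j < i := hij.not_gt
  have hτ : τ i ≠ τ j := τ.injective.ne hij.ne
  have hστ : σ (τ i) ≠ σ (τ j) := σ.injective.ne hτ
  have hc : ksgn K (d j * d i) = ksgn K (d i * d j) := by rw [mul_comm]
  have hs := ksgn_mul_self K (d i * d j)
  simp only [Equiv.Perm.mul_apply, hij, h1, true_and, false_and, if_false, one_mul, mul_one, hc]
  rcases lt_or_gt_of_ne hτ with h2 | h2 <;> rcases lt_or_gt_of_ne hστ with h3 | h3 <;>
    simp [h2, h2.not_gt, h3, h3.not_gt, hs]

/-- Permuting pairs `(x i, y i)` after a shuffle, or the two families before it. -/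
theorem shufSign_mul_koszulSign {n : ℕ} (σ : Equiv.Perm (Fin n)) (d e : Fin n → ℤ) :
    shufSign K d e * koszulSign K σ (fun i => d i + e i) =
      koszulSign K σ d * koszulSign K σ e *
        shufSign K (fun i => d (σ.symm i)) (fun i => e (σ.symm i)) := by
  have h : shufSign K (fun i => d (σ.symm i)) (fun i => e (σ.symm i)) =
      ∏ i, ∏ j, if σ i < σ j then ksgn K (d j * e i) else 1 := by
    rw [shufSign, ← Equiv.prod_comp σ]
    refine Finset.prod_congr rfl fun i _ => ?_
    rw [← Equiv.prod_comp σ]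
    simp
  rw [h]
  simp only [koszulSign, shufSign, ← Finset.prod_mul_distrib]
  refine prod_pairs_congr (fun i => by simp) fun i j hij => ?_
  have h1 : ¬ j < i := hij.not_gt
  have hσ : σ i ≠ σ j := σ.injective.ne hij.ne
  simp only [hij, h1, true_and, false_and, if_false, one_mul, mul_one, if_true]
  rcases lt_or_gt_of_ne hσ with h2 | h2 <;> simp only [h2, h2.not_gt, if_true, if_false, mul_one,
    one_mul]
  have hs := ksgn_mul_self K (d j * e i)
  rw [show (d i + e i) * (d j + e j) = d i * d j + e i * e j + (d j * e i + d i * e j) by ring,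
    ksgn_add, ksgn_add, ksgn_add]
  linear_combination (ksgn K (d i * d j) * ksgn K (e i * e j) * ksgn K (d i * e j)) * hs

theorem koszulSign_one {n : ℕ} (d : Fin n → ℤ) : koszulSign K 1 d = 1 := by
  refine Finset.prod_eq_one fun i _ => Finset.prod_eq_one fun j _ => if_neg ?_
  rintro ⟨h, h'⟩
  exact absurd h h'.not_gt

/-- For an adjacent transposition only the pair of exchanged elements contributes to the sign. -/
theorem koszulSign_swap {n : ℕ} (i : Fin (n + 1)) (d : Fin (n + 2) → ℤ) :
    koszulSign K (Equiv.swap i.castSucc i.succ) d = ksgn K (d i.castSucc * d i.succ) := by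
  have key : ∀ a b : Fin (n + 2), (a < b ∧ Equiv.swap i.castSucc i.succ b <
      Equiv.swap i.castSucc i.succ a) ↔ (a = i.castSucc ∧ b = i.succ) := by
    intro a b
    simp only [Equiv.swap_apply_def, Fin.ext_iff, Fin.lt_def]
    constructor
    · rintro ⟨h1, h2⟩
      split_ifs at h2 <;> simp_all <;> omega
    · rintro ⟨h1, h2⟩
      simp [h1, h2]
  simp only [koszulSign, key]
  rw [Finset.prod_eq_single i.castSucc, Finset.prod_eq_single i.succ]
  · simp
  · intro b _ hb; simp [hb]
  · simp
  · intro a _ ha; simp [ha]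
  · simp

end Signs

/-! ### Multilinear maps and homogeneous tensors -/

section Multilinear

variable {K : Type u} [Field K]

/-- A multilinear map sends spans into a submodule as soon as it does so on generators. -/
theorem MultilinearMap.mem_of_mem_span {ι : Type*} [Fintype ι] {G : ι → Type*}
    [∀ i, AddCommGroup (G i)] [∀ i, Module K (G i)] {M : Type*} [AddCommGroup M] [Module K M]
    (f : MultilinearMap K G M) (H : ∀ i, Set (G i)) (S : Submodule K M)
    (h : ∀ x, (∀ i, x i ∈ H i) → f x ∈ S) (x : ∀ i, G i) (hx : ∀ i, x i ∈ Submodule.span K (H i)) :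
    f x ∈ S := by
  classical
  have key : ∀ s : Finset ι, ∀ x : ∀ i, G i, (∀ i, i ∈ s → x i ∈ Submodule.span K (H i)) →
      (∀ i, i ∉ s → x i ∈ H i) → f x ∈ S := by
    intro s
    induction s using Finset.induction_on with
    | empty => exact fun x _ hx => h x fun i => hx i (by simp)
    | insert a s ha ih =>
      intro x hx hx'
      have hle : Submodule.span K (H a) ≤ S.comap (f.toLinearMap x a) := by
        refine Submodule.span_le.2 fun y hy => ?_
        refine ih _ (fun i hi => ?_) (fun i hi => ?_)
        · have : i ≠ a := fun h => ha (h ▸ hi)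
          rw [Function.update_of_ne this]
          exact hx i (by simp [hi])
        · by_cases hia : i = a
          · subst hia; simpa using hy
          · rw [Function.update_of_ne hia]
            exact hx' i (by simp [hi, hia])
      have := hle (hx a (by simp))
      simpa using this
  exact key Finset.univ x (fun i _ => hx i) (fun i hi => absurd (Finset.mem_univ i) hi)

theorem GMod.mem_span_homogeneous {D : GMod K} (hD : D.IsGraded) (x : D) :
    x ∈ Submodule.span K {y : D | ∃ n, y ∈ D.gr n} :=
  GMod.hom_induction hD (p := fun x => x ∈ Submodule.span K {y : D | ∃ n, y ∈ D.gr n})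
    (fun n _ hx => Submodule.subset_span ⟨n, hx⟩) (Submodule.zero_mem _)
    (fun _ _ => Submodule.add_mem _) x

theorem MultilinearMap.mem_of_homogeneous {ι : Type*} [Fintype ι] {D : GMod K} (hD : D.IsGraded)
    {M : Type*} [AddCommGroup M] [Module K M] (f : MultilinearMap K (fun _ : ι => D.carrier) M)
    (S : Submodule K M)
    (h : ∀ (x : ι → D) (d : ι → ℤ), (∀ i, x i ∈ D.gr (d i)) → f x ∈ S) (x : ι → D) : f x ∈ S := by
  refine f.mem_of_mem_span (fun _ => {y : D | ∃ n, y ∈ D.gr n}) S (fun x hx => ?_) x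
    (fun i => GMod.mem_span_homogeneous hD (x i))
  choose d hd using hx
  exact h x d hd

/-- A linear map on a tensor power sends everything into a submodule as soon as it does so on
tensors of homogeneous elements. -/
theorem tprod_homogeneous_induction {ι : Type*} [Fintype ι] {D : GMod K} (hD : D.IsGraded)
    {M : Type*} [AddCommGroup M] [Module K M] (f : (⨂[K] _ : ι, D.carrier) →ₗ[K] M)
    (S : Submodule K M)
    (h : ∀ (x : ι → D) (d : ι → ℤ), (∀ i, x i ∈ D.gr (d i)) → f (PiTensorProduct.tprod K x) ∈ S)
    (t : ⨂[K] _ : ι, D.carrier) : f t ∈ S := by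
  induction t using PiTensorProduct.induction_on with
  | smul_tprod r x =>
    rw [map_smul]
    exact S.smul_mem _ ((f.compMultilinearMap (PiTensorProduct.tprod K)).mem_of_homogeneous hD S
      h x)
  | add s t hs ht => rw [map_add]; exact S.add_mem hs ht

/-- Linear maps on a tensor power that agree on tensors of homogeneous elements are equal. -/
theorem tprod_homogeneous_ext {ι : Type*} [Fintype ι] {D : GMod K} (hD : D.IsGraded)
    {M : Type*} [AddCommGroup M] [Module K M] {f g : (⨂[K] _ : ι, D.carrier) →ₗ[K] M}
    (h : ∀ (x : ι → D) (d : ι → ℤ), (∀ i, x i ∈ D.gr (d i)) →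
      f (PiTensorProduct.tprod K x) = g (PiTensorProduct.tprod K x)) : f = g := by
  refine LinearMap.ext fun t => ?_
  have := tprod_homogeneous_induction hD (f - g) ⊥ (fun x d hx => by simp [h x d hx]) t
  simpa [sub_eq_zero] using this

end Multilinear

/-! ### The reordering of a tensor product of tensor powers -/

namespace SMod

variable {K : Type u} [Field K]

/-- The map `v, x 1 ⊗ ⋯ ⊗ x n ↦ v ⊗ x 1 ⊗ ⋯ ⊗ x n`, with values in `V ∘ D`. -/
noncomputable def evalLin (V : SMod K) (D : GMod K) (n : ℕ) :
    V.obj n →ₗ[K] (⨂[K] _ : Fin n, D) →ₗ[K] V.eval D :=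
  (TensorProduct.mk K (V.obj n) (⨂[K] _ : Fin n, D)).compr₂
    ((SMod.evalRel V D).mkQ ∘ₗ
      DirectSum.lof K ℕ (fun n => V.obj n ⊗[K] (⨂[K] _ : Fin n, D)) n)

theorem evalLin_tprod (V : SMod K) (D : GMod K) {n : ℕ} (v : V.obj n) (x : Fin n → D) :
    evalLin V D n v (PiTensorProduct.tprod K x) = evalMk V D v x := rfl

theorem evalMap_mk {V V' : SMod K} {D D' : GMod K} (f : Hom V V') (g : GMod.Hom D D') {n : ℕ}
    (v : V.obj n) (x : Fin n → D) :
    (evalMap f g).lin (evalMk V D v x) = evalMk V' D' ((f.app n).lin v) (fun i => g.lin (x i)) := by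
  simp only [evalMap, evalMk, Submodule.mkQ_apply, Submodule.mapQ_apply, preEvalMap_mk]

theorem evalMk_act (V : SMod K) (D : GMod K) {n : ℕ} (σ : Equiv.Perm (Fin n)) (v : V.obj n)
    (x : Fin n → D) (d : Fin n → ℤ) (hx : ∀ i, x i ∈ D.gr (d i)) :
    evalMk V D (V.act n σ v) x = koszulSign K σ d • evalMk V D v (fun i => x (σ.symm i)) := by
  rw [← sub_eq_zero]
  simp only [evalMk, ← map_smul, ← map_sub]
  exact (Submodule.Quotient.mk_eq_zero _).2 (Submodule.subset_span ⟨n, v, x, σ, d, hx, rfl⟩)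

theorem evalMk_mem_gr (V : SMod K) (D : GMod K) {n : ℕ} {v : V.obj n} {x : Fin n → D} {e₀ e : ℤ}
    {d : Fin n → ℤ} (hv : v ∈ (V.obj n).gr e₀) (hx : ∀ i, x i ∈ D.gr (d i))
    (h : e₀ + ∑ i, d i = e) : evalMk V D v x ∈ (V.eval D).gr e :=
  Submodule.subset_span ⟨n, v, x, e₀, d, hv, hx, h, rfl⟩

/-- Two linear maps on `V ∘ D` that agree on generators are equal. -/
theorem eval_hom_ext {V : SMod K} {D : GMod K} {M : Type*} [AddCommGroup M] [Module K M]
    {f g : V.eval D →ₗ[K] M}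
    (h : ∀ (n : ℕ) (v : V.obj n) (x : Fin n → D), f (evalMk V D v x) = g (evalMk V D v x)) :
    f = g := by
  refine Submodule.linearMap_qext _ (DirectSum.linearMap_ext _ fun n => ?_)
  refine TensorProduct.ext (LinearMap.ext fun v => PiTensorProduct.ext ?_)
  exact MultilinearMap.ext fun x => h n v x

theorem eval_induction {V : SMod K} {D : GMod K} (S : Submodule K (V.eval D))
    (h : ∀ (n : ℕ) (v : V.obj n) (x : Fin n → D), evalMk V D v x ∈ S) (z : V.eval D) : z ∈ S := by
  have : S.mkQ = 0 := eval_hom_ext fun n v x => by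
    simpa using h n v x
  have hz := LinearMap.congr_fun this z
  simpa using hz

theorem eval_homogeneous_induction {V : SMod K} {D : GMod K} (hV : ∀ n, (V.obj n).IsGraded)
    (hD : D.IsGraded) (S : Submodule K (V.eval D))
    (h : ∀ (n : ℕ) (v : V.obj n) (x : Fin n → D) (e₀ : ℤ) (d : Fin n → ℤ), v ∈ (V.obj n).gr e₀ →
      (∀ i, x i ∈ D.gr (d i)) → evalMk V D v x ∈ S) (z : V.eval D) : z ∈ S := by
  refine eval_induction S (fun n v x => ?_) z
  refine GMod.hom_induction (hV n) (p := fun v => evalMk V D v x ∈ S) ?_ ?_ ?_ v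
  · intro e₀ v hv
    exact ((evalLin V D n v).compMultilinearMap (PiTensorProduct.tprod K)).mem_of_homogeneous hD S
      (fun x d hx => h n v x e₀ d hv hx) x
  · change evalLin V D n 0 _ ∈ S
    simp
  · intro v w hv hw
    change evalLin V D n (v + w) _ ∈ S
    rw [map_add]
    exact S.add_mem hv hw

end SMod

namespace GMod

variable {K : Type u} [Field K]

/-- The projection on the elements of the degrees with a given parity. -/
noncomputable def parityProj {G : GMod K} (hG : G.IsGraded) (ε : ZMod 2) : G →ₗ[K] G :=
  glue hG fun n => if (n : ZMod 2) = ε then LinearMap.id else 0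

theorem parityProj_apply {G : GMod K} (hG : G.IsGraded) (ε : ZMod 2) {n : ℤ} {y : G}
    (hy : y ∈ G.gr n) : parityProj hG ε y = if (n : ZMod 2) = ε then y else 0 := by
  rw [parityProj, glue_apply hG _ hy]
  split_ifs <;> rfl

/-- A linear operator which is `x ↦ (-1) ^ |x| x` on homogeneous elements. -/
def IsParity (D : GMod K) (s : D →ₗ[K] D) : Prop := ∀ n x, x ∈ D.gr n → s x = ksgn K n • x

theorem IsParity.pow {D : GMod K} {s : D →ₗ[K] D} (hs : D.IsParity s) {n : ℤ} {x : D}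
    (hx : x ∈ D.gr n) (k : ℕ) : (s ^ k) x = ksgn K (k * n) • x := by
  induction k with
  | zero => simp [ksgn_zero]
  | succ k ih =>
    rw [pow_succ', Module.End.mul_apply, ih, map_smul, hs n x hx, smul_smul, ← ksgn_add]
    congr 2
    push_cast
    ring

theorem isParity_sgn {D : GMod K} (hD : D.IsGraded) : D.IsParity (sgn hD 1) := by
  intro n x hx
  rw [sgn_apply hD 1 hx, one_mul]

/-- The summand of `reorder` for a given pattern of the parities of the elements of `G`. -/
noncomputable def reorderPattern {D G : GMod K} (s : D →ₗ[K] D) (hG : G.IsGraded) {n : ℕ}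
    (ε : Fin n → ZMod 2) :
    MultilinearMap K (fun _ : Fin n => D.carrier)
      ((⨂[K] _ : Fin n, G.carrier) →ₗ[K] (⨂[K] _ : Fin n, (D.tensor G).carrier)) :=
  (PiTensorProduct.mapMultilinear K (fun _ : Fin n => G.carrier)
    (fun _ : Fin n => (D.tensor G).carrier)).compLinearMap fun i =>
      LinearMap.lcomp K (D ⊗[K] G) (parityProj hG (ε i)) ∘ₗ TensorProduct.mk K D G ∘ₗ
        (s ^ (∑ j ∈ Finset.Iio i, (ε j).val))

/-- The map `x 1 ⊗ ⋯ ⊗ x n, y 1 ⊗ ⋯ ⊗ y n ↦ ± (x 1 ⊗ y 1) ⊗ ⋯ ⊗ (x n ⊗ y n)`. It is written in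
terms of the parities of the `y i` and of an operator `s` on `D` which computes the parity, so that
`D` does not need to be the direct sum of its homogeneous parts. -/
noncomputable def reorder {D G : GMod K} (s : D →ₗ[K] D) (hG : G.IsGraded) (n : ℕ) :
    (⨂[K] _ : Fin n, D.carrier) →ₗ[K]
      (⨂[K] _ : Fin n, G.carrier) →ₗ[K] (⨂[K] _ : Fin n, (D.tensor G).carrier) :=
  ∑ ε : Fin n → ZMod 2, PiTensorProduct.lift (reorderPattern s hG ε)

theorem reorder_tprod' {D G : GMod K} (s : D →ₗ[K] D) (hG : G.IsGraded) {n : ℕ} (x : Fin n → D)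
    {y : Fin n → G} {e : Fin n → ℤ} (hy : ∀ i, y i ∈ G.gr (e i)) :
    reorder s hG n (PiTensorProduct.tprod K x) (PiTensorProduct.tprod K y) =
      PiTensorProduct.tprod K fun i =>
        ((s ^ (∑ j ∈ Finset.Iio i, ((e j : ℤ) : ZMod 2).val)) (x i)) ⊗ₜ[K] (y i) := by
  simp only [reorder, LinearMap.sum_apply, PiTensorProduct.lift.tprod]
  rw [Finset.sum_eq_single (fun i => ((e i : ℤ) : ZMod 2))]
  · simp only [reorderPattern, MultilinearMap.compLinearMap_apply]
    rw [PiTensorProduct.mapMultilinear_apply, PiTensorProduct.map_tprod]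
    congr 1
    funext i
    simp only [LinearMap.comp_apply, LinearMap.lcomp_apply, TensorProduct.mk_apply]
    rw [parityProj_apply hG _ (hy i), if_pos rfl]
  · intro ε _ hε
    obtain ⟨i, hi⟩ := Function.ne_iff.1 hε
    simp only [reorderPattern, MultilinearMap.compLinearMap_apply]
    rw [PiTensorProduct.mapMultilinear_apply, PiTensorProduct.map_tprod]
    refine MultilinearMap.map_coord_zero _ i ?_
    simp only [LinearMap.comp_apply, LinearMap.lcomp_apply, TensorProduct.mk_apply]
    rw [parityProj_apply hG _ (hy i), if_neg (fun h => hi h.symm), TensorProduct.tmul_zero]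
  · intro h; exact absurd (Finset.mem_univ _) h

theorem even_val_sub (n : ℤ) : Even ((((n : ZMod 2).val : ℕ) : ℤ) - n) := by
  rw [← ZMod.intCast_eq_zero_iff_even]
  push_cast
  rw [ZMod.natCast_zmod_val, sub_self]

theorem reorder_tprod {D G : GMod K} {s : D →ₗ[K] D} (hs : D.IsParity s) (hG : G.IsGraded) {n : ℕ}
    {x : Fin n → D} {d : Fin n → ℤ} (hx : ∀ i, x i ∈ D.gr (d i))
    {y : Fin n → G} {e : Fin n → ℤ} (hy : ∀ i, y i ∈ G.gr (e i)) :
    reorder s hG n (PiTensorProduct.tprod K x) (PiTensorProduct.tprod K y) =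
      shufSign K d e • PiTensorProduct.tprod K fun i => (x i) ⊗ₜ[K] (y i) := by
  rw [reorder_tprod' s hG x hy]
  have : ∀ i, ((s ^ (∑ j ∈ Finset.Iio i, ((e j : ℤ) : ZMod 2).val)) (x i)) ⊗ₜ[K] (y i) =
      ksgn K ((∑ j ∈ Finset.Iio i, e j) * d i) • ((x i) ⊗ₜ[K] (y i)) := by
    intro i
    rw [hs.pow (hx i), TensorProduct.smul_tmul']
    congr 2
    refine ksgn_congr K ?_
    rw [← sub_mul]
    refine Even.mul_right ?_ _
    push_cast
    rw [← Finset.sum_sub_distrib]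
    exact Finset.even_sum _ fun j _ => even_val_sub _
  simp only [this]
  rw [(PiTensorProduct.tprod K).map_smul_univ, shufSign_eq_left]

/-- `reorder` is natural in both arguments. -/
theorem reorder_natural {D D' G G' : GMod K} {s : D →ₗ[K] D} {s' : D' →ₗ[K] D'} (hG : G.IsGraded)
    (hG' : G'.IsGraded) (f : Hom D D') (hf : ∀ x, f.lin (s x) = s' (f.lin x)) (g : Hom G G')
    {n : ℕ} (x : Fin n → D) (t : ⨂[K] _ : Fin n, G.carrier) :
    PiTensorProduct.map (fun _ => (Hom.tensor f g).lin)
        (reorder s hG n (PiTensorProduct.tprod K x) t) =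
      reorder s' hG' n (PiTensorProduct.tprod K fun i => f.lin (x i))
        (PiTensorProduct.map (fun _ => g.lin) t) := by
  have hpow : ∀ (k : ℕ) (x : D), f.lin ((s ^ k) x) = (s' ^ k) (f.lin x) := by
    intro k
    induction k with
    | zero => simp
    | succ k ih => intro x; rw [pow_succ, pow_succ, Module.End.mul_apply, Module.End.mul_apply,
        ih, hf]
  have : PiTensorProduct.map (fun _ => (Hom.tensor f g).lin) ∘ₗ
      reorder s hG n (PiTensorProduct.tprod K x) =
      reorder s' hG' n (PiTensorProduct.tprod K fun i => f.lin (x i)) ∘ₗ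
        PiTensorProduct.map (fun _ => g.lin) := by
    refine tprod_homogeneous_ext hG fun y e hy => ?_
    simp only [LinearMap.comp_apply, PiTensorProduct.map_tprod]
    rw [reorder_tprod' s hG x hy, reorder_tprod' s' hG' _ (fun i => g.map_gr _ _ (hy i)),
      PiTensorProduct.map_tprod]
    congr 1
    funext i
    simp only [Hom.tensor, TensorProduct.map_tmul, hpow]
  exact LinearMap.congr_fun this t

end GMod

/-! ### Iterated coproducts -/

namespace UCocom

variable {K : Type u} [Field K]

theorem coassoc_apply (E : UCocom K) (y : E.toGMod) :
    TensorProduct.assoc K E.toGMod.carrier E.toGMod.carrier E.toGMod.carrier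
      (TensorProduct.map E.comul LinearMap.id (E.comul y)) =
      TensorProduct.map LinearMap.id E.comul (E.comul y) :=
  (LinearMap.congr_fun (congrArg (fun f => f.lin) (ComonObj.comul_assoc E.obj.X)) y).symm

theorem counit_comul_apply (E : UCocom K) (y : E.toGMod) :
    TensorProduct.lid K E.toGMod.carrier (TensorProduct.map E.counit LinearMap.id (E.comul y)) =
      y := by
  have h := LinearMap.congr_fun (congrArg (fun f => f.lin) (ComonObj.counit_comul E.obj.X)) y
  exact (congrArg (TensorProduct.lid K E.toGMod.carrier) h).trans
    ((TensorProduct.lid K E.toGMod.carrier).apply_symm_apply y)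

theorem comul_counit_apply (E : UCocom K) (y : E.toGMod) :
    TensorProduct.rid K E.toGMod.carrier (TensorProduct.map LinearMap.id E.counit (E.comul y)) =
      y := by
  have h := LinearMap.congr_fun (congrArg (fun f => f.lin) (ComonObj.comul_counit E.obj.X)) y
  exact (congrArg (TensorProduct.rid K E.toGMod.carrier) h).trans
    ((TensorProduct.rid K E.toGMod.carrier).apply_symm_apply y)

theorem swap_comul (E : UCocom K) (y : E.toGMod) :
    GMod.swap E.isGraded E.isGraded (E.comul y) = E.comul y := by
  have : IsCommComonObj E.obj.X := E.property
  exact LinearMap.congr_fun (congrArg (fun f => f.lin) (IsCommComonObj.comul_comm E.obj.X)) y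

theorem comul_gr (E : UCocom K) {n : ℤ} {y : E.toGMod} (hy : y ∈ E.toGMod.gr n) :
    E.comul y ∈ (E.toGMod.tensor E.toGMod).gr n :=
  E.obj.comon.comul.map_gr n y hy

theorem counit_gr (E : UCocom K) {n : ℤ} (hn : n ≠ 0) {y : E.toGMod} (hy : y ∈ E.toGMod.gr n) :
    E.counit y = 0 := by
  have h : E.counit y ∈ (GMod.unit K).gr n := E.obj.comon.counit.map_gr n y hy
  simpa [hn] using h

theorem comul_lin {E F : UCocom K} (f : E ⟶ F) (x : E.toGMod) :
    F.comul (lin f x) = TensorProduct.map (lin f) (lin f) (E.comul x) :=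
  LinearMap.congr_fun (congrArg (fun f => f.lin) (IsComonHom.hom_comul f.hom.hom)) x

theorem counit_lin {E F : UCocom K} (f : E ⟶ F) (x : E.toGMod) :
    F.counit (lin f x) = E.counit x :=
  LinearMap.congr_fun (congrArg (fun f => f.lin) (IsComonHom.hom_counit f.hom.hom)) x

theorem comul_d (E : UCocom K) (y : E.toGMod) :
    E.comul (E.d y) = GMod.tensorD E.isGraded E.d E.d (E.comul y) :=
  E.obj.comon.comul.comm y

theorem counit_d (E : UCocom K) (y : E.toGMod) : E.counit (E.d y) = 0 :=
  E.obj.comon.counit.comm y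

/-- The coalgebra structure of the underlying module, the grading and the differential being
forgotten. -/
noncomputable abbrev coalgebra (E : UCocom K) : Coalgebra K E.toGMod where
  comul := E.comul
  counit := E.counit
  coassoc := LinearMap.ext fun y => E.coassoc_apply y
  rTensor_counit_comp_comul := LinearMap.ext fun y =>
    (TensorProduct.lid K E.toGMod.carrier).injective (by
      rw [TensorProduct.mk_apply, TensorProduct.lid_tmul, one_smul]
      exact E.counit_comul_apply y)
  lTensor_counit_comp_comul := LinearMap.ext fun y =>
    (TensorProduct.rid K E.toGMod.carrier).injective (by
      rw [LinearMap.flip_apply, TensorProduct.mk_apply, TensorProduct.rid_tmul, one_smul]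
      exact E.comul_counit_apply y)

theorem iterComul_succ (E : UCocom K) (n : ℕ) (y : E.toGMod) :
    E.iterComul (n + 1) y =
      consMap E.toGMod n (TensorProduct.map LinearMap.id (E.iterComul n) (E.comul y)) := rfl

theorem iterComul_one (E : UCocom K) (y : E.toGMod) :
    E.iterComul 1 y = PiTensorProduct.tprod K fun _ => y := by
  have hu : ∀ z : E.toGMod.carrier, Function.update (0 : Fin 1 → E.toGMod.carrier) 0 z =
      fun _ => z := fun z => funext fun i => by
    obtain rfl : i = 0 := Subsingleton.elim (α := Fin 1) _ _
    simp
  have h : consMap E.toGMod 0 ∘ₗ TensorProduct.map LinearMap.id (E.iterComul 0) =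
      (PiTensorProduct.tprod K (s := fun _ : Fin 1 => E.toGMod.carrier)).toLinearMap 0 0 ∘ₗ
        (TensorProduct.rid K E.toGMod.carrier).toLinearMap ∘ₗ
          TensorProduct.map LinearMap.id E.counit := by
    refine TensorProduct.ext' fun a b => ?_
    simp only [LinearMap.comp_apply, TensorProduct.map_tmul, iterComul, LinearMap.smulRight_apply,
      LinearMap.id_apply, TensorProduct.tmul_smul, map_smul, consMap_tmul, LinearEquiv.coe_coe,
      TensorProduct.rid_tmul, MultilinearMap.toLinearMap_apply, hu]
    congr 2
    funext i
    obtain rfl : i = 0 := Subsingleton.elim (α := Fin 1) _ _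
    rfl
  have := LinearMap.congr_fun h (E.comul y)
  simp only [LinearMap.comp_apply, LinearEquiv.coe_coe, comul_counit_apply,
    MultilinearMap.toLinearMap_apply, hu] at this
  exact this

/-- The tensors of a given degree in a tensor power. -/
def powGr (D : GMod K) (n : ℕ) (e : ℤ) : Submodule K (⨂[K] _ : Fin n, D.carrier) :=
  Submodule.span K {t | ∃ (y : Fin n → D) (d : Fin n → ℤ), (∀ i, y i ∈ D.gr (d i)) ∧
    ∑ i, d i = e ∧ t = PiTensorProduct.tprod K y}

theorem iterComul_gr (E : UCocom K) (n : ℕ) : ∀ {e : ℤ} {y : E.toGMod}, y ∈ E.toGMod.gr e →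
    E.iterComul n y ∈ powGr E.toGMod n e := by
  induction n with
  | zero =>
    intro e y hy
    by_cases he : e = 0
    · subst he
      change E.counit y • PiTensorProduct.tprod K Fin.elim0 ∈ _
      refine Submodule.smul_mem _ _ ?_
      exact Submodule.subset_span ⟨Fin.elim0, Fin.elim0, fun i => i.elim0, by simp, rfl⟩
    · simp [iterComul, E.counit_gr he hy]
  | succ n ih =>
    intro e y hy
    refine DGMod.tensor_gr_le (D := E.toGMod) (E := E.toGMod)
      (consMap E.toGMod n ∘ₗ TensorProduct.map LinearMap.id (E.iterComul n)) _
      (fun i j a b ha hb h => ?_) (E.comul_gr hy)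
    have hle : powGr E.toGMod n j ≤ (powGr E.toGMod (n + 1) e).comap
        (consMap E.toGMod n ∘ₗ TensorProduct.mk K _ _ a) := by
      refine Submodule.span_le.2 ?_
      rintro _ ⟨z, d, hz, hd, rfl⟩
      refine Submodule.subset_span ⟨Fin.cons a z, Fin.cons i d, ?_, ?_, ?_⟩
      · refine Fin.cases ?_ ?_
        · simpa using ha
        · simpa using hz
      · rw [Fin.sum_univ_succ]; simpa [hd] using h
      · simp [consMap_tmul]
    exact hle (ih hb)

/-- The map `a ⊗ b ↦ y 1 ⊗ ⋯ ⊗ a ⊗ b ⊗ ⋯ ⊗ y n`, with `a` and `b` in positions `i` and `i + 1`. -/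
noncomputable def pairMap (M : Type u) [AddCommGroup M] [Module K M] {n : ℕ} (i : Fin (n + 1))
    (y : Fin (n + 2) → M) : M ⊗[K] M →ₗ[K] (⨂[K] _ : Fin (n + 2), M) :=
  TensorProduct.lift (LinearMap.mk₂ K
    (fun a b => PiTensorProduct.tprod K
      (Function.update (Function.update y i.castSucc a) i.succ b))
    (fun a a' b => by
      simp only [Function.update_comm (Fin.castSucc_lt_succ (i := i)).ne,
        MultilinearMap.map_update_add])
    (fun c a b => by
      simp only [Function.update_comm (Fin.castSucc_lt_succ (i := i)).ne,
        MultilinearMap.map_update_smul])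
    (fun a b b' => by simp only [MultilinearMap.map_update_add])
    (fun c a b => by simp only [MultilinearMap.map_update_smul]))

theorem pairMap_tmul (M : Type u) [AddCommGroup M] [Module K M] {n : ℕ} (i : Fin (n + 1))
    (y : Fin (n + 2) → M) (a b : M) : pairMap M i y (a ⊗ₜ[K] b) =
      PiTensorProduct.tprod K (Function.update (Function.update y i.castSucc a) i.succ b) := by
  simp [pairMap]

/-- By coassociativity, an iterated coproduct is a sum of tensors in which any two chosen successive
factors form a coproduct. -/
theorem iterComul_mem_pairMap (E : UCocom K) {n : ℕ} (i : Fin (n + 1)) (y : E.toGMod) :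
    E.iterComul (n + 2) y ∈ Submodule.span K {t | ∃ (z : Fin (n + 2) → E.toGMod)
      (e : Fin (n + 2) → ℤ) (a : E.toGMod), (∀ j, z j ∈ E.toGMod.gr (e j)) ∧
      t = pairMap E.toGMod i z (E.comul a)} := by
  set S : ∀ {n : ℕ}, Fin (n + 1) → Submodule K (⨂[K] _ : Fin (n + 2), E.toGMod.carrier) :=
    fun {n} i => Submodule.span K {t | ∃ (z : Fin (n + 2) → E.toGMod) (e : Fin (n + 2) → ℤ)
      (a : E.toGMod), (∀ j, z j ∈ E.toGMod.gr (e j)) ∧ t = pairMap E.toGMod i z (E.comul a)}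
  -- In positions `0` and `1`, coassociativity lets the first two coproducts be formed in the other
  -- order, after which `E.comul a` occupies these positions.
  have hzero : ∀ (n : ℕ) (y : E.toGMod), E.iterComul (n + 2) y ∈ S (0 : Fin (n + 1)) := by
    intro n y
    let Φ : E.toGMod.carrier ⊗[K] (E.toGMod.carrier ⊗[K] E.toGMod.carrier) →ₗ[K]
        (⨂[K] _ : Fin (n + 2), E.toGMod.carrier) :=
      consMap E.toGMod (n + 1) ∘ₗ TensorProduct.map LinearMap.id
        (consMap E.toGMod n ∘ₗ TensorProduct.map LinearMap.id (E.iterComul n))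
    have h1 : E.iterComul (n + 2) y =
        Φ (TensorProduct.map LinearMap.id E.comul (E.comul y)) := by
      rw [iterComul_succ]
      simp only [Φ, LinearMap.comp_apply]
      rw [← LinearMap.comp_apply (TensorProduct.map _ _) (TensorProduct.map _ _),
        ← TensorProduct.map_comp]
      rfl
    rw [h1, ← coassoc_apply]
    generalize E.comul y = t
    induction t using TensorProduct.induction_on with
    | zero => simp
    | add s t hs ht => rw [map_add, map_add, map_add]; exact Submodule.add_mem _ hs ht
    | tmul a c =>
      rw [TensorProduct.map_tmul]
      have h2 : ∀ t : ⨂[K] _ : Fin n, E.toGMod.carrier,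
          (consMap E.toGMod (n + 1) ∘ₗ TensorProduct.map LinearMap.id
            (consMap E.toGMod n ∘ₗ (TensorProduct.mk K _ _).flip t))
            (E.comul a) ∈ S (0 : Fin (n + 1)) := by
        intro t
        let Ψ : (⨂[K] _ : Fin n, E.toGMod.carrier) →ₗ[K]
            (⨂[K] _ : Fin (n + 2), E.toGMod.carrier) :=
          consMap E.toGMod (n + 1) ∘ₗ
            TensorProduct.map LinearMap.id (consMap E.toGMod n) ∘ₗ
              (TensorProduct.assoc K _ _ _).toLinearMap ∘ₗ
                (TensorProduct.mk K (E.toGMod.carrier ⊗[K] E.toGMod.carrier) _ (E.comul a))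
        have hΨ : ∀ t, Ψ t = (consMap E.toGMod (n + 1) ∘ₗ TensorProduct.map LinearMap.id
            (consMap E.toGMod n ∘ₗ (TensorProduct.mk K _ _).flip t)) (E.comul a) := by
          intro t
          simp only [Ψ, LinearMap.comp_apply, TensorProduct.mk_apply, LinearEquiv.coe_coe]
          generalize E.comul a = u
          induction u using TensorProduct.induction_on with
          | zero => simp
          | add s t hs ht => simp only [TensorProduct.add_tmul, map_add, hs, ht]
          | tmul b c => simp
        rw [← hΨ]
        refine tprod_homogeneous_induction E.isGraded Ψ _ (fun z e hz => ?_) t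
        -- `pairMap` ignores the entries in the two chosen positions, so they may be `0`.
        refine Submodule.subset_span ⟨Fin.cons 0 (Fin.cons 0 z), Fin.cons 0 (Fin.cons 0 e), a,
          ?_, ?_⟩
        · refine Fin.cases (by simp) (Fin.cases (by simp) (by simpa using hz))
        · rw [hΨ]
          generalize E.comul a = u
          induction u using TensorProduct.induction_on with
          | zero => simp
          | add s t hs ht => simp only [map_add, hs, ht]
          | tmul b c =>
            simp only [LinearMap.comp_apply, TensorProduct.map_tmul, LinearMap.id_apply,
              LinearMap.flip_apply, TensorProduct.mk_apply, consMap_tmul, pairMap_tmul]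
            congr 1
            funext j
            refine Fin.cases ?_ (Fin.cases ?_ fun j => ?_) j
            · rw [Function.update_of_ne (by simp)]; simp
            · rw [Function.update_self]; simp
            · rw [Function.update_of_ne (by simp [Fin.ext_iff]),
                Function.update_of_ne (by simp [Fin.ext_iff])]; simp
      have h3 := h2 (E.iterComul n c)
      convert h3 using 1
      simp only [Φ, LinearMap.comp_apply, LinearMap.id_apply]
      generalize E.comul a = u
      induction u using TensorProduct.induction_on with
      | zero => simp
      | add s t hs ht => simp only [TensorProduct.add_tmul, map_add, hs, ht]
      | tmul b c => simp
  change E.iterComul (n + 2) y ∈ S i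
  induction n generalizing y with
  | zero =>
    obtain rfl : i = 0 := Subsingleton.elim (α := Fin 1) _ _
    exact hzero 0 y
  | succ n ih =>
    -- The other positions are those of the iterated coproduct of the second factor of a coproduct.
    refine Fin.cases (hzero (n + 1) y) (fun i => ?_) i
    rw [iterComul_succ]
    generalize E.comul y = t
    induction t using TensorProduct.induction_on with
    | zero => simp
    | add s t hs ht => rw [map_add, map_add]; exact Submodule.add_mem _ hs ht
    | tmul b c =>
      rw [TensorProduct.map_tmul, LinearMap.id_apply]
      have hb := GMod.mem_span_homogeneous E.isGraded b
      have hle : Submodule.span K {b : E.toGMod.carrier | ∃ n, b ∈ E.toGMod.gr n} ≤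
          (S i.succ).comap (consMap E.toGMod (n + 2) ∘ₗ
            (TensorProduct.mk K _ _).flip (E.iterComul (n + 2) c)) := by
        refine Submodule.span_le.2 ?_
        rintro b ⟨m, hb⟩
        have hle' : S i ≤ (S i.succ).comap (consMap E.toGMod (n + 2) ∘ₗ
            TensorProduct.mk K _ _ b) := by
          refine Submodule.span_le.2 ?_
          rintro _ ⟨z, e, a, hz, rfl⟩
          refine Submodule.subset_span ⟨Fin.cons b z, Fin.cons m e, a, ?_, ?_⟩
          · exact Fin.cases (by simpa using hb) (by simpa using hz)
          · generalize E.comul a = u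
            induction u using TensorProduct.induction_on with
            | zero => simp
            | add s t hs ht => simp only [map_add, hs, ht]
            | tmul b' c' =>
              simp only [LinearMap.comp_apply, TensorProduct.mk_apply, pairMap_tmul, consMap_tmul]
              rw [Fin.cons_update, Fin.cons_update, Fin.succ_castSucc]
        exact hle' (ih i c)
      exact hle hb

end UCocom

/-! ### The map `(V ∘ D) ⊗ E → V ∘ (D ⊗ E)` -/

namespace SMod

variable {K : Type u} [Field K]

/-- The operators of a family form right actions of the symmetric groups. -/
structure IsAct (V : SMod K) : Prop where
  one : ∀ n c, V.act n 1 c = c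
  mul : ∀ n σ τ c, V.act n (σ * τ) c = V.act n τ (V.act n σ c)

theorem IsSMod.isAct {V : SMod K} (hV : V.IsSMod) : V.IsAct := ⟨hV.act_one, hV.act_mul⟩

theorem comp_hom_ext {V W : SMod K} {n : ℕ} {M : Type*} [AddCommGroup M] [Module K M]
    {f g : (comp V W).obj n →ₗ[K] M}
    (h : ∀ (k : ℕ) (m : Fin k → ℕ) (β : (Σ i, Fin (m i)) ≃ Fin n) (v : V.obj k)
      (w : ∀ i, W.obj (m i)), f (compMk V W m β v w) = g (compMk V W m β v w)) : f = g := by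
  refine Submodule.linearMap_qext _ (DirectSum.linearMap_ext _ fun p => ?_)
  refine TensorProduct.ext (LinearMap.ext fun v => PiTensorProduct.ext ?_)
  exact MultilinearMap.ext fun w => h p.1 p.2.1 p.2.2 v w

theorem isAct_comp (V W : SMod K) : (comp V W).IsAct where
  one n c := by
    have : (comp V W).act n 1 = LinearMap.id := comp_hom_ext fun k m β v w => by
      rw [act_compMk]; rfl
    rw [this]; rfl
  mul n σ τ c := by
    have : (comp V W).act n (σ * τ) = (comp V W).act n τ ∘ₗ (comp V W).act n σ :=
      comp_hom_ext fun k m β v w => by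
        rw [LinearMap.comp_apply, act_compMk, act_compMk, act_compMk]; rfl
    rw [this]; rfl

theorem evalMap_evalLin {V V' : SMod K} {D D' : GMod K} (f : Hom V V') (g : GMod.Hom D D') {n : ℕ}
    (c : V.obj n) (t : ⨂[K] _ : Fin n, D.carrier) :
    (evalMap f g).lin (evalLin V D n c t) =
      evalLin V' D' n ((f.app n).lin c) (PiTensorProduct.map (fun _ => g.lin) t) := by
  have : (evalMap f g).lin ∘ₗ evalLin V D n c =
      evalLin V' D' n ((f.app n).lin c) ∘ₗ PiTensorProduct.map (fun _ => g.lin) := by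
    refine PiTensorProduct.ext (MultilinearMap.ext fun t => ?_)
    simp only [LinearMap.compMultilinearMap_apply, LinearMap.comp_apply,
      PiTensorProduct.map_tprod]
    exact evalMap_mk f g c t
  exact LinearMap.congr_fun this t

variable {V : SMod K} {D : GMod K} {s : D →ₗ[K] D}

/-- The map `y 1 ⊗ ⋯ ⊗ y n ↦ ± c ⊗ (x 1 ⊗ y 1) ⊗ ⋯ ⊗ (x n ⊗ y n)`. -/
noncomputable def shufTensor (V : SMod K) {D : GMod K} (s : D →ₗ[K] D) (E : UCocom K) {n : ℕ}
    (c : V.obj n) (x : Fin n → D) :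
    (⨂[K] _ : Fin n, E.toGMod.carrier) →ₗ[K] V.eval (D.tensor E.toGMod) :=
  evalLin V (D.tensor E.toGMod) n c ∘ₗ
    GMod.reorder s E.isGraded n (PiTensorProduct.tprod K x)

theorem shufTensor_tprod (hs : D.IsParity s) (E : UCocom K) {n : ℕ} (c : V.obj n) {x : Fin n → D}
    {d : Fin n → ℤ} (hx : ∀ i, x i ∈ D.gr (d i)) {y : Fin n → E.toGMod} {e : Fin n → ℤ}
    (hy : ∀ i, y i ∈ E.toGMod.gr (e i)) :
    shufTensor V s E c x (PiTensorProduct.tprod K y) =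
      shufSign K d e • evalMk V (D.tensor E.toGMod) c fun i => x i ⊗ₜ[K] y i := by
  rw [shufTensor, LinearMap.comp_apply, GMod.reorder_tprod hs E.isGraded hx hy, map_smul,
    evalLin_tprod]

/-- On a fixed tensor of elements of `E`, the symmetric group also acts on these elements. -/
theorem shufTensor_act_tprod (hs : D.IsParity s) (E : UCocom K) {n : ℕ} (σ : Equiv.Perm (Fin n))
    (c : V.obj n) {x : Fin n → D} {d : Fin n → ℤ} (hx : ∀ i, x i ∈ D.gr (d i))
    {y : Fin n → E.toGMod} {e : Fin n → ℤ} (hy : ∀ i, y i ∈ E.toGMod.gr (e i)) :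
    shufTensor V s E (V.act n σ c) x (PiTensorProduct.tprod K y) =
      koszulSign K σ d • koszulSign K σ e •
        shufTensor V s E c (fun i => x (σ.symm i))
          (PiTensorProduct.tprod K fun i => y (σ.symm i)) := by
  rw [shufTensor_tprod hs E _ hx hy, shufTensor_tprod hs E c (fun i => hx (σ.symm i))
    (fun i => hy (σ.symm i)), evalMk_act V _ σ c _ (fun i => d i + e i)
    (fun i => GMod.tmul_mem (hx i) (hy i) rfl), smul_smul, smul_smul, smul_smul,
    shufSign_mul_koszulSign]

/-- Cocommutativity of `E` makes the shuffle map compatible with the adjacent transpositions. -/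
theorem shufTensor_act_swap (hs : D.IsParity s) (E : UCocom K) {n : ℕ} (i : Fin (n + 1))
    (c : V.obj (n + 2)) {x : Fin (n + 2) → D} {d : Fin (n + 2) → ℤ} (hx : ∀ i, x i ∈ D.gr (d i))
    (y : E.toGMod) :
    shufTensor V s E (V.act _ (Equiv.swap i.castSucc i.succ) c) x (E.iterComul (n + 2) y) =
      koszulSign K (Equiv.swap i.castSucc i.succ) d •
        shufTensor V s E c (fun j => x ((Equiv.swap i.castSucc i.succ).symm j))
          (E.iterComul (n + 2) y) := by
  set σ := Equiv.swap i.castSucc i.succ with hσ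
  have hne : i.castSucc ≠ i.succ := (Fin.castSucc_lt_succ (i := i)).ne
  let Φ := shufTensor V s E (V.act _ σ c) x -
    koszulSign K σ d • shufTensor V s E c (fun j => x (σ.symm j))
  suffices h : Submodule.span K {t | ∃ (z : Fin (n + 2) → E.toGMod)
      (e : Fin (n + 2) → ℤ) (a : E.toGMod), (∀ j, z j ∈ E.toGMod.gr (e j)) ∧
      t = UCocom.pairMap E.toGMod i z (E.comul a)} ≤ LinearMap.ker Φ by
    have := h (E.iterComul_mem_pairMap i y)
    rw [LinearMap.mem_ker] at this
    simpa only [Φ, LinearMap.sub_apply, LinearMap.smul_apply, sub_eq_zero] using this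
  refine Submodule.span_le.2 ?_
  rintro _ ⟨z, e, a, hz, rfl⟩
  -- The transposition may be moved to the two elements of `E` in the positions `i` and `i + 1`; as
  -- these form a coproduct, they can be exchanged by cocommutativity.
  have key : ∀ t : E.toGMod.carrier ⊗[K] E.toGMod.carrier,
      shufTensor V s E (V.act _ σ c) x (UCocom.pairMap E.toGMod i z t) =
        koszulSign K σ d • shufTensor V s E c (fun j => x (σ.symm j))
          (UCocom.pairMap E.toGMod i z (GMod.swap E.isGraded E.isGraded t)) := by
    refine GMod.tensor_induction E.isGraded E.isGraded ?_ (by simp) ?_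
    · intro p q b b' hb hb'
      have hy : ∀ j, Function.update (Function.update z i.castSucc b) i.succ b' j ∈
          E.toGMod.gr (Function.update (Function.update e i.castSucc p) i.succ q j) := by
        intro j
        by_cases h1 : j = i.succ
        · subst h1; simpa using hb'
        · by_cases h2 : j = i.castSucc
          · subst h2; simpa [h1] using hb
          · simpa [h1, h2] using hz j
      rw [UCocom.pairMap_tmul, shufTensor_act_tprod hs E σ c hx hy,
        GMod.swap_tmul _ _ hb hb', map_smul, UCocom.pairMap_tmul, map_smul]
      congr 2
      · rw [hσ, koszulSign_swap]; simp [hne]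
      · congr 2
        funext j
        simp only [hσ, Equiv.symm_swap, Equiv.swap_apply_def, Function.update_apply]
        split_ifs <;> simp_all
    · intro t t' h h'
      simp only [map_add, smul_add, h, h']
  simp only [Φ, SetLike.mem_coe, LinearMap.mem_ker, LinearMap.sub_apply, LinearMap.smul_apply]
  rw [key, E.swap_comul, sub_self]

/-- The relation that defines the coinvariants in `V ∘ D` is respected after substituting an
iterated coproduct. Adjacent transpositions generate the symmetric group, and the cocycle property
of the Koszul sign reduces the statement to them. -/
theorem shufTensor_act (hV : V.IsAct) (hs : D.IsParity s) (E : UCocom K) {n : ℕ}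
    (σ : Equiv.Perm (Fin n)) (c : V.obj n) {x : Fin n → D} {d : Fin n → ℤ}
    (hx : ∀ i, x i ∈ D.gr (d i)) (y : E.toGMod) :
    shufTensor V s E (V.act n σ c) x (E.iterComul n y) =
      koszulSign K σ d • shufTensor V s E c (fun j => x (σ.symm j)) (E.iterComul n y) := by
  have hone : ∀ (c : V.obj n) (x : Fin n → D) (d : Fin n → ℤ),
      shufTensor V s E (V.act n 1 c) x (E.iterComul n y) = koszulSign K 1 d •
        shufTensor V s E c (fun j => x ((1 : Equiv.Perm (Fin n)).symm j))
          (E.iterComul n y) := by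
    intro c x d
    rw [hV.one, koszulSign_one, one_smul]; rfl
  cases n with
  | zero =>
    obtain rfl : σ = 1 := Subsingleton.elim _ _
    exact hone c x d
  | succ n =>
    have hσ : σ ∈ Submonoid.closure
        (Set.range fun i : Fin n => Equiv.swap i.castSucc i.succ) := by
      rw [Equiv.Perm.mclosure_swap_castSucc_succ]; trivial
    induction hσ using Submonoid.closure_induction generalizing c x d with
    | mem σ h =>
      obtain ⟨i, rfl⟩ := h
      cases n with
      | zero => exact i.elim0
      | succ n => exact shufTensor_act_swap hs E i c hx y
    | one => exact hone c x d
    | mul σ τ _ _ hσ hτ =>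
      rw [hV.mul, hτ _ hx, hσ c (fun i => hx (τ.symm i)), smul_smul, ← koszulSign_mul]
      rfl

/-- The map underlying `shuf`, before passing to the quotient. -/
noncomputable def preShuf (V : SMod K) {D : GMod K} (s : D →ₗ[K] D) (E : UCocom K) :
    EvalPre V D →ₗ[K] E.toGMod.carrier →ₗ[K] (V.eval (D.tensor E.toGMod)).carrier :=
  DirectSum.toModule K ℕ _ fun n => TensorProduct.lift <| LinearMap.mk₂ K
    (fun c t => evalLin V (D.tensor E.toGMod) n c ∘ₗ
      GMod.reorder s E.isGraded n t ∘ₗ E.iterComul n)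
    (fun c c' t => by simp only [map_add, LinearMap.add_comp])
    (fun a c t => by simp only [map_smul, LinearMap.smul_comp])
    (fun c t t' => by simp only [map_add, LinearMap.add_comp, LinearMap.comp_add])
    (fun a c t => by simp only [map_smul, LinearMap.smul_comp, LinearMap.comp_smul])

theorem preShuf_mk (V : SMod K) {D : GMod K} (s : D →ₗ[K] D) (E : UCocom K) {n : ℕ}
    (c : V.obj n) (x : Fin n → D) (y : E.toGMod) :
    preShuf V s E (preEvalMk V D c x) y = shufTensor V s E c x (E.iterComul n y) := by
  simp only [preShuf, preEvalMk, DirectSum.toModule_lof, TensorProduct.lift.tmul,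
    LinearMap.mk₂_apply]
  rfl

/-- The map `(V ∘ D) ⊗ E → V ∘ (D ⊗ E)` given by the iterated coproducts of `E`. -/
noncomputable def shuf (hV : V.IsAct) (hs : D.IsParity s) (E : UCocom K) :
    V.eval D →ₗ[K] E.toGMod.carrier →ₗ[K] (V.eval (D.tensor E.toGMod)).carrier :=
  (evalRel V D).liftQ (preShuf V s E) (Submodule.span_le.2 (by
    rintro _ ⟨n, v, x, σ, d, hx, rfl⟩
    rw [SetLike.mem_coe, LinearMap.mem_ker, map_sub, map_smul]
    refine LinearMap.ext fun y => ?_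
    rw [LinearMap.sub_apply, LinearMap.smul_apply, preShuf_mk, preShuf_mk,
      shufTensor_act hV hs E σ v hx y, sub_self]
    rfl))

theorem shuf_mk (hV : V.IsAct) (hs : D.IsParity s) (E : UCocom K) {n : ℕ} (c : V.obj n)
    (x : Fin n → D) (y : E.toGMod) :
    shuf hV hs E (evalMk V D c x) y = shufTensor V s E c x (E.iterComul n y) :=
  preShuf_mk V s E c x y

/-- The shuffle map preserves the degree. -/
theorem shuf_gr (hV : V.IsAct) (hs : D.IsParity s) (E : UCocom K) {p q r : ℤ} {z : V.eval D}
    (hz : z ∈ (V.eval D).gr p) {y : E.toGMod} (hy : y ∈ E.toGMod.gr q) (h : p + q = r) :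
    shuf hV hs E z y ∈ (V.eval (D.tensor E.toGMod)).gr r := by
  have hle : (V.eval D).gr p ≤ ((V.eval (D.tensor E.toGMod)).gr r).comap
      ((shuf hV hs E).flip y) := by
    refine Submodule.span_le.2 ?_
    rintro _ ⟨n, c, x, e₀, d, hc, hx, hd, rfl⟩
    have hle' : UCocom.powGr E.toGMod n q ≤ ((V.eval (D.tensor E.toGMod)).gr r).comap
        (shufTensor V s E c x) := by
      refine Submodule.span_le.2 ?_
      rintro _ ⟨y, e, hy, he, rfl⟩
      simp only [Submodule.comap_coe, Set.mem_preimage, SetLike.mem_coe]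
      rw [shufTensor_tprod hs E c hx hy]
      refine Submodule.smul_mem _ _ (evalMk_mem_gr V _ hc
        (d := fun i => d i + e i) (fun i => GMod.tmul_mem (hx i) (hy i) rfl) ?_)
      rw [Finset.sum_add_distrib]; omega
    have := hle' (E.iterComul_gr n hy)
    simp only [Submodule.comap_coe, Set.mem_preimage, SetLike.mem_coe, LinearMap.flip_apply]
    rwa [shuf_mk]
  exact hle hz

/-- The shuffle map is natural in `V`. -/
theorem shuf_natural_left {V' : SMod K} (hV : V.IsAct) (hV' : V'.IsAct) (hs : D.IsParity s)
    (E : UCocom K) (f : Hom V V') (g : GMod.Hom D D) (hg : g.lin = LinearMap.id)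
    (g' : GMod.Hom (D.tensor E.toGMod) (D.tensor E.toGMod)) (hg' : g'.lin = LinearMap.id)
    (z : V.eval D) (y : E.toGMod) :
    (evalMap f g').lin (shuf hV hs E z y) = shuf hV' hs E ((evalMap f g).lin z) y := by
  have : (evalMap f g').lin ∘ₗ (shuf hV hs E).flip y =
      (shuf hV' hs E).flip y ∘ₗ (evalMap f g).lin := by
    refine eval_hom_ext fun n c x => ?_
    simp only [LinearMap.comp_apply, LinearMap.flip_apply]
    rw [evalMap_mk, shuf_mk, shuf_mk]
    rw [hg, shufTensor, LinearMap.comp_apply]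
    refine (evalMap_evalLin f g' c _).trans ?_
    rw [hg', PiTensorProduct.map_id]
    rfl
  exact LinearMap.congr_fun this z

theorem _root_.UCocom.iterComul_natural {E E' : UCocom K} (g : E ⟶ E') (n : ℕ) (y : E.toGMod) :
    E'.iterComul n (UCocom.lin g y) =
      PiTensorProduct.map (fun _ => UCocom.lin g) (E.iterComul n y) := by
  induction n generalizing y with
  | zero =>
    simp only [UCocom.iterComul, LinearMap.smulRight_apply, UCocom.counit_lin, map_smul,
      PiTensorProduct.map_tprod]
    congr 2
    exact Subsingleton.elim _ _
  | succ n ih =>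
    rw [UCocom.iterComul_succ, UCocom.iterComul_succ, UCocom.comul_lin]
    generalize E.comul y = t
    induction t using TensorProduct.induction_on with
    | zero => simp
    | add s t hs ht => simp only [map_add, hs, ht]
    | tmul a b =>
      simp only [TensorProduct.map_tmul, LinearMap.id_apply, ih]
      generalize E.iterComul n b = t
      induction t using PiTensorProduct.induction_on with
      | smul_tprod r z =>
        simp only [map_smul, TensorProduct.tmul_smul, PiTensorProduct.map_tprod,
          UCocom.consMap_tmul]
        congr 2
        funext j
        refine Fin.cases ?_ (fun j => ?_) j <;> simp
      | add s t hs ht => simp only [map_add, TensorProduct.tmul_add, hs, ht]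

/-- The shuffle map is natural in `D` and `E`. -/
theorem shuf_natural {D' : GMod K} {s' : D' →ₗ[K] D'} (hV : V.IsAct) (hs : D.IsParity s)
    (hs' : D'.IsParity s') {E E' : UCocom K} (f : GMod.Hom D D')
    (hf : ∀ x, f.lin (s x) = s' (f.lin x)) (g : E ⟶ E') (z : V.eval D) (y : E.toGMod) :
    (evalMap (Hom.id V) (GMod.Hom.tensor f g.hom.hom.toHom)).lin (shuf hV hs E z y) =
      shuf hV hs' E' ((evalMap (Hom.id V) f).lin z) (UCocom.lin g y) := by
  have : (evalMap (Hom.id V) (GMod.Hom.tensor f g.hom.hom.toHom)).lin ∘ₗ (shuf hV hs E).flip y =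
      (shuf hV hs' E').flip (UCocom.lin g y) ∘ₗ (evalMap (Hom.id V) f).lin := by
    refine eval_hom_ext fun n c x => ?_
    simp only [LinearMap.comp_apply, LinearMap.flip_apply]
    rw [evalMap_mk, shuf_mk, shuf_mk, UCocom.iterComul_natural]
    have h' := GMod.reorder_natural E.isGraded E'.isGraded f hf g.hom.hom.toHom x
      (E.iterComul n y)
    rw [shufTensor, LinearMap.comp_apply]
    refine (evalMap_evalLin (Hom.id V) (GMod.Hom.tensor f g.hom.hom.toHom) c _).trans ?_
    rw [h']
    rfl
  exact LinearMap.congr_fun this z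

end SMod

/-! ### Compatibility of the shuffle map with counits and coderivations -/

namespace SMod

variable {K : Type u} [Field K] {V : SMod K} {D : GMod K} {s : D →ₗ[K] D}

theorem evalLin_mem_rootGraph (V : SMod K) (D : GMod K) (φ : V.obj 1 →ₗ[K] K) {n : ℕ} (hn : n ≠ 1)
    (v : V.obj n) (t : ⨂[K] _ : Fin n, D.carrier) :
    (evalLin V D n v t, (0 : D)) ∈ evalRootGraph V D φ := by
  induction t using PiTensorProduct.induction_on with
  | smul_tprod r x =>
    have := (evalRootGraph V D φ).smul_mem r
      (Submodule.subset_span (Or.inr ⟨n, v, x, hn, rfl⟩))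
    rw [map_smul]
    simp only [Prod.smul_mk, smul_zero] at this
    exact this
  | add t t' h h' =>
    have := (evalRootGraph V D φ).add_mem h h'
    rw [map_add]
    simpa using this

/-- The shuffle map sends the projection of `V ∘ D` to `D` given by a functional `φ` on `V(1)` to
that of `V ∘ (D ⊗ E)` to `D ⊗ E`, because the iterated coproduct of length one is the identity. This
applies to the counit as well as to the curvature. -/
theorem shuf_mem_rootGraph (hV : V.IsAct) (hs : D.IsParity s) (E : UCocom K)
    (φ : V.obj 1 →ₗ[K] K) {z : V.eval D} {w : D} (h : (z, w) ∈ evalRootGraph V D φ)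
    (y : E.toGMod) :
    (shuf hV hs E z y, (w ⊗ₜ[K] y : D ⊗[K] E.toGMod)) ∈
      evalRootGraph V (D.tensor E.toGMod) φ := by
  have hle : evalRootGraph V D φ ≤ (evalRootGraph V (D.tensor E.toGMod) φ).comap
      (LinearMap.prodMap ((shuf hV hs E).flip y) ((TensorProduct.mk K D E.toGMod).flip y)) := by
    refine Submodule.span_le.2 ?_
    rintro _ (⟨v, x, rfl⟩ | ⟨n, v, x, hn, rfl⟩)
    · simp only [Submodule.comap_coe, Set.mem_preimage, SetLike.mem_coe, LinearMap.prodMap_apply,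
        LinearMap.flip_apply, TensorProduct.mk_apply]
      refine GMod.hom_induction E.isGraded (p := fun y =>
        (shuf hV hs E (evalMk V D v x) y, ((φ v • x 0) ⊗ₜ[K] y : D ⊗[K] E.toGMod)) ∈
          evalRootGraph V (D.tensor E.toGMod) φ) ?_ ?_ ?_ y
      · intro n y hy
        rw [shuf_mk, UCocom.iterComul_one, shufTensor, LinearMap.comp_apply,
          GMod.reorder_tprod' s E.isGraded x (y := fun _ => y) (fun _ => hy)]
        refine Submodule.subset_span (Or.inl ⟨v, fun i => x i ⊗ₜ[K] y, ?_⟩)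
        refine Prod.ext ?_ (TensorProduct.smul_tmul' _ _ _).symm
        refine congrArg (fun x => evalMk V (D.tensor E.toGMod) v x) (funext fun i => ?_)
        obtain rfl : i = 0 := Subsingleton.elim (α := Fin 1) _ _
        have : (Finset.Iio (0 : Fin 1)) = ∅ := by ext; simp
        rw [this]
        simp
      · simp only [map_zero, TensorProduct.tmul_zero]
        exact Submodule.zero_mem _
      · intro y y' h h'
        simp only [map_add, TensorProduct.tmul_add]
        exact Submodule.add_mem _ h h'
    · simp only [Submodule.comap_coe, Set.mem_preimage, SetLike.mem_coe, LinearMap.prodMap_apply,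
        LinearMap.flip_apply, TensorProduct.mk_apply, TensorProduct.zero_tmul]
      rw [shuf_mk]
      exact evalLin_mem_rootGraph V (D.tensor E.toGMod) φ hn v _
  exact hle h

end SMod

namespace UCocom

variable {K : Type u} [Field K]

/-- The differential of a tensor power. -/
noncomputable def powD (E : UCocom K) (n : ℕ) :
    (⨂[K] _ : Fin n, E.toGMod.carrier) →ₗ[K] (⨂[K] _ : Fin n, E.toGMod.carrier) :=
  ∑ i, PiTensorProduct.map fun j =>
    if j < i then GMod.sgn E.isGraded 1 else if j = i then E.d else LinearMap.id

theorem powD_tprod (E : UCocom K) {n : ℕ} {y : Fin n → E.toGMod} {e : Fin n → ℤ}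
    (hy : ∀ i, y i ∈ E.toGMod.gr (e i)) :
    E.powD n (PiTensorProduct.tprod K y) = ∑ i, ksgn K (∑ j ∈ Finset.Iio i, e j) •
      PiTensorProduct.tprod K (Function.update y i (E.d (y i))) := by
  rw [powD, LinearMap.sum_apply]
  refine Finset.sum_congr rfl fun i _ => ?_
  rw [PiTensorProduct.map_tprod]
  have : (fun j => (if j < i then GMod.sgn E.isGraded 1 else if j = i then E.d
      else LinearMap.id : E.toGMod.carrier →ₗ[K] E.toGMod.carrier) (y j)) =
      fun j => (if j < i then ksgn K (e j) else 1) • Function.update y i (E.d (y i)) j := by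
    funext j
    rcases lt_trichotomy j i with h | h | h
    · simp [h, h.ne, GMod.sgn_apply E.isGraded 1 (hy j)]
    · subst h; simp
    · simp [h.not_gt, h.ne']
  rw [this, (PiTensorProduct.tprod K).map_smul_univ, ksgn_sum, ← Finset.prod_filter]
  congr 1
  refine Finset.prod_congr ?_ fun _ _ => rfl
  ext; simp

/-- The Leibniz rule for `a ⊗ t`. -/
theorem powD_consMap (E : UCocom K) (n : ℕ) (a : E.toGMod)
    (t : ⨂[K] _ : Fin n, E.toGMod.carrier) :
    E.powD (n + 1) (consMap E.toGMod n (a ⊗ₜ t)) = consMap E.toGMod n (E.d a ⊗ₜ t) +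
      consMap E.toGMod n (GMod.sgn E.isGraded 1 a ⊗ₜ E.powD n t) := by
  induction t using PiTensorProduct.induction_on with
  | smul_tprod r z =>
    simp only [map_smul, TensorProduct.tmul_smul, ← smul_add]
    congr 1
    rw [consMap_tmul, powD, LinearMap.sum_apply, Fin.sum_univ_succ]
    congr 1
    · rw [PiTensorProduct.map_tprod, consMap_tmul]
      congr 1
      funext j
      refine Fin.cases ?_ (fun j => ?_) j
      · simp
      · simp
    · rw [powD, LinearMap.sum_apply, TensorProduct.tmul_sum, map_sum]
      refine Finset.sum_congr rfl fun i _ => ?_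
      rw [PiTensorProduct.map_tprod, PiTensorProduct.map_tprod, consMap_tmul]
      congr 1
      funext j
      refine Fin.cases ?_ (fun j => ?_) j
      · simp
      · simp
  | add t t' h h' =>
    simp only [map_add, TensorProduct.tmul_add, h, h']
    abel

/-- Iterated coproducts are chain maps. -/
theorem iterComul_d (E : UCocom K) (n : ℕ) (y : E.toGMod) :
    E.iterComul n (E.d y) = E.powD n (E.iterComul n y) := by
  induction n generalizing y with
  | zero => simp [iterComul, E.counit_d, powD]
  | succ n ih =>
    rw [iterComul_succ, iterComul_succ, E.comul_d]
    generalize E.comul y = t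
    induction t using TensorProduct.induction_on with
    | zero => simp
    | add s t hs ht => simp only [map_add, hs, ht]
    | tmul a b =>
      simp only [TensorProduct.map_tmul, LinearMap.id_apply, powD_consMap, GMod.tensorD,
        LinearMap.add_apply, map_add, ih]

end UCocom

section Signs

variable (K : Type u) [Field K]

theorem shufSign_update_left {n : ℕ} (d e : Fin n → ℤ) (i : Fin n) :
    shufSign K (Function.update d i (d i - 1)) e =
      shufSign K d e * ksgn K (∑ j ∈ Finset.Iio i, e j) := by
  have h : Function.update d i (d i - 1) = fun j => d j + (Pi.single i (-1) : Fin n → ℤ) j := by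
    funext j
    by_cases h : j = i
    · subst h; simp [sub_eq_add_neg]
    · simp [h]
  rw [h, shufSign_add_left, shufSign_eq_left K (Pi.single i (-1)) e,
    Finset.prod_eq_single i]
  · congr 1
    refine ksgn_congr K ?_
    rw [Pi.single_eq_same]
    exact ⟨- ∑ j ∈ Finset.Iio i, e j, by ring⟩
  · intro j _ hj
    simp [hj, ksgn_zero]
  · simp

theorem shufSign_update_right {n : ℕ} (d e : Fin n → ℤ) (i : Fin n) :
    shufSign K d (Function.update e i (e i - 1)) =
      shufSign K d e * ksgn K (∑ j ∈ Finset.Ioi i, d j) := by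
  have h : Function.update e i (e i - 1) = fun j => e j + (Pi.single i (-1) : Fin n → ℤ) j := by
    funext j
    by_cases h : j = i
    · subst h; simp [sub_eq_add_neg]
    · simp [h]
  rw [h, shufSign_add_right, shufSign_eq_right K d (Pi.single i (-1)),
    Finset.prod_eq_single i]
  · congr 1
    refine ksgn_congr K ?_
    rw [Pi.single_eq_same]
    exact ⟨- ∑ j ∈ Finset.Ioi i, d j, by ring⟩
  · intro j _ hj
    simp [hj, ksgn_zero]
  · simp

end Signs

namespace SMod

variable {K : Type u} [Field K] {V : SMod K} {D : GMod K} {s : D →ₗ[K] D}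

/-- The shuffle map sends a coderivation of `V ∘ D`, together with the differential of `E`, to a
coderivation of `V ∘ (D ⊗ E)`. The operator `S` is `z ↦ (-1) ^ |z| z`, the sign by which the
differential of `E` passes `V ∘ D`. -/
theorem shuf_mem_coderGraph (hV : V.IsAct) (hs : D.IsParity s) (hD : D.IsGraded) (E : UCocom K)
    (dV : ∀ n, V.obj n →ₗ[K] V.obj n) (dD : D →ₗ[K] D)
    (hdD : ∀ n x, x ∈ D.gr n → dD x ∈ D.gr (n - 1)) {S : V.eval D →ₗ[K] V.eval D}
    (hS : (V.eval D).IsParity S) {z w : V.eval D} (h : (z, w) ∈ evalCoderGraph V D dV dD)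
    (y : E.toGMod) :
    (shuf hV hs E z y, shuf hV hs E w y + shuf hV hs E (S z) (E.d y)) ∈
      evalCoderGraph V (D.tensor E.toGMod) dV (GMod.tensorD hD dD E.d) := by
  set G := evalCoderGraph V (D.tensor E.toGMod) dV (GMod.tensorD hD dD E.d) with hG
  let Φ : (V.eval D × V.eval D) →ₗ[K] (V.eval (D.tensor E.toGMod) ×
      V.eval (D.tensor E.toGMod)) :=
    LinearMap.prod ((shuf hV hs E).flip y ∘ₗ LinearMap.fst K _ _)
      ((shuf hV hs E).flip y ∘ₗ LinearMap.snd K _ _ +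
        (shuf hV hs E).flip (E.d y) ∘ₗ S ∘ₗ LinearMap.fst K _ _)
  suffices hle : evalCoderGraph V D dV dD ≤ G.comap Φ from hle h
  refine Submodule.span_le.2 ?_
  rintro _ ⟨n, v, x, e₀, d, hv, hx, rfl⟩
  have hSz : S (evalMk V D v x) = ksgn K (e₀ + ∑ i, d i) • evalMk V D v x :=
    hS _ _ (evalMk_mem_gr V D hv hx rfl)
  let Ψ : (⨂[K] _ : Fin n, E.toGMod.carrier) →ₗ[K]
      (V.eval (D.tensor E.toGMod) × V.eval (D.tensor E.toGMod)) :=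
    LinearMap.prod (shufTensor V s E v x)
      (shufTensor V s E (dV n v) x + (∑ i, ksgn K (e₀ + ∑ j ∈ Finset.Iio i, d j) •
        shufTensor V s E v (Function.update x i (dD (x i)))) +
        ksgn K (e₀ + ∑ i, d i) • (shufTensor V s E v x ∘ₗ E.powD n))
  -- As the differential commutes with iterated coproducts, it may be applied to the tensor `t`
  -- instead of `y`; the statement is then linear in `t`, which may be taken to be a pure tensor.
  suffices hΨ : ∀ t, Ψ t ∈ G by
    have := hΨ (E.iterComul n y)
    simp only [Submodule.comap_coe, Set.mem_preimage, SetLike.mem_coe]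
    convert this using 1
    simp only [Φ, Ψ, LinearMap.prod_apply, Function.prod_apply, LinearMap.comp_apply,
      LinearMap.add_apply, LinearMap.fst_apply, LinearMap.snd_apply, LinearMap.flip_apply, hSz,
      map_smul, map_add, map_sum, LinearMap.smul_apply, LinearMap.sum_apply]
    rw [← E.iterComul_d]
    exact Prod.ext (shuf_mk hV hs E v x y) (congrArg₂ (· + ·) (congrArg₂ (· + ·)
      (shuf_mk hV hs E _ x y) (Finset.sum_congr rfl fun i _ => congrArg _ (shuf_mk hV hs E v _ y)))
      (congrArg _ (shuf_mk hV hs E v x (E.d y))))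
  refine fun t => tprod_homogeneous_induction E.isGraded Ψ G (fun y e hy => ?_) t
  let M : MultilinearMap K (fun _ : Fin n => (D.tensor E.toGMod).carrier)
      (V.eval (D.tensor E.toGMod)).carrier :=
    (evalLin V (D.tensor E.toGMod) n v).compMultilinearMap (PiTensorProduct.tprod K)
  have hM : ∀ u, evalMk V (D.tensor E.toGMod) v u = M u := fun u => rfl
  have hmem : (M (fun i => x i ⊗ₜ[K] y i),
      evalMk V (D.tensor E.toGMod) (dV n v) (fun i => x i ⊗ₜ[K] y i) +
      ∑ i, ksgn K (e₀ + ∑ j ∈ Finset.Iio i, (d j + e j)) •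
        M (Function.update (fun i => x i ⊗ₜ[K] y i) i
          (GMod.tensorD hD dD E.d (x i ⊗ₜ[K] y i)))) ∈ G :=
    Submodule.subset_span ⟨n, v, fun i => x i ⊗ₜ[K] y i, e₀, fun i => d i + e i, hv,
      fun i => GMod.tmul_mem (hx i) (hy i) rfl, rfl⟩
  have hx' : ∀ i j, Function.update x i (dD (x i)) j ∈
      D.gr (Function.update d i (d i - 1) j) := by
    intro i j
    by_cases h : j = i
    · subst h; simpa using hdD _ _ (hx j)
    · simpa [h] using hx j
  have hy' : ∀ i j, Function.update y i (E.d (y i)) j ∈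
      E.toGMod.gr (Function.update e i (e i - 1) j) := by
    intro i j
    by_cases h : j = i
    · subst h; simpa using E.obj.X.d_gr _ _ (hy j)
    · simpa [h] using hy j
  have hux : ∀ i, (fun j => Function.update x i (dD (x i)) j ⊗ₜ[K] y j) =
      Function.update (fun j => x j ⊗ₜ[K] y j) i (dD (x i) ⊗ₜ[K] y i) := by
    intro i
    funext j
    by_cases h : j = i
    · subst h; simp
    · simp [h]
  have huy : ∀ i, (fun j => x j ⊗ₜ[K] Function.update y i (E.d (y i)) j) =
      Function.update (fun j => x j ⊗ₜ[K] y j) i (x i ⊗ₜ[K] E.d (y i)) := by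
    intro i
    funext j
    by_cases h : j = i
    · subst h; simp
    · simp [h]
  have hsign : ∀ i, ∑ j, d j = ∑ j ∈ Finset.Iio i, d j + d i + ∑ j ∈ Finset.Ioi i, d j := by
    intro i
    have h1 : (Finset.univ : Finset (Fin n)) = (Finset.Iio i ∪ {i}) ∪ Finset.Ioi i := by
      ext j
      rcases lt_trichotomy j i with h | h | h <;> simp [h, h.le]
    rw [h1, Finset.sum_union, Finset.sum_union, Finset.sum_singleton]
    · simp
    · rw [Finset.disjoint_left]
      intro j hj hj'
      rw [Finset.mem_Ioi] at hj'
      rcases Finset.mem_union.1 hj with h | h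
      · exact absurd (Finset.mem_Iio.1 h) hj'.not_gt
      · exact hj'.ne' (Finset.mem_singleton.1 h)
  convert G.smul_mem (shufSign K d e) hmem using 1
  simp only [Ψ, LinearMap.prod_apply, Function.prod_apply, LinearMap.comp_apply,
    LinearMap.add_apply, LinearMap.smul_apply, LinearMap.sum_apply, Prod.smul_mk]
  refine Prod.ext (shufTensor_tprod hs E v hx hy) ?_
  simp only
  rw [shufTensor_tprod hs E _ hx hy, E.powD_tprod hy, map_sum, smul_add, add_assoc,
    Finset.smul_sum, Finset.smul_sum, ← Finset.sum_add_distrib]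
  congr 1
  refine Finset.sum_congr rfl fun i _ => ?_
  rw [shufTensor_tprod hs E _ (hx' i) hy, map_smul, shufTensor_tprod hs E _ hx (hy' i),
    hux, huy, hM, hM, shufSign_update_left, shufSign_update_right,
    GMod.tensorD_tmul hD dD E.d (hx i), M.map_update_add, M.map_update_smul]
  simp only [smul_smul, smul_add]
  -- An operator of degree `-1` passes `v` and the pairs before `x i ⊗ y i`; the differential of `E`
  -- also passes `x i`. The elements `x j` with `i < j` are passed twice in the latter case, once by
  -- the operator and once by its value in the shuffle, so that they do not contribute.
  have h1 := ksgn_mul_self K (∑ j ∈ Finset.Ioi i, d j)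
  congr 2
  · rw [Finset.sum_add_distrib, ← add_assoc, ksgn_add K (e₀ + _)]
    ring
  · rw [hsign i, Finset.sum_add_distrib]
    simp only [ksgn_add]
    linear_combination (shufSign K d e * ksgn K e₀ * ksgn K (∑ j ∈ Finset.Iio i, d j) *
      ksgn K (d i) * ksgn K (∑ j ∈ Finset.Iio i, e j)) * h1

end SMod

/-! ### Grouping the factors of an iterated coproduct -/

section Grouping

theorem finSigmaFinEquiv_castSucc {k : ℕ} (m : Fin (k + 1) → ℕ) (i : Fin k)
    (j : Fin (m i.castSucc)) :
    (finSigmaFinEquiv (⟨i.castSucc, j⟩ : Σ i, Fin (m i)) : ℕ) =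
      (finSigmaFinEquiv (⟨i, j⟩ : Σ i : Fin k, Fin (m i.castSucc)) : ℕ) := by
  rw [finSigmaFinEquiv_apply, finSigmaFinEquiv_apply]
  rfl

theorem finSigmaFinEquiv_last {k : ℕ} (m : Fin (k + 1) → ℕ) (j : Fin (m (Fin.last k))) :
    (finSigmaFinEquiv (⟨Fin.last k, j⟩ : Σ i, Fin (m i)) : ℕ) = ∑ i : Fin k, m i.castSucc + j := by
  rw [finSigmaFinEquiv_apply]
  rfl

theorem finSigmaFinEquiv_lt_of_fst_lt {k : ℕ} {m : Fin k → ℕ} {p q : Σ i, Fin (m i)}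
    (h : p.1 < q.1) : finSigmaFinEquiv p < finSigmaFinEquiv q := by
  rw [Fin.lt_def]
  induction k with
  | zero => exact p.1.elim0
  | succ k ih =>
    obtain ⟨i, a⟩ := p
    obtain ⟨j, b⟩ := q
    induction j using Fin.lastCases with
    | last =>
      induction i using Fin.lastCases with
      | last => exact absurd h (lt_irrefl _)
      | cast i =>
        rw [finSigmaFinEquiv_last, finSigmaFinEquiv_castSucc]
        exact lt_of_lt_of_le (Fin.is_lt _) (Nat.le_add_right _ _)
    | cast j =>
      induction i using Fin.lastCases with
      | last => exact absurd h (Fin.castSucc_lt_last j).not_gt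
      | cast i =>
        rw [finSigmaFinEquiv_castSucc, finSigmaFinEquiv_castSucc]
        exact ih (m := fun i => m i.castSucc) (p := ⟨i, a⟩) (q := ⟨j, b⟩) (by simpa using h)

theorem finSigmaFinEquiv_lt_iff {k : ℕ} {m : Fin k → ℕ} {p q : Σ i, Fin (m i)} :
    finSigmaFinEquiv p < finSigmaFinEquiv q ↔ (p.1 < q.1 ∨ (p.1 = q.1 ∧ (p.2 : ℕ) < q.2)) := by
  rcases lt_trichotomy p.1 q.1 with h | h | h
  · simp [h, finSigmaFinEquiv_lt_of_fst_lt h]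
  · obtain ⟨i, a⟩ := p
    obtain ⟨j, b⟩ := q
    obtain rfl : i = j := h
    rw [Fin.lt_def, finSigmaFinEquiv_apply, finSigmaFinEquiv_apply]
    simp
  · have := (finSigmaFinEquiv_lt_of_fst_lt h).not_gt
    simp [h.not_gt, h.ne', this]

/-- The product of a family indexed by the lexicographically ordered pairs, as an iterated
product. -/
theorem prod_ofFn_finSigmaFinEquiv {A : Type*} [Monoid A] {k : ℕ} (m : Fin k → ℕ)
    (g : (Σ i, Fin (m i)) → A) :
    (List.ofFn fun p => g (finSigmaFinEquiv.symm p)).prod =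
      (List.ofFn fun i => (List.ofFn fun j => g ⟨i, j⟩).prod).prod := by
  induction k with
  | zero =>
    rw [List.ofFn_congr (Fin.sum_univ_zero m)]
    simp
  | succ k ih =>
    have h := Fin.sum_univ_castSucc m
    rw [List.ofFn_succ' (f := fun i => (List.ofFn fun j => g ⟨i, j⟩).prod), List.prod_concat,
      ← ih (fun i => m i.castSucc) (fun q => g ⟨q.1.castSucc, q.2⟩), List.ofFn_congr h,
      List.ofFn_add, List.prod_append]
    congr 1
    · congr 2
      funext p
      obtain ⟨q, rfl⟩ := finSigmaFinEquiv.surjective p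
      rw [Equiv.symm_apply_apply]
      congr 1
      rw [Equiv.symm_apply_eq, Fin.ext_iff, finSigmaFinEquiv_castSucc]
      rfl
    · congr 2
      funext p
      congr 1
      rw [Equiv.symm_apply_eq, Fin.ext_iff, finSigmaFinEquiv_last]
      rfl

end Grouping

namespace UCocom

variable {K : Type u} [Field K]

/-- The concatenation of tensors
`(y 1 1 ⊗ y 1 2 ⊗ ⋯), …, (y k 1 ⊗ y k 2 ⊗ ⋯) ↦ y 1 1 ⊗ y 1 2 ⊗ ⋯ ⊗ y k 1 ⊗ y k 2 ⊗ ⋯`, obtained from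
the product of the tensor algebra. -/
noncomputable def concatMap (M : Type u) [AddCommGroup M] [Module K M] {k : ℕ} (m : Fin k → ℕ) :
    MultilinearMap K (fun i => ⨂[K] _ : Fin (m i), M) (⨂[K] _ : Fin (∑ i, m i), M) :=
  (DirectSum.component K ℕ (fun n => ⨂[K] _ : Fin n, M) (∑ i, m i) ∘ₗ
    (TensorAlgebra.toDirectSum (R := K) (M := M)).toLinearMap).compMultilinearMap
      ((MultilinearMap.mkPiAlgebraFin K k (TensorAlgebra K M)).compLinearMap
        fun _ => TensorPower.toTensorAlgebra)

theorem component_toDirectSum (M : Type u) [AddCommGroup M] [Module K M] {n : ℕ}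
    (t : ⨂[K] _ : Fin n, M) :
    DirectSum.component K ℕ (fun n => ⨂[K] _ : Fin n, M) n
      (TensorAlgebra.toDirectSum (TensorPower.toTensorAlgebra t)) = t := by
  have h : TensorPower.toTensorAlgebra t =
      TensorAlgebra.ofDirectSum (DirectSum.of (fun n => ⨂[K] _ : Fin n, M) n t) := by
    induction t using PiTensorProduct.induction_on with
    | smul_tprod r x =>
      have := TensorAlgebra.ofDirectSum_of_tprod (R := K) x
      rw [map_smul, TensorPower.toTensorAlgebra_tprod, ← this, ← map_smul,
        ← DirectSum.lof_eq_of K, ← DirectSum.lof_eq_of K]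
      exact congrArg _ (map_smul (DirectSum.lof K ℕ (fun n => ⨂[K] _ : Fin n, M) n) r _).symm
    | add s t hs ht => rw [map_add, hs, ht, map_add, map_add]
  rw [h, TensorAlgebra.toDirectSum_ofDirectSum]
  exact DirectSum.component.lof_self (M := fun n => ⨂[K] _ : Fin n, M) K n t

theorem toTensorAlgebra_injective (M : Type u) [AddCommGroup M] [Module K M] {n : ℕ} :
    Function.Injective (TensorPower.toTensorAlgebra (R := K) (M := M) (n := n)) := fun s t h => by
  rw [← component_toDirectSum M s, h, component_toDirectSum]

/-- In the tensor algebra, a product of products is a product over the concatenated index set. -/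
theorem toTensorAlgebra_tprod_flatten (M : Type u) [AddCommGroup M] [Module K M] {k : ℕ}
    (m : Fin k → ℕ) (y : ∀ i, Fin (m i) → M) :
    (List.ofFn fun i => TensorPower.toTensorAlgebra (n := m i)
      (PiTensorProduct.tprod K (y i))).prod =
      TensorPower.toTensorAlgebra (PiTensorProduct.tprod K
        fun p : Fin (∑ i, m i) => y (finSigmaFinEquiv.symm p).1 (finSigmaFinEquiv.symm p).2) := by
  simp only [TensorPower.toTensorAlgebra_tprod, TensorAlgebra.tprod_apply]
  exact (prod_ofFn_finSigmaFinEquiv m fun q => TensorAlgebra.ι K (y q.1 q.2)).symm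

theorem concatMap_tprod (M : Type u) [AddCommGroup M] [Module K M] {k : ℕ} (m : Fin k → ℕ)
    (y : ∀ i, Fin (m i) → M) :
    concatMap (K := K) M m (fun i => PiTensorProduct.tprod K (y i)) = PiTensorProduct.tprod K
      fun p : Fin (∑ i, m i) => y (finSigmaFinEquiv.symm p).1 (finSigmaFinEquiv.symm p).2 := by
  simp only [concatMap, LinearMap.compMultilinearMap_apply, MultilinearMap.compLinearMap_apply,
    MultilinearMap.mkPiAlgebraFin_apply, LinearMap.comp_apply, AlgHom.toLinearMap_apply]
  rw [toTensorAlgebra_tprod_flatten, component_toDirectSum]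

theorem toTensorAlgebra_concatMap (M : Type u) [AddCommGroup M] [Module K M] {k : ℕ}
    (m : Fin k → ℕ) (t : ∀ i, ⨂[K] _ : Fin (m i), M) :
    TensorPower.toTensorAlgebra (concatMap (K := K) M m t) =
      (List.ofFn fun i => TensorPower.toTensorAlgebra (t i)).prod := by
  let f : MultilinearMap K (fun i => ⨂[K] _ : Fin (m i), M) (TensorAlgebra K M) :=
    TensorPower.toTensorAlgebra.compMultilinearMap (concatMap (K := K) M m) -
      (MultilinearMap.mkPiAlgebraFin K k (TensorAlgebra K M)).compLinearMap
        fun _ => TensorPower.toTensorAlgebra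
  have := f.mem_of_mem_span (fun i => Set.range (PiTensorProduct.tprod K)) ⊥ (fun x hx => by
    choose y hy using hx
    obtain rfl : (fun i => PiTensorProduct.tprod K (y i)) = x := funext hy
    simp only [f, _root_.sub_apply, LinearMap.compMultilinearMap_apply,
      MultilinearMap.compLinearMap_apply, MultilinearMap.mkPiAlgebraFin_apply, Submodule.mem_bot]
    rw [concatMap_tprod, toTensorAlgebra_tprod_flatten, sub_self]) t (fun i => by
      rw [PiTensorProduct.span_tprod_eq_top]; trivial)
  simpa only [f, _root_.sub_apply, LinearMap.compMultilinearMap_apply,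
      MultilinearMap.compLinearMap_apply, MultilinearMap.mkPiAlgebraFin_apply, Submodule.mem_bot,
      sub_eq_zero] using this

open WithConv in
/-- Iterated coproducts compute the products of the convolution algebra. -/
theorem lift_mkPiAlgebraFin_iterComul (E : UCocom K) {A : Type u} [Ring A] [Algebra K A] {k : ℕ}
    (f : Fin k → (E.toGMod.carrier →ₗ[K] A)) (y : E.toGMod) :
    letI := E.coalgebra
    PiTensorProduct.lift ((MultilinearMap.mkPiAlgebraFin K k A).compLinearMap f)
      (E.iterComul k y) = (List.ofFn fun i => toConv (f i)).prod.ofConv y := by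
  let _ := E.coalgebra
  induction k generalizing y with
  | zero =>
    simp only [iterComul, LinearMap.smulRight_apply, map_smul, PiTensorProduct.lift.tprod,
      MultilinearMap.compLinearMap_apply, MultilinearMap.mkPiAlgebraFin_apply, List.ofFn_zero,
      List.prod_nil]
    exact (Algebra.algebraMap_eq_smul_one (R := K) (A := A) (E.counit y)).symm
  | succ k ih =>
    rw [iterComul_succ, List.ofFn_succ, List.prod_cons, LinearMap.convMul_def]
    simp only [LinearMap.comp_apply]
    change _ = LinearMap.mul' K A (TensorProduct.map (f 0)
      ((List.ofFn fun i : Fin k => toConv (f i.succ)).prod.ofConv) (E.comul y))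
    generalize E.comul y = t
    induction t using TensorProduct.induction_on with
    | zero => simp
    | add s t hs ht => simp only [map_add, hs, ht]
    | tmul a b =>
      simp only [TensorProduct.map_tmul, LinearMap.id_apply, LinearMap.mul'_apply,
        ← ih (fun i => f i.succ) b]
      generalize E.iterComul k b = t
      induction t using PiTensorProduct.induction_on with
      | smul_tprod r z =>
        simp [consMap_tmul, List.ofFn_succ]
      | add s t hs ht => simp only [map_add, TensorProduct.tmul_add, mul_add, hs, ht]

open WithConv in
/-- Coassociativity: an iterated coproduct of length `∑ i, m i` consists of iterated coproducts of
lengths `m i` of the factors of an iterated coproduct of length `k`. -/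
theorem iterComul_sum (E : UCocom K) {k : ℕ} (m : Fin k → ℕ) (y : E.toGMod) :
    E.iterComul (∑ i, m i) y =
      PiTensorProduct.lift ((concatMap (K := K) E.toGMod.carrier m).compLinearMap
        fun i => E.iterComul (m i)) (E.iterComul k y) := by
  let _ := E.coalgebra
  let ι : WithConv (E.toGMod.carrier →ₗ[K] TensorAlgebra K E.toGMod.carrier) :=
    toConv (TensorAlgebra.ι K)
  -- In the algebra of linear maps from `E` to its tensor algebra, with the convolution product, the
  -- iterated coproduct of length `n` is the `n`-th power of the inclusion, so that the statement
  -- becomes the rule for the product of powers.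
  have hpow : ∀ n y, TensorPower.toTensorAlgebra (E.iterComul n y) = (ι ^ n).ofConv y := by
    intro n y
    have h := E.lift_mkPiAlgebraFin_iterComul (fun _ : Fin n => TensorAlgebra.ι K) y
    rw [List.ofFn_const, List.prod_replicate] at h
    rw [← h]
    congr 1
  have hsum : (List.ofFn fun i => ι ^ m i).prod = ι ^ ∑ i, m i := by
    clear hpow y
    induction k with
    | zero => simp
    | succ k ih => rw [List.ofFn_succ, List.prod_cons, ih, Fin.sum_univ_succ, pow_add]
  apply toTensorAlgebra_injective
  rw [hpow, ← hsum]
  have h := E.lift_mkPiAlgebraFin_iterComul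
    (fun i => TensorPower.toTensorAlgebra ∘ₗ E.iterComul (m i)) y
  have hι : ∀ i, toConv (TensorPower.toTensorAlgebra ∘ₗ E.iterComul (m i)) = ι ^ m i := by
    intro i
    apply ofConv_injective
    exact LinearMap.ext fun y => hpow (m i) y
  simp only [hι] at h
  rw [← h]
  generalize E.iterComul k y = t
  induction t using PiTensorProduct.induction_on with
  | smul_tprod r z =>
    simp only [map_smul, PiTensorProduct.lift.tprod, MultilinearMap.compLinearMap_apply,
      toTensorAlgebra_concatMap, MultilinearMap.mkPiAlgebraFin_apply, LinearMap.comp_apply]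
  | add s t hs ht => simp only [map_add, hs, ht]

end UCocom

/-! ### Compatibility of the shuffle map with the associativity isomorphism -/

section Signs

variable (K : Type u) [Field K]

/-- The Koszul sign by which `w 1, …, w k, u 1, …, u l`, of degrees `d` and `e`, are reordered into
`w 1, u 1, …, u (m 1), w 2, …`. -/
noncomputable def groupSign {k : ℕ} (m : Fin k → ℕ) (d : Fin k → ℤ)
    (e : (Σ i, Fin (m i)) → ℤ) : K :=
  ∏ p : Σ i, Fin (m i), ∏ i, if p.1 < i then ksgn K (e p * d i) else 1

/-- The grouping sign is multiplicative in the degrees of the elements to be grouped. -/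
theorem groupSign_add {k : ℕ} (m : Fin k → ℕ) (d : Fin k → ℤ) (e e' : (Σ i, Fin (m i)) → ℤ) :
    groupSign K m d (fun p => e p + e' p) = groupSign K m d e * groupSign K m d e' := by
  simp only [groupSign, ← Finset.prod_mul_distrib]
  refine Finset.prod_congr rfl fun p _ => Finset.prod_congr rfl fun i _ => ?_
  split_ifs
  · rw [add_mul, ksgn_add]
  · simp

/-- Moving blocks of elements as if each of them was one element gives the grouping sign. -/
theorem shufSign_sum {k : ℕ} (m : Fin k → ℕ) (d : Fin k → ℤ) (e : (Σ i, Fin (m i)) → ℤ) :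
    shufSign K d (fun i => ∑ j, e ⟨i, j⟩) = groupSign K m d e := by
  rw [groupSign, Fintype.prod_sigma, shufSign]
  refine Finset.prod_congr rfl fun i _ => ?_
  rw [Finset.prod_comm]
  refine Finset.prod_congr rfl fun i' _ => ?_
  split_ifs with h
  · rw [Finset.mul_sum, ksgn_sum]
    exact Finset.prod_congr rfl fun j _ => by rw [mul_comm]
  · simp

/-- The reordering of `x p, y p`, for `p` in the concatenation of several intervals, is performed
between the different intervals, and then within each interval. -/
theorem shufSign_finSigmaFinEquiv {k : ℕ} (m : Fin k → ℕ) (e g : (Σ i, Fin (m i)) → ℤ) :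
    shufSign K (fun p => e (finSigmaFinEquiv.symm p)) (fun p => g (finSigmaFinEquiv.symm p)) =
      shufSign K (fun i => ∑ j, e ⟨i, j⟩) (fun i => ∑ j, g ⟨i, j⟩) *
        ∏ i, shufSign K (fun j => e ⟨i, j⟩) (fun j => g ⟨i, j⟩) := by
  rw [shufSign_sum, groupSign, Fintype.prod_sigma, ← Finset.prod_mul_distrib, shufSign,
    ← Equiv.prod_comp finSigmaFinEquiv, Fintype.prod_sigma]
  refine Finset.prod_congr rfl fun i _ => ?_
  rw [shufSign, ← Finset.prod_mul_distrib]
  refine Finset.prod_congr rfl fun j _ => ?_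
  rw [← Equiv.prod_comp finSigmaFinEquiv, Fintype.prod_sigma,
    ← Finset.prod_erase_mul _ _ (Finset.mem_univ i),
    ← Finset.prod_erase_mul Finset.univ (fun i' => if i < i' then _ else _) (Finset.mem_univ i)]
  simp only [lt_irrefl, if_false, mul_one]
  congr 1
  · refine Finset.prod_congr rfl fun i' hi' => ?_
    have hne : i ≠ i' := (Finset.ne_of_mem_erase hi').symm
    simp only [finSigmaFinEquiv_lt_iff, hne, false_and, or_false, Equiv.symm_apply_apply]
    split_ifs with h
    · rw [Finset.mul_sum, ksgn_sum]
      exact Finset.prod_congr rfl fun j _ => by rw [mul_comm]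
    · simp
  · refine Finset.prod_congr rfl fun j' _ => ?_
    have : (finSigmaFinEquiv (⟨i, j⟩ : Σ i, Fin (m i)) < finSigmaFinEquiv ⟨i, j'⟩) ↔ j < j' := by
      rw [finSigmaFinEquiv_lt_iff]; simp
    simp only [this, Equiv.symm_apply_apply]

/-- A relabelling of the inputs of a tree contributes the sign of the permutation of the inputs. -/
theorem assocSign_trans {k : ℕ} (m : Fin k → ℕ) (τ : Equiv.Perm (Fin (∑ i, m i)))
    (d : Fin k → ℤ) (e : Fin (∑ i, m i) → ℤ) :
    SMod.assocSign K m (finSigmaFinEquiv.trans τ) d e = koszulSign K τ.symm e *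
      groupSign K m d (fun p => e (τ (finSigmaFinEquiv p))) := by
  rw [SMod.assocSign, mul_comm]
  congr 1
  rw [koszulSign, ← Equiv.prod_comp (finSigmaFinEquiv.trans τ), Finset.prod_comm]
  refine Finset.prod_congr rfl fun q _ => ?_
  rw [← Equiv.prod_comp (finSigmaFinEquiv.trans τ)]
  refine Finset.prod_congr rfl fun p _ => ?_
  simp only [Equiv.trans_apply, Equiv.symm_apply_apply, ← finSigmaFinEquiv_lt_iff]
  rw [mul_comm (e _)]
  exact if_congr and_comm rfl rfl

theorem assocSign_finSigmaFinEquiv {k : ℕ} (m : Fin k → ℕ) (d : Fin k → ℤ)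
    (e : Fin (∑ i, m i) → ℤ) :
    SMod.assocSign K m finSigmaFinEquiv d e =
      groupSign K m d (fun p => e (finSigmaFinEquiv p)) := by
  have := assocSign_trans K m 1 d e
  rwa [show (1 : Equiv.Perm (Fin (∑ i, m i))).symm = 1 from rfl, koszulSign_one, one_mul] at this

end Signs

namespace SMod

variable {K : Type u} [Field K]

/-- The associativity isomorphism is determined by its values on trees whose inputs are labelled in
the planar order. -/
theorem evalAssocGraph_le (V W : SMod K) (D : GMod K)
    (S : Submodule K (eval (comp V W) D × eval V (eval W D)))
    (h : ∀ (k : ℕ) (m : Fin k → ℕ) (v : V.obj k) (w : ∀ i, W.obj (m i))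
      (x : Fin (∑ i, m i) → D) (d : Fin k → ℤ) (e : Fin (∑ i, m i) → ℤ),
      (∀ i, w i ∈ (W.obj (m i)).gr (d i)) → (∀ a, x a ∈ D.gr (e a)) →
      (evalMk (comp V W) D (compMk V W m finSigmaFinEquiv v w) x,
        groupSign K m d (fun p => e (finSigmaFinEquiv p)) • evalMk V (eval W D) v
          (fun i => evalMk W D (w i) (fun j => x (finSigmaFinEquiv ⟨i, j⟩)))) ∈ S) :
    evalAssocGraph V W D ≤ S := by
  refine Submodule.span_le.2 ?_
  rintro _ ⟨k, l, m, γ, v, w, x, d, e, hw, hx, rfl⟩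
  obtain rfl : l = ∑ i, m i := by
    simpa using (Fintype.card_congr γ).symm
  obtain ⟨τ, rfl⟩ : ∃ τ : Equiv.Perm (Fin (∑ i, m i)), γ = finSigmaFinEquiv.trans τ :=
    ⟨finSigmaFinEquiv.symm.trans γ, by ext; simp⟩
  have h1 : evalMk (comp V W) D (compMk V W m (finSigmaFinEquiv.trans τ) v w) x =
      koszulSign K τ.symm e • evalMk (comp V W) D (compMk V W m finSigmaFinEquiv v w)
        (fun i => x (τ i)) := by
    have h2 := act_compMk V W τ.symm m finSigmaFinEquiv v w
    rw [Equiv.symm_symm] at h2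
    rw [← h2]
    exact evalMk_act (comp V W) D τ.symm _ x e hx
  have h3 := S.smul_mem (koszulSign K τ.symm e) (h k m v w (fun i => x (τ i)) d
    (fun i => e (τ i)) hw (fun i => hx (τ i)))
  rw [SetLike.mem_coe]
  convert h3 using 1
  refine Prod.ext h1 ?_
  simp only [Prod.smul_mk, smul_smul, assocSign_trans]
  rfl

theorem planar_mem_evalAssocGraph (V W : SMod K) (D : GMod K) {k : ℕ} (m : Fin k → ℕ)
    (v : V.obj k) (w : ∀ i, W.obj (m i)) (x : Fin (∑ i, m i) → D) (d : Fin k → ℤ)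
    (e : Fin (∑ i, m i) → ℤ) (hw : ∀ i, w i ∈ (W.obj (m i)).gr (d i))
    (hx : ∀ a, x a ∈ D.gr (e a)) :
    (evalMk (comp V W) D (compMk V W m finSigmaFinEquiv v w) x,
      groupSign K m d (fun p => e (finSigmaFinEquiv p)) • evalMk V (eval W D) v
        (fun i => evalMk W D (w i) (fun j => x (finSigmaFinEquiv ⟨i, j⟩)))) ∈
      evalAssocGraph V W D := by
  rw [← assocSign_finSigmaFinEquiv]
  exact Submodule.subset_span ⟨k, _, m, finSigmaFinEquiv, v, w, x, d, e, hw, hx, rfl⟩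

variable {V W : SMod K} {D : GMod K} {s : D →ₗ[K] D}

/-- The shuffle map, as a map of graded modules. -/
noncomputable def shufHom (hW : W.IsAct) (hs : D.IsParity s) (E : UCocom K) :
    GMod.Hom ((W.eval D).tensor E.toGMod) (W.eval (D.tensor E.toGMod)) where
  lin := TensorProduct.lift (shuf hW hs E)
  map_gr _ _ ht := DGMod.tensor_gr_le (D := W.eval D) (E := E.toGMod) _ _
    (fun _ _ _ _ hx hy h => shuf_gr hW hs E hx hy h) ht

/-- The shuffle map for `V ∘ W` is obtained from those for `V` and for `W`, by way of the
associativity isomorphism `(V ∘ W) ∘ D ≃ V ∘ (W ∘ D)`. This is coassociativity in the form of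
`iterComul_sum`: to distribute over all the inputs of a tree, `y` is first distributed over the
upper vertices. -/
theorem shuf_mem_assocGraph (hV : V.IsAct) (hW : W.IsAct) (hs : D.IsParity s)
    {S : W.eval D →ₗ[K] W.eval D} (hS : (W.eval D).IsParity S) (E : UCocom K)
    {a : eval (comp V W) D} {b : eval V (eval W D)} (h : (a, b) ∈ evalAssocGraph V W D)
    (y : E.toGMod) :
    (shuf (isAct_comp V W) hs E a y,
      (evalMap (Hom.id V) (shufHom hW hs E)).lin (shuf hV hS E b y)) ∈
      evalAssocGraph V W (D.tensor E.toGMod) := by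
  set G := evalAssocGraph V W (D.tensor E.toGMod)
  suffices hle : evalAssocGraph V W D ≤ G.comap (LinearMap.prodMap
      ((shuf (isAct_comp V W) hs E).flip y)
      ((evalMap (Hom.id V) (shufHom hW hs E)).lin ∘ₗ (shuf hV hS E).flip y)) from hle h
  refine evalAssocGraph_le V W D _ fun k m v w x d e hw hx => ?_
  set z : Fin k → W.eval D := fun i => evalMk W D (w i) (fun j => x (finSigmaFinEquiv ⟨i, j⟩))
  set ε := groupSign K m d (fun p => e (finSigmaFinEquiv p))
  have hz : ∀ i, z i ∈ (W.eval D).gr (d i + ∑ j, e (finSigmaFinEquiv ⟨i, j⟩)) := fun i =>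
    evalMk_mem_gr W D (hw i) (fun j => hx _) rfl
  -- Both sides are linear functions of the iterated coproduct of `y` of length `k`.
  let Φ : (⨂[K] _ : Fin k, E.toGMod.carrier) →ₗ[K]
      (eval (comp V W) (D.tensor E.toGMod) × eval V (eval W (D.tensor E.toGMod))) :=
    LinearMap.prod
      (shufTensor (comp V W) s E (compMk V W m finSigmaFinEquiv v w) x ∘ₗ
        PiTensorProduct.lift ((UCocom.concatMap (K := K) E.toGMod.carrier m).compLinearMap
          fun i => E.iterComul (m i)))
      (ε • ((evalMap (Hom.id V) (shufHom hW hs E)).lin ∘ₗ shufTensor V S E v z))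
  suffices hΦ : ∀ t, Φ t ∈ G by
    have := hΦ (E.iterComul k y)
    rw [Submodule.mem_comap]
    convert this using 1
    simp only [Φ, LinearMap.prod_apply, Function.prod_apply, LinearMap.prodMap_apply,
      LinearMap.comp_apply, LinearMap.smul_apply, LinearMap.flip_apply, map_smul,
      ← UCocom.iterComul_sum]
    exact Prod.ext (shuf_mk (isAct_comp V W) hs E _ x y) (congrArg (fun t => ε •
      (evalMap (Hom.id V) (shufHom hW hs E)).lin t) (shuf_mk hV hS E v z y))
  refine fun t => tprod_homogeneous_induction E.isGraded Φ G (fun y' f hy' => ?_) t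
  set ε' := shufSign K (fun i => d i + ∑ j, e (finSigmaFinEquiv ⟨i, j⟩)) f
  -- For homogeneous `y' i`, they are multilinear functions of the iterated coproducts of these
  -- elements, which may be replaced with pure tensors.
  let M : MultilinearMap K (fun i => ⨂[K] _ : Fin (m i), E.toGMod.carrier)
      (eval (comp V W) (D.tensor E.toGMod) × eval V (eval W (D.tensor E.toGMod))) :=
    MultilinearMap.prod
      ((shufTensor (comp V W) s E (compMk V W m finSigmaFinEquiv v w) x).compMultilinearMap
        (UCocom.concatMap (K := K) E.toGMod.carrier m))
      (((ε * ε') • evalLin V (W.eval (D.tensor E.toGMod)) k v).compMultilinearMap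
        ((PiTensorProduct.tprod K).compLinearMap fun i =>
          shufTensor W s E (w i) (fun j => x (finSigmaFinEquiv ⟨i, j⟩))))
  have hΦM : Φ (PiTensorProduct.tprod K y') = M (fun i => E.iterComul (m i) (y' i)) := by
    simp only [Φ, M, LinearMap.prod_apply, Function.prod_apply, LinearMap.comp_apply,
      LinearMap.smul_apply, PiTensorProduct.lift.tprod, MultilinearMap.compLinearMap_apply,
      MultilinearMap.prod_apply, LinearMap.compMultilinearMap_apply]
    refine Prod.ext rfl ?_
    rw [shufTensor_tprod hS E v hz hy', map_smul, smul_smul]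
    refine congrArg (fun t => (ε * ε') • t) ?_
    refine (evalMap_mk (Hom.id V) (shufHom hW hs E) v (fun i => z i ⊗ₜ[K] y' i)).trans ?_
    refine congrArg (fun t => evalMk V (W.eval (D.tensor E.toGMod)) v t) (funext fun i => ?_)
    exact shuf_mk hW hs E (w i) _ (y' i)
  rw [hΦM]
  refine M.mem_of_mem_span (fun i => {t | ∃ (y : Fin (m i) → E.toGMod) (d : Fin (m i) → ℤ),
    (∀ j, y j ∈ E.toGMod.gr (d j)) ∧ ∑ j, d j = f i ∧ t = PiTensorProduct.tprod K y}) G ?_ _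
    (fun i => E.iterComul_gr (m i) (hy' i))
  intro t ht
  choose u g hu hg ht using ht
  obtain rfl : t = fun i => PiTensorProduct.tprod K (u i) := funext ht
  obtain rfl : (fun i => ∑ j, g i j) = f := funext hg
  have hu' : ∀ p, u (finSigmaFinEquiv.symm p).1 (finSigmaFinEquiv.symm p).2 ∈
      E.toGMod.gr (g (finSigmaFinEquiv.symm p).1 (finSigmaFinEquiv.symm p).2) := fun p => hu _ _
  have hu'' : ∀ i j, (fun q : Σ i, Fin (m i) => u q.1 q.2)
      (finSigmaFinEquiv.symm (finSigmaFinEquiv ⟨i, j⟩)) = u i j := fun i j => by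
    rw [Equiv.symm_apply_apply]
  have hg'' : ∀ p, (fun q : Σ i, Fin (m i) => g q.1 q.2)
      (finSigmaFinEquiv.symm (finSigmaFinEquiv p)) = g p.1 p.2 := fun p => by
    rw [Equiv.symm_apply_apply]
  have hmem := planar_mem_evalAssocGraph V W (D.tensor E.toGMod) m v w
    (fun p => x p ⊗ₜ[K] u (finSigmaFinEquiv.symm p).1 (finSigmaFinEquiv.symm p).2) d
    (fun p => e p + g (finSigmaFinEquiv.symm p).1 (finSigmaFinEquiv.symm p).2) hw
    (fun p => GMod.tmul_mem (hx p) (hu' p) rfl)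
  simp only at hu'' hg''
  -- Both ways of moving the `u i j` to their places have the same sign.
  have hsign : shufSign K e (fun p => g (finSigmaFinEquiv.symm p).1 (finSigmaFinEquiv.symm p).2) *
      groupSign K m d (fun p => e (finSigmaFinEquiv p) + g p.1 p.2) = ε * ε' *
        ∏ i, shufSign K (fun j => e (finSigmaFinEquiv ⟨i, j⟩)) (g i) := by
    have h1 := shufSign_finSigmaFinEquiv K m (fun p => e (finSigmaFinEquiv p))
      (fun p => g p.1 p.2)
    simp only [Equiv.apply_symm_apply] at h1
    simp only [ε, ε']
    rw [h1, groupSign_add, shufSign_add_left, ← shufSign_sum K m d (fun p => g p.1 p.2)]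
    ring
  convert G.smul_mem (shufSign K e (fun p => g (finSigmaFinEquiv.symm p).1
    (finSigmaFinEquiv.symm p).2)) hmem using 1
  simp only [M, MultilinearMap.prod_apply, LinearMap.compMultilinearMap_apply,
    MultilinearMap.compLinearMap_apply, LinearMap.smul_apply, Prod.smul_mk, smul_smul,
    UCocom.concatMap_tprod, hg'', hsign]
  refine Prod.ext (shufTensor_tprod hs E _ hx hu') ?_
  simp only
  rw [mul_smul (ε * ε')]
  refine congrArg (HSMul.hSMul (ε * ε')) ?_
  have h2 : ∀ i, shufTensor W s E (w i) (fun j => x (finSigmaFinEquiv ⟨i, j⟩))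
      (PiTensorProduct.tprod K (u i)) =
      shufSign K (fun j => e (finSigmaFinEquiv ⟨i, j⟩)) (g i) •
        evalMk W (D.tensor E.toGMod) (w i) (fun j => x (finSigmaFinEquiv ⟨i, j⟩) ⊗ₜ[K] u i j) :=
    fun i => shufTensor_tprod hs E (w i) (fun j => hx _) (hu i)
  simp only [h2, MultilinearMap.map_smul_univ, map_smul]
  refine congrArg (fun t => (∏ i, shufSign K (fun j => e (finSigmaFinEquiv ⟨i, j⟩)) (g i)) • t) ?_
  refine congrArg (fun t => evalMk V (W.eval (D.tensor E.toGMod)) v t) (funext fun i => ?_)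
  simp only [hu'']

end SMod

/-! ### The tensor product of a coalgebra over a curved cooperad with a cocommutative coalgebra -/

namespace GMod

variable {K : Type u} [Field K]

/-- The identity of a graded module. -/
def Hom.id (D : GMod K) : Hom D D := ⟨LinearMap.id, fun _ _ h => h⟩

/-- The operator `x ↦ (-1) ^ |x| x`, as a map of graded modules. -/
noncomputable def Hom.parity {D : GMod K} (hD : D.IsGraded) : Hom D D where
  lin := sgn hD 1
  map_gr n x hx := by
    rw [sgn_apply hD 1 hx]
    exact (D.gr n).smul_mem _ hx

theorem Hom.map_parity {D D' : GMod K} (hD : D.IsGraded) {s : D →ₗ[K] D} {s' : D' →ₗ[K] D'}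
    (hs : D.IsParity s) (hs' : D'.IsParity s') (f : Hom D D') (x : D) :
    f.lin (s x) = s' (f.lin x) := by
  refine hom_induction hD (p := fun x => f.lin (s x) = s' (f.lin x)) (fun n x hx => ?_)
    (by simp) (fun x y hx hy => by simp only [map_add, hx, hy]) x
  rw [hs n x hx, hs' n _ (f.map_gr n x hx), map_smul]

end GMod

namespace SMod

variable {K : Type u} [Field K] {V : SMod K} {D : GMod K}

/-- The operator `c ↦ (-1) ^ |c| c` of a symmetric module. -/
noncomputable def Hom.parity (hV : V.IsSMod) : Hom V V where
  app n := GMod.Hom.parity (hV.isGraded n)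
  equivariant n σ c := GMod.Hom.map_parity (hV.isGraded n)
    (GMod.isParity_sgn (hV.isGraded n)) (GMod.isParity_sgn (hV.isGraded n))
    ⟨V.act n σ, hV.act_gr n σ⟩ c |>.symm

/-- The operator `z ↦ (-1) ^ |z| z` of `V ∘ D`. -/
noncomputable def evalParity (hV : V.IsSMod) (hD : D.IsGraded) : V.eval D →ₗ[K] V.eval D :=
  (evalMap (Hom.parity hV) (GMod.Hom.parity hD)).lin

theorem isParity_evalParity (hV : V.IsSMod) (hD : D.IsGraded) :
    (V.eval D).IsParity (evalParity hV hD) := by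
  intro e z hz
  change z ∈ LinearMap.eqLocus (evalParity hV hD) (ksgn K e • LinearMap.id)
  refine (Submodule.span_le.2 ?_) hz
  rintro _ ⟨n, v, x, e₀, d, hv, hx, rfl, rfl⟩
  rw [SetLike.mem_coe, LinearMap.mem_eqLocus, evalParity, evalMap_mk]
  simp only [Hom.parity, GMod.Hom.parity, GMod.isParity_sgn _ _ _ hv,
    GMod.isParity_sgn _ _ _ (hx _)]
  rw [← evalLin_tprod, MultilinearMap.map_smul_univ, map_smul, map_smul, LinearMap.smul_apply,
    evalLin_tprod, smul_smul, ksgn_add, ksgn_sum, mul_comm]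
  rfl

end SMod

namespace Cog

variable {K : Type u} [Field K] {C : CurvedCooperad K}

theorem isAct (C : CurvedCooperad K) : C.toSMod.IsAct := C.isSMod.isAct

theorem isParity (D : Cog C) : D.toGMod.IsParity (GMod.sgn D.isGraded 1) :=
  GMod.isParity_sgn D.isGraded

/-- The shuffle map `(C ∘ D) ⊗ E → C ∘ (D ⊗ E)`. -/
noncomputable abbrev shuf (D : Cog C) (E : UCocom K) :
    C.toSMod.eval D.toGMod →ₗ[K] E.toGMod.carrier →ₗ[K]
      (C.toSMod.eval (D.toGMod.tensor E.toGMod)).carrier :=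
  SMod.shuf (isAct C) D.isParity E

/-- The decomposition map of `D ⊗ E`. -/
noncomputable def tensorΔ (D : Cog C) (E : UCocom K) :
    GMod.Hom (D.toGMod.tensor E.toGMod) (C.toSMod.eval (D.toGMod.tensor E.toGMod)) where
  lin := TensorProduct.lift (D.shuf E ∘ₗ D.Δ.lin)
  map_gr _ _ ht := DGMod.tensor_gr_le (D := D.toGMod) (E := E.toGMod) _ _
    (fun _ _ _ _ hx hy h => SMod.shuf_gr (isAct C) D.isParity E (D.Δ.map_gr _ _ hx) hy h) ht

theorem tensorΔ_tmul (D : Cog C) (E : UCocom K) (x : D.toGMod) (y : E.toGMod) :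
    (D.tensorΔ E).lin (x ⊗ₜ y) = D.shuf E (D.Δ.lin x) y := rfl

theorem Δ_parity (D : Cog C) (x : D.toGMod) :
    D.Δ.lin (GMod.sgn D.isGraded 1 x) = SMod.evalParity C.isSMod D.isGraded (D.Δ.lin x) :=
  D.Δ.map_parity D.isGraded D.isParity (SMod.isParity_evalParity C.isSMod D.isGraded) x

/-- Coassociativity of `D ⊗ E` follows from that of `D` by applying the shuffle map, which is
natural in `V` with respect to `C.Δ` and in `D` with respect to `D.Δ`. -/
theorem tensorΔ_coassoc (D : Cog C) (E : UCocom K) (x : D.toGMod) (y : E.toGMod) :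
    ((SMod.evalMap C.Δ (GMod.Hom.id (D.toGMod.tensor E.toGMod))).lin
        ((D.tensorΔ E).lin (x ⊗ₜ y)),
      (SMod.evalMap (SMod.Hom.id C.toSMod) (D.tensorΔ E)).lin ((D.tensorΔ E).lin (x ⊗ₜ y))) ∈
      SMod.evalAssocGraph C.toSMod C.toSMod (D.toGMod.tensor E.toGMod) := by
  have hS := SMod.isParity_evalParity C.isSMod D.isGraded
  have h := SMod.shuf_mem_assocGraph (isAct C) (isAct C) D.isParity hS E (D.coassoc x) y
  rw [tensorΔ_tmul, SMod.shuf_natural_left (isAct C) (SMod.isAct_comp _ _) D.isParity E C.Δ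
    (GMod.Hom.id D.toGMod) rfl (GMod.Hom.id _) rfl]
  rw [SMod.evalMap_comp C.toSMod (GMod.Hom.tensor D.Δ (GMod.Hom.id E.toGMod))
    (SMod.shufHom (isAct C) D.isParity E) (D.tensorΔ E)
    (TensorProduct.ext' fun x y => rfl)]
  have h2 := SMod.shuf_natural (isAct C) D.isParity hS D.Δ D.Δ_parity (𝟙 E) (D.Δ.lin x) y
  erw [h2]
  exact h

/-- The mixed terms cancel and `E.d` squares to zero, so that the curvature of `D ⊗ E` comes from
`D`. -/
theorem tensor_d_d (D : Cog C) (E : UCocom K) (x : D.toGMod) (y : E.toGMod) :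
    GMod.tensorD D.isGraded D.d E.d (GMod.tensorD D.isGraded D.d E.d (x ⊗ₜ y)) =
      D.d (D.d x) ⊗ₜ y := by
  refine GMod.hom_induction D.isGraded (p := fun x =>
    GMod.tensorD D.isGraded D.d E.d (GMod.tensorD D.isGraded D.d E.d (x ⊗ₜ y)) =
      D.d (D.d x) ⊗ₜ y) (fun i x hx => ?_) (by simp)
    (fun x x' hx hx' => by simp only [TensorProduct.add_tmul, map_add, hx, hx']) x
  rw [GMod.tensorD_tmul _ _ _ hx, map_add, map_smul,
    GMod.tensorD_tmul _ _ _ (D.d_gr _ _ hx), GMod.tensorD_tmul _ _ _ hx,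
    show E.d (E.d y) = 0 from E.obj.X.d_d y, ksgn_sub_one]
  simp

/-- The coalgebra `D ⊗ E`. -/
noncomputable def tensor (D : Cog C) (E : UCocom K) : Cog C where
  toGMod := D.toGMod.tensor E.toGMod
  isGraded := GMod.tensor_isGraded D.isGraded E.isGraded
  Δ := D.tensorΔ E
  coassoc t := by
    induction t using TensorProduct.induction_on with
    | zero => simp only [map_zero]; exact Submodule.zero_mem _
    | tmul x y => exact D.tensorΔ_coassoc E x y
    | add s t hs ht => simp only [map_add, ← Prod.mk_add_mk]; exact Submodule.add_mem _ hs ht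
  counit t := by
    induction t using TensorProduct.induction_on with
    | zero => simp only [map_zero]; exact Submodule.zero_mem _
    | tmul x y => exact SMod.shuf_mem_rootGraph (isAct C) D.isParity E C.ε (D.counit x) y
    | add s t hs ht => simp only [map_add, ← Prod.mk_add_mk]; exact Submodule.add_mem _ hs ht
  d := GMod.tensorD D.isGraded D.d E.d
  d_gr n t ht := by
    refine DGMod.tensor_gr_le (D := D.toGMod) (E := E.toGMod) _ _ (fun i j x y hx hy h => ?_) ht
    rw [GMod.tensorD_tmul _ _ _ hx]
    exact Submodule.add_mem _ (GMod.tmul_mem (D.d_gr _ _ hx) hy (by omega))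
      (Submodule.smul_mem _ _ (GMod.tmul_mem hx (E.obj.X.d_gr _ _ hy) (by omega)))
  Δ_d t := by
    induction t using TensorProduct.induction_on with
    | zero => simp only [map_zero]; exact Submodule.zero_mem _
    | tmul x y =>
      have h := SMod.shuf_mem_coderGraph (isAct C) D.isParity D.isGraded E C.d D.d D.d_gr
        (SMod.isParity_evalParity C.isSMod D.isGraded) (D.Δ_d x) y
      rw [← D.Δ_parity] at h
      rw [show GMod.tensorD D.isGraded D.d E.d (x ⊗ₜ y) =
        D.d x ⊗ₜ y + GMod.sgn D.isGraded 1 x ⊗ₜ E.d y from rfl, map_add]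
      exact h
    | add s t hs ht => simp only [map_add, ← Prod.mk_add_mk]; exact Submodule.add_mem _ hs ht
  d_d t := by
    induction t using TensorProduct.induction_on with
    | zero => simp only [map_zero]; exact Submodule.zero_mem _
    | tmul x y =>
      rw [tensor_d_d]
      exact SMod.shuf_mem_rootGraph (isAct C) D.isParity E C.θ (D.d_d x) y
    | add s t hs ht => simp only [map_add, ← Prod.mk_add_mk]; exact Submodule.add_mem _ hs ht

@[ext]
theorem hom_ext {D D' : Cog C} {f g : D ⟶ D'} (h : f.lin = g.lin) : f = g := Hom.ext h

@[simp] theorem id_lin (D : Cog C) : (𝟙 D : D ⟶ D).lin = LinearMap.id := rfl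

@[simp] theorem comp_lin {D D' D'' : Cog C} (f : D ⟶ D') (g : D' ⟶ D'') :
    (f ≫ g).lin = g.lin ∘ₗ f.lin := rfl

/-- An isomorphism of coalgebras from a linear equivalence that is a morphism. -/
def mkIso {D D' : Cog C} (f : D ⟶ D') (e : D.toGMod ≃ₗ[K] D'.toGMod)
    (he : ∀ x, e x = f.lin x) (he' : ∀ n y, y ∈ D'.gr n → e.symm y ∈ D.gr n) : D ≅ D' where
  hom := f
  inv :=
    { lin := e.symm.toLinearMap
      map_gr := he'
      comm_d := fun y => e.injective (by
        have := f.comm_d (e.symm y)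
        rw [← he, ← he] at this
        simp [this])
      comm_Δ := fun y => by
        have h1 := f.comm_Δ (e.symm y)
        rw [← he, LinearEquiv.apply_symm_apply] at h1
        erw [h1, ← SMod.evalMap_comp C.toSMod f.toHom ⟨e.symm.toLinearMap, he'⟩
          (GMod.Hom.id D.toGMod) (by ext x; simp [← he, GMod.Hom.id])]
        exact (SMod.evalMap_id _ _ _).symm }
  hom_inv_id := by ext x; simp [← he]
  inv_hom_id := by ext x; simp [← he]

/-- The morphism `f ⊗ g`. -/
noncomputable def tensorMap {D D' : Cog C} {E E' : UCocom K} (f : D ⟶ D') (g : E ⟶ E') :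
    D.tensor E ⟶ D'.tensor E' where
  toHom := GMod.Hom.tensor f.toHom g.hom.hom.toHom
  comm_d t := by
    refine GMod.tensor_induction D.isGraded E.isGraded (p := fun t =>
      TensorProduct.map f.lin (UCocom.lin g) (GMod.tensorD D.isGraded D.d E.d t) =
        GMod.tensorD D'.isGraded D'.d E'.d (TensorProduct.map f.lin (UCocom.lin g) t))
      ?_ (by simp) (fun s t hs ht => by simp only [map_add, hs, ht]) t
    intro i j x y hx hy
    rw [GMod.tensorD_tmul _ _ _ hx, TensorProduct.map_tmul,
      GMod.tensorD_tmul _ _ _ (f.map_gr _ _ hx)]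
    simp [f.comm_d, g.hom.hom.comm]
  comm_Δ t := by
    refine LinearMap.congr_fun (f := (D'.tensorΔ E').lin ∘ₗ TensorProduct.map f.lin (UCocom.lin g))
      (g := (SMod.evalMap (SMod.Hom.id C.toSMod)
        (GMod.Hom.tensor f.toHom g.hom.hom.toHom)).lin ∘ₗ (D.tensorΔ E).lin)
      (TensorProduct.ext' fun x y => ?_) t
    refine Eq.trans ?_ (SMod.shuf_natural (isAct C) D.isParity D'.isParity f.toHom
      (f.map_parity D.isGraded D.isParity D'.isParity) g (D.Δ.lin x) y).symm
    rw [← f.comm_Δ]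
    rfl

end Cog

/-! ### Iterated coproducts of a tensor product of cocommutative coalgebras -/

theorem shufSign_cons (K : Type u) [Field K] {n : ℕ} (d₀ e₀ : ℤ) (d e : Fin n → ℤ) :
    shufSign K (Fin.cons d₀ d : Fin (n + 1) → ℤ) (Fin.cons e₀ e) =
      ksgn K ((∑ i, d i) * e₀) * shufSign K d e := by
  simp only [shufSign, Fin.prod_univ_succ, Fin.cons_zero, Fin.cons_succ, if_false,
    Fin.succ_pos, if_true, Fin.not_lt_zero, one_mul, Fin.succ_lt_succ_iff]
  rw [Finset.sum_mul, ksgn_sum]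

namespace UCocom

variable {K : Type u} [Field K]

/-- The exchange of the two factors in the middle of `E ⊗ E ⊗ F ⊗ F`. -/
noncomputable def exchange (E F : UCocom K) :
    ((E.toGMod ⊗[K] E.toGMod) ⊗[K] (F.toGMod ⊗[K] F.toGMod)) →ₗ[K]
      (E.toGMod ⊗[K] F.toGMod) ⊗[K] (E.toGMod ⊗[K] F.toGMod) :=
  (tensorμ E.obj.X E.obj.X F.obj.X F.obj.X).lin

theorem exchange_tmul (E F : UCocom K) {i j : ℤ} (x : E.toGMod) {x' : E.toGMod}
    (hx' : x' ∈ E.toGMod.gr i) {y : F.toGMod} (hy : y ∈ F.toGMod.gr j) (y' : F.toGMod) :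
    exchange E F ((x ⊗ₜ x') ⊗ₜ (y ⊗ₜ y')) = ksgn K (i * j) • ((x ⊗ₜ y) ⊗ₜ (x' ⊗ₜ y')) := by
  have h : exchange E F ((x ⊗ₜ x') ⊗ₜ (y ⊗ₜ y')) =
    (TensorProduct.assoc K E.toGMod F.toGMod (E.toGMod ⊗[K] F.toGMod)).symm
      (x ⊗ₜ TensorProduct.assoc K F.toGMod E.toGMod F.toGMod
        (GMod.swap E.isGraded F.isGraded (x' ⊗ₜ y) ⊗ₜ y')) := rfl
  rw [h, GMod.swap_tmul _ _ hx' hy, ← TensorProduct.smul_tmul', map_smul, TensorProduct.tmul_smul,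
    map_smul, TensorProduct.assoc_tmul, TensorProduct.assoc_symm_tmul]

theorem comul_tensor (E F : UCocom K) (x : E.toGMod) (y : F.toGMod) :
    (E ⊗ F).comul (x ⊗ₜ[K] y) = exchange E F (E.comul x ⊗ₜ F.comul y) := by
  have h := Comon.tensorObj_comul E.obj.X F.obj.X
  exact LinearMap.congr_fun (congrArg (fun f => f.lin) h) (x ⊗ₜ[K] y)

theorem counit_tensor (E F : UCocom K) (x : E.toGMod) (y : F.toGMod) :
    (E ⊗ F).counit (x ⊗ₜ[K] y) = E.counit x * F.counit y := by
  have h := Comon.tensorObj_counit E.obj.X F.obj.X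
  exact LinearMap.congr_fun (congrArg (fun f => f.lin) h) (x ⊗ₜ[K] y)

theorem comul_unit (r : K) : (𝟙_ (UCocom K)).comul r = r ⊗ₜ[K] (1 : K) := by
  have h : (𝟙_ (UCocom K)).comul r = (1 : K) ⊗ₜ[K] r := rfl
  have h' : (1 : K) ⊗ₜ[K] r = r ⊗ₜ[K] (1 : K) := by
    simpa using (TensorProduct.smul_tmul r (1 : K) (1 : K)).symm
  exact h.trans h'

theorem counit_unit (r : K) : (𝟙_ (UCocom K)).counit r = r := rfl

/-- The recursion for `reorder`: the element `y`, of degree `j`, passes the tensor `t`, of degree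
`p`. -/
theorem reorder_cons (E F : UCocom K) (n : ℕ) {i j : ℤ} {x : E.toGMod} (hx : x ∈ E.toGMod.gr i)
    {y : F.toGMod} (hy : y ∈ F.toGMod.gr j) {t : ⨂[K] _ : Fin n, E.toGMod.carrier} {p : ℤ}
    (ht : t ∈ powGr E.toGMod n p) (s : ⨂[K] _ : Fin n, F.toGMod.carrier) :
    GMod.reorder (GMod.sgn E.isGraded 1) F.isGraded (n + 1) (consMap E.toGMod n (x ⊗ₜ t))
        (consMap F.toGMod n (y ⊗ₜ s)) =
      ksgn K (p * j) • consMap (E.toGMod.tensor F.toGMod) n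
        ((x ⊗ₜ y) ⊗ₜ GMod.reorder (GMod.sgn E.isGraded 1) F.isGraded n t s) := by
  have hE := GMod.isParity_sgn E.isGraded
  let A : (⨂[K] _ : Fin n, E.toGMod.carrier) →ₗ[K] (⨂[K] _ : Fin n, F.toGMod.carrier) →ₗ[K]
      (⨂[K] _ : Fin (n + 1), (E.toGMod.tensor F.toGMod).carrier) :=
    (GMod.reorder (GMod.sgn E.isGraded 1) F.isGraded (n + 1)).compl₁₂
      (consMap E.toGMod n ∘ₗ TensorProduct.mk K _ _ x)
      (consMap F.toGMod n ∘ₗ TensorProduct.mk K _ _ y)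
  let B : (⨂[K] _ : Fin n, E.toGMod.carrier) →ₗ[K] (⨂[K] _ : Fin n, F.toGMod.carrier) →ₗ[K]
      (⨂[K] _ : Fin (n + 1), (E.toGMod.tensor F.toGMod).carrier) :=
    ksgn K (p * j) • (GMod.reorder (GMod.sgn E.isGraded 1) F.isGraded n).compr₂
      (consMap (E.toGMod.tensor F.toGMod) n ∘ₗ TensorProduct.mk K _ _ (x ⊗ₜ y))
  suffices h : powGr E.toGMod n p ≤ LinearMap.eqLocus A B from LinearMap.congr_fun (h ht) s
  refine Submodule.span_le.2 ?_
  rintro _ ⟨x', d, hx', rfl, rfl⟩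
  rw [SetLike.mem_coe, LinearMap.mem_eqLocus]
  refine tprod_homogeneous_ext F.isGraded fun y' e hy' => ?_
  have hxx : ∀ k, (Fin.cons x x' : Fin (n + 1) → E.toGMod) k ∈
      E.toGMod.gr ((Fin.cons i d : Fin (n + 1) → ℤ) k) :=
    Fin.cases (by simpa using hx) (by simpa using hx')
  have hyy : ∀ k, (Fin.cons y y' : Fin (n + 1) → F.toGMod) k ∈
      F.toGMod.gr ((Fin.cons j e : Fin (n + 1) → ℤ) k) :=
    Fin.cases (by simpa using hy) (by simpa using hy')
  simp only [A, B, LinearMap.compl₁₂_apply, LinearMap.comp_apply, TensorProduct.mk_apply,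
    LinearMap.smul_apply, LinearMap.compr₂_apply, consMap_tmul]
  rw [GMod.reorder_tprod hE F.isGraded hx' hy', GMod.reorder_tprod hE F.isGraded hxx hyy,
    shufSign_cons, TensorProduct.tmul_smul, map_smul, smul_smul]
  congr 1
  erw [consMap_tmul]
  congr 1
  funext k
  refine Fin.cases ?_ (fun k => ?_) k <;> simp

/-- The induction step for `iterComul_tensor`: the exchange in the coproduct of `E ⊗ F` supplies the
sign of `reorder_cons`. -/
theorem exchange_consMap (E F : UCocom K) (n : ℕ)
    (f : (E.toGMod.tensor F.toGMod).carrier →ₗ[K]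
      (⨂[K] _ : Fin n, (E.toGMod.tensor F.toGMod).carrier))
    (hf : ∀ x y, f (x ⊗ₜ[K] y) =
      GMod.reorder (GMod.sgn E.isGraded 1) F.isGraded n (E.iterComul n x) (F.iterComul n y))
    (a : E.toGMod ⊗[K] E.toGMod) (b : F.toGMod ⊗[K] F.toGMod) :
    consMap (E.toGMod.tensor F.toGMod) n (TensorProduct.map LinearMap.id f
        (exchange E F (a ⊗ₜ b))) =
      GMod.reorder (GMod.sgn E.isGraded 1) F.isGraded (n + 1)
        (consMap E.toGMod n (TensorProduct.map LinearMap.id (E.iterComul n) a))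
        (consMap F.toGMod n (TensorProduct.map LinearMap.id (F.iterComul n) b)) := by
  refine GMod.tensor_induction E.isGraded E.isGraded (p := fun a => ∀ b,
    consMap (E.toGMod.tensor F.toGMod) n (TensorProduct.map LinearMap.id f
        (exchange E F (a ⊗ₜ b))) =
      GMod.reorder (GMod.sgn E.isGraded 1) F.isGraded (n + 1)
        (consMap E.toGMod n (TensorProduct.map LinearMap.id (E.iterComul n) a))
        (consMap F.toGMod n (TensorProduct.map LinearMap.id (F.iterComul n) b)))
    (fun i i' x x' hx hx' b => ?_) (by simp)
    (fun s t hs ht b => by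
      simp only [TensorProduct.add_tmul, map_add, LinearMap.add_apply, hs, ht]) a b
  refine GMod.tensor_induction F.isGraded F.isGraded (p := fun b =>
    consMap (E.toGMod.tensor F.toGMod) n (TensorProduct.map LinearMap.id f
        (exchange E F ((x ⊗ₜ x') ⊗ₜ b))) =
      GMod.reorder (GMod.sgn E.isGraded 1) F.isGraded (n + 1)
        (consMap E.toGMod n (TensorProduct.map LinearMap.id (E.iterComul n) (x ⊗ₜ x')))
        (consMap F.toGMod n (TensorProduct.map LinearMap.id (F.iterComul n) b)))
    (fun j j' y y' hy hy' => ?_) (by simp)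
    (fun s t hs ht => by
      simp only [TensorProduct.tmul_add, map_add, hs, ht]) b
  rw [exchange_tmul E F x hx' hy y', map_smul, map_smul]
  simp only [TensorProduct.map_tmul, LinearMap.id_apply]
  rw [reorder_cons E F n hx hy (E.iterComul_gr n hx'), hf]

/-- The iterated coproducts of `E ⊗ F` are those of `E` and `F`, up to the reordering of the
factors. -/
theorem iterComul_tensor (E F : UCocom K) (n : ℕ) (x : E.toGMod) (y : F.toGMod) :
    (E ⊗ F).iterComul n (x ⊗ₜ[K] y) =
      GMod.reorder (GMod.sgn E.isGraded 1) F.isGraded n (E.iterComul n x) (F.iterComul n y) := by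
  induction n generalizing x y with
  | zero =>
    have h := GMod.reorder_tprod (GMod.isParity_sgn E.isGraded) F.isGraded (n := 0)
      (x := Fin.elim0) (d := Fin.elim0) (fun i => i.elim0) (y := Fin.elim0) (e := Fin.elim0)
      (fun i => i.elim0)
    have h' : (E ⊗ F).iterComul 0 (x ⊗ₜ[K] y) = (E ⊗ F).counit (x ⊗ₜ[K] y) •
      PiTensorProduct.tprod K (Fin.elim0 : Fin 0 → (E ⊗ F).toGMod) := rfl
    refine h'.trans ?_
    simp only [iterComul, LinearMap.smulRight_apply, map_smul, LinearMap.smul_apply, h, smul_smul]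
    simp only [shufSign, Finset.univ_eq_empty, Finset.prod_empty, mul_one]
    refine congrArg₂ _ ((counit_tensor E F x y).trans (mul_comm _ _)) ?_
    exact congrArg _ (Subsingleton.elim _ _)
  | succ n ih =>
    rw [iterComul_succ, iterComul_succ]
    refine ((E ⊗ F).iterComul_succ n _).trans ?_
    rw [comul_tensor]
    exact exchange_consMap E F n ((E ⊗ F).iterComul n) ih (E.comul x) (F.comul y)

theorem tprod_cons_one (n : ℕ) (r : K) :
    PiTensorProduct.tprod K (Fin.cons r (fun _ => 1) : Fin (n + 1) → K) =
      r • PiTensorProduct.tprod K fun _ => (1 : K) := by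
  have : (Fin.cons r (fun _ => 1) : Fin (n + 1) → K) =
      Function.update (fun _ => 1) 0 (r • 1) := by
    funext k
    refine Fin.cases ?_ (fun k => ?_) k <;> simp
  rw [this, MultilinearMap.map_update_smul, Function.update_eq_self]

theorem iterComul_unit (n : ℕ) (r : K) :
    (𝟙_ (UCocom K)).iterComul n r = r • PiTensorProduct.tprod K fun _ => (1 : K) := by
  induction n generalizing r with
  | zero =>
    refine (LinearMap.smulRight_apply _ _ _).trans ?_
    rw [counit_unit]
    congr 2
    exact Subsingleton.elim _ _
  | succ n ih =>
    refine ((𝟙_ (UCocom K)).iterComul_succ n r).trans ?_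
    rw [comul_unit]
    refine (congrArg _ (congrArg (fun t => r ⊗ₜ[K] t) (ih 1))).trans ?_
    rw [one_smul]
    refine (consMap_tmul K n r fun _ => (1 : K)).trans ?_
    exact tprod_cons_one n r

end UCocom

/-! ### The action of cocommutative coalgebras on coalgebras over a curved cooperad -/

namespace SMod

variable {K : Type u} [Field K] {V : SMod K} {D : GMod K} {s : D →ₗ[K] D}

/-- The shuffle map for `E ⊗ F` is obtained from those for `E` and for `F`. -/
theorem shuf_assoc (hV : V.IsSMod) (hD : D.IsGraded) (hs : D.IsParity s) (E F : UCocom K)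
    {s' : (D.tensor E.toGMod).carrier →ₗ[K] (D.tensor E.toGMod).carrier}
    (hs' : (D.tensor E.toGMod).IsParity s')
    (f : GMod.Hom ((D.tensor E.toGMod).tensor F.toGMod) (D.tensor (E.toGMod.tensor F.toGMod)))
    (hf : f.lin = (TensorProduct.assoc K D E.toGMod F.toGMod).toLinearMap)
    (z : V.eval D) (x : E.toGMod) (y : F.toGMod) :
    (evalMap (Hom.id V) f).lin (shuf hV.isAct hs' F (shuf hV.isAct hs E z x) y) =
      shuf hV.isAct hs (E ⊗ F) z (x ⊗ₜ[K] y) := by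
  let A : V.eval D →ₗ[K] V.eval (D.tensor (E.toGMod.tensor F.toGMod)) :=
    (evalMap (Hom.id V) f).lin ∘ₗ (shuf hV.isAct hs' F).flip y ∘ₗ (shuf hV.isAct hs E).flip x
  let B : V.eval D →ₗ[K] V.eval (D.tensor (E.toGMod.tensor F.toGMod)) :=
    (shuf hV.isAct hs (E ⊗ F)).flip (x ⊗ₜ[K] y)
  refine eval_homogeneous_induction hV.isGraded hD (LinearMap.eqLocus A B)
    (fun n c w e₀ d _ hw => ?_) z
  rw [LinearMap.mem_eqLocus]
  have hB : B (evalMk V D c w) = evalLin V (D.tensor (E.toGMod.tensor F.toGMod)) n c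
      (GMod.reorder s (GMod.tensor_isGraded E.isGraded F.isGraded) n (PiTensorProduct.tprod K w)
        (GMod.reorder (GMod.sgn E.isGraded 1) F.isGraded n (E.iterComul n x)
          (F.iterComul n y))) := by
    refine (shuf_mk hV.isAct hs (E ⊗ F) c w (x ⊗ₜ[K] y)).trans ?_
    rw [UCocom.iterComul_tensor]
    rfl
  have hA : A (evalMk V D c w) = (evalMap (Hom.id V) f).lin (shuf hV.isAct hs' F
      (shufTensor V s E c w (E.iterComul n x)) y) :=
    congrArg (fun t => (evalMap (Hom.id V) f).lin (shuf hV.isAct hs' F t y))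
      (shuf_mk hV.isAct hs E c w x)
  rw [hA, hB]
  -- By linearity in the iterated coproducts of `x` and `y`, these may be replaced with pure
  -- tensors, one after the other.
  let A' : (⨂[K] _ : Fin n, E.toGMod.carrier) →ₗ[K]
      V.eval (D.tensor (E.toGMod.tensor F.toGMod)) :=
    (evalMap (Hom.id V) f).lin ∘ₗ (shuf hV.isAct hs' F).flip y ∘ₗ shufTensor V s E c w
  let R := GMod.reorder s (GMod.tensor_isGraded E.isGraded F.isGraded) n
    (PiTensorProduct.tprod K w)
  let B' : (⨂[K] _ : Fin n, E.toGMod.carrier) →ₗ[K]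
      V.eval (D.tensor (E.toGMod.tensor F.toGMod)) :=
    evalLin V (D.tensor (E.toGMod.tensor F.toGMod)) n c ∘ₗ R ∘ₗ
      (GMod.reorder (GMod.sgn E.isGraded 1) F.isGraded n).flip (F.iterComul n y)
  suffices h : A' = B' from LinearMap.congr_fun h (E.iterComul n x)
  refine tprod_homogeneous_ext E.isGraded fun x' e hx' => ?_
  have hwx : ∀ i, w i ⊗ₜ[K] x' i ∈ (D.tensor E.toGMod).gr (d i + e i) := fun i =>
    GMod.tmul_mem (hw i) (hx' i) rfl
  simp only [A', B', LinearMap.comp_apply, LinearMap.flip_apply]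
  rw [shufTensor_tprod hs E c hw hx', map_smul, LinearMap.smul_apply, map_smul, shuf_mk]
  let A'' : (⨂[K] _ : Fin n, F.toGMod.carrier) →ₗ[K]
      V.eval (D.tensor (E.toGMod.tensor F.toGMod)) :=
    shufSign K d e • ((evalMap (Hom.id V) f).lin ∘ₗ
      shufTensor V s' F c (fun i => w i ⊗ₜ[K] x' i))
  let B'' : (⨂[K] _ : Fin n, F.toGMod.carrier) →ₗ[K]
      V.eval (D.tensor (E.toGMod.tensor F.toGMod)) :=
    evalLin V (D.tensor (E.toGMod.tensor F.toGMod)) n c ∘ₗ R ∘ₗ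
      (GMod.reorder (GMod.sgn E.isGraded 1) F.isGraded n) (PiTensorProduct.tprod K x')
  suffices h : A'' = B'' from LinearMap.congr_fun h (F.iterComul n y)
  refine tprod_homogeneous_ext F.isGraded fun y' g hy' => ?_
  have hxy : ∀ i, x' i ⊗ₜ[K] y' i ∈ (E.toGMod.tensor F.toGMod).gr (e i + g i) := fun i =>
    GMod.tmul_mem (hx' i) (hy' i) rfl
  simp only [A'', B'', R, LinearMap.comp_apply, LinearMap.smul_apply]
  rw [shufTensor_tprod hs' F c hwx hy', map_smul, evalMap_mk,
    GMod.reorder_tprod (GMod.isParity_sgn E.isGraded) F.isGraded hx' hy', map_smul,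
    GMod.reorder_tprod hs _ hw hxy, map_smul, map_smul, evalLin_tprod, smul_smul, smul_smul, hf,
    shufSign_add_left, shufSign_add_right]
  refine congrArg₂ _ (by ring) rfl

/-- The shuffle map for the unit coalgebra is the evident isomorphism. -/
theorem shuf_unit (hV : V.IsSMod) (hD : D.IsGraded) (hs : D.IsParity s)
    (f : GMod.Hom (D.tensor (GMod.unit K)) D)
    (hf : f.lin = (TensorProduct.rid K D.carrier).toLinearMap) (z : V.eval D) (r : K) :
    (evalMap (Hom.id V) f).lin (shuf hV.isAct hs (𝟙_ (UCocom K)) z r) = r • z := by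
  let A : V.eval D →ₗ[K] V.eval D :=
    (evalMap (Hom.id V) f).lin ∘ₗ (shuf hV.isAct hs (𝟙_ (UCocom K))).flip r
  refine eval_homogeneous_induction hV.isGraded hD (LinearMap.eqLocus A (r • LinearMap.id))
    (fun n c w e₀ d _ hw => ?_) z
  have hA : A (evalMk V D c w) = (evalMap (Hom.id V) f).lin (shufTensor V s (𝟙_ (UCocom K)) c w
      ((𝟙_ (UCocom K)).iterComul n r)) :=
    congrArg (evalMap (Hom.id V) f).lin (shuf_mk hV.isAct hs (𝟙_ (UCocom K)) c w r)
  rw [LinearMap.mem_eqLocus, hA, UCocom.iterComul_unit]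
  have h1 : ∀ i : Fin n, (1 : K) ∈ (GMod.unit K).gr 0 := fun _ => by simp
  have h2 := shufTensor_tprod hs (𝟙_ (UCocom K)) c hw h1
  have h3 : shufSign K d (fun _ => 0) = 1 := by simp [shufSign, ksgn_zero]
  rw [h3, one_smul] at h2
  refine (congrArg (evalMap (Hom.id V) f).lin (map_smul _ r _)).trans ?_
  refine (map_smul _ r _).trans ?_
  refine congrArg (HSMul.hSMul r) ((congrArg (evalMap (Hom.id V) f).lin h2).trans ?_)
  refine (evalMap_mk (Hom.id V) f c _).trans ?_
  rw [hf]
  refine congrArg (fun t => evalMk V D c t) (funext fun i => ?_)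
  exact one_smul K (w i)

end SMod

namespace Cog

variable {K : Type u} [Field K] {C : CurvedCooperad K}

/-- The associativity isomorphism `(D ⊗ E) ⊗ F → D ⊗ (E ⊗ F)`, as a map of graded modules. -/
noncomputable def assocGHom (D E F : GMod K) :
    GMod.Hom ((D.tensor E).tensor F) (D.tensor (E.tensor F)) where
  lin := (TensorProduct.assoc K D E F).toLinearMap
  map_gr n t ht := by
    refine DGMod.tensor_gr_le (D := D.tensor E) (E := F) _ _ (fun i j x y hx hy h => ?_) ht
    refine DGMod.tensor_gr_le (D := D) (E := E) ((TensorProduct.assoc K D E F).toLinearMap ∘ₗ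
      (TensorProduct.mk K (D ⊗[K] E) F).flip y) _ (fun i' j' x x' hx hx' h' => ?_) hx
    exact GMod.tmul_mem hx (GMod.tmul_mem hx' hy rfl) (by omega)

/-- The associativity morphism `(D ⊗ E) ⊗ F → D ⊗ (E ⊗ F)`. -/
noncomputable def assocHom (D : Cog C) (E F : UCocom K) :
    (D.tensor E).tensor F ⟶ D.tensor (E ⊗ F) where
  toHom := assocGHom D.toGMod E.toGMod F.toGMod
  comm_d t := by
    refine DGMod.tensor_induction₃ D.isGraded E.isGraded F.isGraded (p := fun t =>
      TensorProduct.assoc K D.toGMod E.toGMod F.toGMod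
        (GMod.tensorD (D := D.toGMod.tensor E.toGMod) (E := F.toGMod)
          (GMod.tensor_isGraded D.isGraded E.isGraded) (GMod.tensorD D.isGraded D.d E.d) F.d t) =
      GMod.tensorD (D := D.toGMod) (E := E.toGMod.tensor F.toGMod) D.isGraded D.d
        (GMod.tensorD E.isGraded E.d F.d)
        (TensorProduct.assoc K D.toGMod E.toGMod F.toGMod t))
      (fun i j k x y z hx hy hz => ?_) (by simp)
      (fun s t hs ht => by simp only [map_add, hs, ht]) t
    rw [GMod.tensorD_tmul (D := D.toGMod.tensor E.toGMod) _ _ _ (GMod.tmul_mem hx hy rfl),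
      GMod.tensorD_tmul _ _ _ hx, TensorProduct.assoc_tmul,
      GMod.tensorD_tmul (E := E.toGMod.tensor F.toGMod) _ _ _ hx,
        GMod.tensorD_tmul _ _ _ hy, ksgn_add]
    simp only [TensorProduct.add_tmul, TensorProduct.tmul_add, ← TensorProduct.smul_tmul',
      TensorProduct.tmul_smul, TensorProduct.assoc_tmul, map_add, map_smul, smul_smul, smul_add,
      add_assoc]
  comm_Δ t := by
    refine LinearMap.congr_fun (f := (D.tensorΔ (E ⊗ F)).lin ∘ₗ
        (TensorProduct.assoc K D.toGMod E.toGMod F.toGMod).toLinearMap)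
      (g := (SMod.evalMap (SMod.Hom.id C.toSMod) (assocGHom D.toGMod E.toGMod F.toGMod)).lin ∘ₗ
        ((D.tensor E).tensorΔ F).lin)
      (TensorProduct.ext_threefold fun x y z => ?_) t
    exact (SMod.shuf_assoc C.isSMod D.isGraded D.isParity E F (D.tensor E).isParity
      (assocGHom D.toGMod E.toGMod F.toGMod) rfl (D.Δ.lin x) y z).symm

/-- The associativity isomorphism `D ⊗ (E ⊗ F) ≅ (D ⊗ E) ⊗ F`. -/
noncomputable def assocIso (D : Cog C) (E F : UCocom K) :
    D.tensor (E ⊗ F) ≅ (D.tensor E).tensor F :=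
  (mkIso (assocHom D E F) (TensorProduct.assoc K D.toGMod E.toGMod F.toGMod) (fun _ => rfl)
    (fun n t ht => by
      refine DGMod.tensor_gr_le (D := D.toGMod) (E := E.toGMod.tensor F.toGMod)
        (TensorProduct.assoc K D.toGMod E.toGMod F.toGMod).symm.toLinearMap _
        (fun i j x y hx hy h => ?_) ht
      refine DGMod.tensor_gr_le (D := E.toGMod) (E := F.toGMod)
        ((TensorProduct.assoc K D.toGMod E.toGMod F.toGMod).symm.toLinearMap ∘ₗ
          TensorProduct.mk K D.toGMod (E.toGMod ⊗[K] F.toGMod) x) _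
        (fun i' j' y y' hy hy' h' => ?_) hy
      exact GMod.tmul_mem (GMod.tmul_mem hx hy rfl) hy' (by omega))).symm

/-- The unit isomorphism `D ⊗ K → D`, as a map of graded modules. -/
noncomputable def unitGHom (D : GMod K) : GMod.Hom (D.tensor (GMod.unit K)) D where
  lin := (TensorProduct.rid K D.carrier).toLinearMap
  map_gr n t ht := by
    refine DGMod.tensor_gr_le (D := D) (E := GMod.unit K)
      (TensorProduct.rid K D.carrier).toLinearMap _ (fun i j x a hx ha hn => ?_) ht
    by_cases hi : j = 0
    · obtain rfl : i = n := by omega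
      exact Submodule.smul_mem _ a hx
    · have : a = 0 := by simpa [hi] using ha
      subst this
      simp

/-- The unit morphism `D ⊗ K → D`. -/
noncomputable def unitHom (D : Cog C) : D.tensor (𝟙_ (UCocom K)) ⟶ D where
  toHom := unitGHom D.toGMod
  comm_d t := by
    refine LinearMap.congr_fun (f := (TensorProduct.rid K D.toGMod.carrier).toLinearMap ∘ₗ
        GMod.tensorD (E := GMod.unit K) D.isGraded D.d (0 : K →ₗ[K] K))
      (g := D.d ∘ₗ (TensorProduct.rid K D.toGMod.carrier).toLinearMap)
      (TensorProduct.ext' fun x r => ?_) t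
    simp [GMod.tensorD]
  comm_Δ t := by
    refine LinearMap.congr_fun (f := D.Δ.lin ∘ₗ
        (TensorProduct.rid K D.toGMod.carrier).toLinearMap)
      (g := (SMod.evalMap (SMod.Hom.id C.toSMod) (unitGHom D.toGMod)).lin ∘ₗ
        (D.tensorΔ (𝟙_ (UCocom K))).lin)
      (TensorProduct.ext' fun x r => ?_) t
    refine Eq.trans ?_ (SMod.shuf_unit C.isSMod D.isGraded D.isParity (unitGHom D.toGMod) rfl
      (D.Δ.lin x) r).symm
    exact D.Δ.lin.map_smul r x

/-- The unit isomorphism `D ⊗ K ≅ D`. -/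
noncomputable def unitIso (D : Cog C) : D.tensor (𝟙_ (UCocom K)) ≅ D :=
  mkIso (unitHom D) (TensorProduct.rid K D.toGMod.carrier) (fun _ => rfl)
    (fun n x hx => GMod.tmul_mem (E := GMod.unit K) (j := 0) hx (by simp) (by omega))

noncomputable instance : MonoidalRightActionStruct (UCocom K) (Cog C) where
  actionObj := tensor
  actionHomRight D _ _ g := tensorMap (𝟙 D) g
  actionHomLeft f E := tensorMap f (𝟙 E)
  actionHom f g := tensorMap f g
  actionAssocIso := assocIso
  actionUnitIso := unitIso

noncomputable instance tensorAction : MonoidalRightAction (UCocom K) (Cog C) where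
  actionHom_def _ _ := hom_ext (TensorProduct.ext' fun _ _ => rfl)
  actionHomRight_id _ _ := hom_ext (TensorProduct.ext' fun _ _ => rfl)
  id_actionHomLeft _ _ := hom_ext (TensorProduct.ext' fun _ _ => rfl)
  actionHom_comp _ _ _ _ := hom_ext (TensorProduct.ext' fun _ _ => rfl)
  actionAssocIso_hom_naturality _ _ _ := hom_ext
    (TensorProduct.ext (LinearMap.ext fun _ => TensorProduct.ext' fun _ _ => rfl))
  actionUnitIso_hom_naturality f := hom_ext (TensorProduct.ext' fun x r =>
    f.lin.map_smul r x)
  actionHomRight_whiskerRight _ _ _ := hom_ext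
    (TensorProduct.ext (LinearMap.ext fun _ => TensorProduct.ext' fun _ _ => rfl))
  whiskerRight_actionHomLeft _ _ _ _ _ := hom_ext
    (TensorProduct.ext (LinearMap.ext fun _ => TensorProduct.ext' fun _ _ => rfl))
  actionHom_associator _ _ _ _ := hom_ext
    (TensorProduct.ext (LinearMap.ext fun _ => TensorProduct.ext_threefold fun _ _ _ => rfl))
  actionHom_leftUnitor E D := hom_ext
    (TensorProduct.ext (LinearMap.ext fun x => TensorProduct.ext' fun (r : K) (y : E.toGMod) =>
      (TensorProduct.smul_tmul (M := D.toGMod.carrier) (N := E.toGMod.carrier) r x y).symm))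
  actionHom_rightUnitor E D := hom_ext
    (TensorProduct.ext (LinearMap.ext fun x => TensorProduct.ext' fun (y : E.toGMod) (r : K) =>
      TensorProduct.tmul_smul (M := D.toGMod.carrier) (N := E.toGMod.carrier) r x y))

theorem shuffle_eq_shufTensor (D : Cog C) (E : UCocom K) {n : ℕ} (c : C.obj n)
    {x : Fin n → D.toGMod} {d : Fin n → ℤ} (hx : ∀ i, x i ∈ D.gr (d i)) :
    shuffle C.toSMod D.toGMod E c x d =
      SMod.shufTensor C.toSMod (GMod.sgn D.isGraded 1) E c x := by
  refine tprod_homogeneous_ext E.isGraded fun y e hy => ?_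
  rw [SMod.shufTensor_tprod D.isParity E c hx hy, shufSign_eq_right]
  have h : shuffle C.toSMod D.toGMod E c x d (PiTensorProduct.tprod K y) =
      SMod.evalMk C.toSMod (D.toGMod.tensor E.toGMod) c fun i =>
        ksgn K ((∑ j ∈ Finset.Ioi i, d j) * e i) • (x i ⊗ₜ[K] y i) := by
    simp only [shuffle, LinearMap.comp_apply, PiTensorProduct.map_tprod, TensorProduct.mk_apply,
      GMod.sgn_apply E.isGraded _ (hy _), TensorProduct.tmul_smul]
    rfl
  rw [h, ← SMod.evalLin_tprod, MultilinearMap.map_smul_univ, map_smul, SMod.evalLin_tprod]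

theorem shuf_mem_shuffleGraph (D : Cog C) (E : UCocom K) (z : C.toSMod.eval D.toGMod)
    (y : E.toGMod) :
    (z ⊗ₜ[K] y, D.shuf E z y) ∈ shuffleGraph C.toSMod D.toGMod E := by
  refine SMod.eval_homogeneous_induction C.isSMod.isGraded D.isGraded
    ((shuffleGraph C.toSMod D.toGMod E).comap (LinearMap.prod
      ((TensorProduct.mk K (C.toSMod.eval D.toGMod) E.toGMod).flip y) ((D.shuf E).flip y)))
    (fun n c x _ d _ hx => ?_) z
  refine Submodule.subset_span ⟨n, c, x, d, y, hx, ?_⟩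
  rw [shuffle_eq_shufTensor D E c hx]
  exact Prod.ext rfl (SMod.shuf_mk (isAct C) D.isParity E c x y)

theorem isTensor_tensor (D : Cog C) (E : UCocom K) :
    IsTensor D E (D.tensor E) (LinearEquiv.refl K (D.toGMod ⊗[K] E.toGMod)) where
  map_gr _ _ := Iff.rfl
  map_d _ := rfl
  map_Δ x y := by
    have h := SMod.evalMap_id C.toSMod (D.toGMod.tensor E.toGMod) (D.shuf E (D.Δ.lin x) y)
    have h' := D.shuf_mem_shuffleGraph E (D.Δ.lin x) y
    rw [← h] at h'
    exact h'

theorem isTensorAction_tensor : IsTensorAction (C := C) tensorAction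
    (fun D E => LinearEquiv.refl K (D.toGMod ⊗[K] E.toGMod)) where
  isTensor := isTensor_tensor
  map_actionHom _ _ _ := rfl
  map_assoc D E F t := by
    refine LinearMap.congr_fun (f := (TensorProduct.assoc K D.toGMod E.toGMod F.toGMod).toLinearMap
      ∘ₗ TensorProduct.map LinearMap.id LinearMap.id ∘ₗ
        (TensorProduct.assoc K D.toGMod E.toGMod F.toGMod).symm.toLinearMap)
      (g := LinearMap.id) ?_ t
    exact TensorProduct.ext (LinearMap.ext fun _ => TensorProduct.ext' fun _ _ => rfl)
  map_unit _ _ := rfl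

end Cog

/-! ### Homogeneous components, graded submodules and retractions -/

namespace GMod

variable {K : Type u} [Field K]

instance : Category (GMod K) where
  Hom := Hom
  id := Hom.id
  comp f g := ⟨g.lin ∘ₗ f.lin, fun n x h => g.map_gr n _ (f.map_gr n x h)⟩

@[ext]
theorem hom_ext {D E : GMod K} {f g : D ⟶ E} (h : f.lin = g.lin) : f = g := Hom.ext h

@[simp] theorem comp_lin {D E F : GMod K} (f : D ⟶ E) (g : E ⟶ F) :
    Hom.lin (f ≫ g) = Hom.lin g ∘ₗ Hom.lin f := rfl

/-- The projection on the homogeneous part of degree `n`. -/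
noncomputable def proj {D : GMod K} (hD : D.IsGraded) (n : ℤ) : D →ₗ[K] D :=
  glue hD fun m => if m = n then LinearMap.id else 0

theorem proj_apply {D : GMod K} (hD : D.IsGraded) (n : ℤ) {m : ℤ} {x : D} (hx : x ∈ D.gr m) :
    proj hD n x = if m = n then x else 0 := by
  rw [proj, glue_apply hD _ hx]
  split_ifs <;> rfl

theorem proj_self {D : GMod K} (hD : D.IsGraded) {n : ℤ} {x : D} (hx : x ∈ D.gr n) :
    proj hD n x = x := by simp [proj_apply hD n hx]

theorem proj_mem {D : GMod K} (hD : D.IsGraded) (n : ℤ) (x : D) : proj hD n x ∈ D.gr n := by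
  refine hom_induction hD (p := fun x => proj hD n x ∈ D.gr n) (fun m x hx => ?_)
    (by simp) (fun x y hx hy => by rw [map_add]; exact Submodule.add_mem _ hx hy) x
  rw [proj_apply hD n hx]
  split_ifs with h
  · exact h ▸ hx
  · exact Submodule.zero_mem _

theorem Hom.map_proj {D E : GMod K} (hD : D.IsGraded) (hE : E.IsGraded) (f : Hom D E) (n : ℤ)
    (x : D) : f.lin (proj hD n x) = proj hE n (f.lin x) := by
  refine hom_induction hD (p := fun x => f.lin (proj hD n x) = proj hE n (f.lin x))
    (fun m x hx => ?_) (by simp) (fun x y hx hy => by simp only [map_add, hx, hy]) x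
  rw [proj_apply hD n hx, proj_apply hE n (f.map_gr m x hx)]
  split_ifs <;> simp

/-- An element is in any submodule that contains its homogeneous components. -/
theorem mem_of_proj_mem {D : GMod K} (hD : D.IsGraded) {S : Submodule K D} {x : D}
    (h : ∀ n, proj hD n x ∈ S) : x ∈ S := by
  have key : ∀ x : D, x ∈ Submodule.span K (Set.range fun n => proj hD n x) := by
    intro x
    classical
    have hx : x ∈ iSup D.gr := by rw [iSup_gr hD]; trivial
    obtain ⟨f, hf, rfl⟩ := (Submodule.mem_iSup_iff_exists_finsupp _ _).1 hx
    refine Submodule.sum_mem _ fun m hm => ?_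
    refine Submodule.subset_span ⟨m, ?_⟩
    simp only [Finsupp.sum, map_sum, proj_apply hD m (hf _)]
    rw [Finset.sum_ite_eq' f.support m, if_pos hm]
  exact Submodule.span_le.2 (by rintro _ ⟨n, rfl⟩; exact h n) (key x)

/-- If the images of a family of degree preserving maps span a graded module, then the images of
the homogeneous parts of degree `n` span its homogeneous part of degree `n`. -/
theorem gr_le_iSup_map {X : GMod K} (hX : X.IsGraded) {ι : Type*} {D : ι → GMod K}
    (hD : ∀ i, (D i).IsGraded) (f : ∀ i, Hom (D i) X)
    (hf : ⨆ i, LinearMap.range (f i).lin = ⊤) (n : ℤ) :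
    X.gr n ≤ ⨆ i, ((D i).gr n).map (f i).lin := by
  intro x hx
  have h : (⨆ i, LinearMap.range (f i).lin) ≤
      (⨆ i, ((D i).gr n).map (f i).lin).comap (proj hX n) := by
    refine iSup_le fun i => ?_
    rintro _ ⟨y, rfl⟩
    rw [Submodule.mem_comap, ← (f i).map_proj (hD i) hX]
    exact (le_iSup (fun i => ((D i).gr n).map (f i).lin) i)
      (Submodule.mem_map_of_mem (proj_mem (hD i) n y))
  rw [hf] at h
  have := h (Submodule.mem_top (x := x))
  rwa [Submodule.mem_comap, proj_self hX hx] at this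

/-- The inverse of a bijective degree preserving map between graded modules preserves the
degree. -/
theorem mem_gr_of_map_mem_gr {D E : GMod K} (hD : D.IsGraded) (hE : E.IsGraded) (f : Hom D E)
    (hf : Function.Injective f.lin) {n : ℤ} {x : D} (hx : f.lin x ∈ E.gr n) : x ∈ D.gr n := by
  have h : proj hD n x = x := hf (by rw [f.map_proj hD hE, proj_self hE hx])
  exact h ▸ proj_mem hD n x

/-- A submodule, with the homogeneous elements of the ambient module. -/
abbrev sub (D : GMod K) (N : Submodule K D) : GMod K where
  carrier := N
  gr n := (D.gr n).comap N.subtype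

/-- The inclusion of a submodule. -/
def incl (D : GMod K) (N : Submodule K D) : Hom (D.sub N) D where
  lin := N.subtype
  map_gr _ _ hx := hx

theorem sub_isGraded {D : GMod K} (hD : D.IsGraded) {N : Submodule K D}
    (hN : ∀ n, ∀ x ∈ N, proj hD n x ∈ N) : (D.sub N).IsGraded := by
  refine isGraded_of_proj ?_ (fun n => (proj hD n).restrict (hN n)) ?_ ?_
  · rw [eq_top_iff]
    rintro x -
    have h : (x : D) ∈ (iSup (D.sub N).gr).map N.subtype := by
      refine mem_of_proj_mem hD fun n => ?_
      refine ⟨⟨proj hD n x, hN n x x.2⟩, ?_, rfl⟩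
      exact (le_iSup (D.sub N).gr n) (proj_mem hD n (x : D))
    obtain ⟨y, hy, hxy⟩ := h
    rwa [← N.injective_subtype hxy]
  · intro n x hx
    exact Subtype.ext (proj_self hD hx)
  · intro m n x hmn hx
    refine Subtype.ext ?_
    rw [LinearMap.restrict_apply]
    exact (proj_apply hD m hx).trans (if_neg hmn.symm)

/-- Over a field, a graded submodule is a direct factor in the category of graded modules. -/
theorem exists_retraction {D : GMod K} (hD : D.IsGraded) {N : Submodule K D}
    (hN : (D.sub N).IsGraded) : ∃ r : Hom D (D.sub N), ∀ x : N, r.lin x = x := by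
  obtain ⟨r₀, hr₀⟩ := N.subtype.exists_leftInverse_of_injective (Submodule.ker_subtype N)
  have hr₀' : ∀ x : N, r₀ x = x := fun x => LinearMap.congr_fun hr₀ x
  -- The homogeneous part of degree zero of any linear retraction is a retraction.
  refine ⟨⟨glue hD fun n => proj hN n ∘ₗ r₀, fun n x hx => ?_⟩, fun x => ?_⟩
  · rw [glue_apply hD _ hx]
    exact proj_mem hN n _
  · refine hom_induction hN (p := fun x : N => glue hD (fun n => proj hN n ∘ₗ r₀) (x : D) = x)
      (fun n x hx => ?_) (by simp)
      (fun x y hx hy => by simp only [Submodule.coe_add, map_add, hx, hy]) x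
    rw [glue_apply hD _ (x := (x : D)) hx, LinearMap.comp_apply, hr₀']
    exact proj_self hN hx

end GMod

/-! ### Categories of graded modules with a linear structure map -/

namespace GMod

variable {K : Type u} [Field K]

/-- The underlying module of a graded module. -/
abbrev forgetGrading (K : Type u) [Field K] : GMod K ⥤ ModuleCat.{u} K where
  obj D := ModuleCat.of K D
  map f := ModuleCat.ofHom f.lin

end GMod

/-- A functor `U` from a category `A` to graded modules, together with natural linear maps
`U X → T (U X)`, for an endofunctor `T`, which exhibits `A` as a full subcategory of the category of
graded modules `D` with a linear map `D → T D`. This subcategory has to be stable under isomorphisms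
and under quotients of sums, and any element of an object has to be contained in a subobject that is
spanned by a countable set. -/
structure CoalgebraicFunctor {K : Type u} [Field K] {A : Type (u + 1)} [Category.{u} A]
    (U : A ⥤ GMod K) (T : GMod K ⥤ ModuleCat.{u} K) where
  isGraded : ∀ X, (U.obj X).IsGraded
  faithful : U.Faithful
  /-- the structure map -/
  str : ∀ X, U.obj X →ₗ[K] T.obj (U.obj X)
  str_natural : ∀ {X Y : A} (f : X ⟶ Y), str Y ∘ₗ (U.map f).lin = (T.map (U.map f)).hom ∘ₗ str X
  full : ∀ {X Y : A} (f : U.obj X ⟶ U.obj Y), str Y ∘ₗ f.lin = (T.map f).hom ∘ₗ str X →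
    ∃ g : X ⟶ Y, U.map g = f
  exists_quotient : ∀ (D : GMod K), D.IsGraded → ∀ (s : D →ₗ[K] T.obj D) {ι : Type u} (X : ι → A)
    (f : ∀ i, U.obj (X i) ⟶ D), (∀ i, s ∘ₗ (f i).lin = (T.map (f i)).hom ∘ₗ str (X i)) →
    ⨆ i, LinearMap.range (f i).lin = ⊤ →
    ∃ (Y : A) (e : U.obj Y ≅ D), s ∘ₗ e.hom.lin = (T.map e.hom).hom ∘ₗ str Y
  exists_sub : ∀ X : A, ∃ w : U.obj X → Set (U.obj X), (∀ x, (w x).Countable) ∧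
    ∀ S : Set (U.obj X), (∀ x ∈ S, w x ⊆ S) → ∃ (Y : A) (g : Y ⟶ X),
      Function.Injective (U.map g).lin ∧ LinearMap.range (U.map g).lin = Submodule.span K S

namespace CoalgebraicFunctor

variable {K : Type u} [Field K] {A : Type (u + 1)} [Category.{u} A] {U : A ⥤ GMod K}
  {T : GMod K ⥤ ModuleCat.{u} K}

/-- The underlying module of an object. -/
abbrev toModule (U : A ⥤ GMod K) : A ⥤ ModuleCat.{u} K := U ⋙ GMod.forgetGrading K

theorem ext (h : CoalgebraicFunctor U T) {X Y : A} {f g : X ⟶ Y}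
    (hfg : (U.map f).lin = (U.map g).lin) : f = g :=
  h.faithful.map_injective (GMod.hom_ext hfg)

/-- A bijective morphism is invertible. -/
theorem isIso_of_bijective (h : CoalgebraicFunctor U T) {X Y : A} (f : X ⟶ Y)
    (hf : Function.Bijective (U.map f).lin) : IsIso f := by
  let e := LinearEquiv.ofBijective (U.map f).lin hf
  let g : U.obj Y ⟶ U.obj X := ⟨e.symm.toLinearMap, fun n y hy =>
    GMod.mem_gr_of_map_mem_gr (h.isGraded X) (h.isGraded Y) (U.map f) hf.1 (by
      have : (U.map f).lin (e.symm y) = y := e.apply_symm_apply y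
      exact this.symm ▸ hy)⟩
  have hfg : U.map f ≫ g = 𝟙 _ := GMod.hom_ext (LinearMap.ext fun x => e.symm_apply_apply x)
  have hgf : g ≫ U.map f = 𝟙 _ := GMod.hom_ext (LinearMap.ext fun x => e.apply_symm_apply x)
  obtain ⟨g', hg'⟩ := h.full g (by
    have h1 : (T.map g).hom ∘ₗ (T.map (U.map f)).hom = LinearMap.id := by
      rw [← ModuleCat.hom_comp, ← T.map_comp, hfg, T.map_id]; rfl
    have h2 : (U.map f).lin ∘ₗ g.lin = LinearMap.id := congrArg (fun f => f.lin) hgf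
    calc h.str X ∘ₗ g.lin
        = ((T.map g).hom ∘ₗ (T.map (U.map f)).hom) ∘ₗ h.str X ∘ₗ g.lin := by rw [h1]; rfl
      _ = (T.map g).hom ∘ₗ ((T.map (U.map f)).hom ∘ₗ h.str X) ∘ₗ g.lin := rfl
      _ = (T.map g).hom ∘ₗ h.str Y ∘ₗ ((U.map f).lin ∘ₗ g.lin) := by
        rw [← h.str_natural]; rfl
      _ = _ := by rw [h2]; rfl)
  refine ⟨g', h.faithful.map_injective ?_, h.faithful.map_injective ?_⟩
  · rw [U.map_comp, hg', hfg, U.map_id]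
  · rw [U.map_comp, hg', hgf, U.map_id]

theorem reflectsIsomorphisms (h : CoalgebraicFunctor U T) :
    (toModule U).ReflectsIsomorphisms where
  reflects f hf := h.isIso_of_bijective f
    ((ConcreteCategory.isIso_iff_bijective ((toModule U).map f)).1 hf)

section Colimits

open Limits

variable {J : Type u} [Category.{u} J] {F : J ⥤ A}

/-- The leg of a cocone, as a linear map. -/
def leg (c : Cocone (F ⋙ toModule U)) (j : J) : U.obj (F.obj j) →ₗ[K] c.pt := (c.ι.app j).hom

theorem leg_comp (c : Cocone (F ⋙ toModule U)) {i j : J} (f : i ⟶ j) :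
    leg c j ∘ₗ (U.map (F.map f)).lin = leg c i :=
  congrArg ModuleCat.Hom.hom (c.w f)

/-- A linear map out of a colimit. -/
noncomputable def colimitDesc {c : Cocone (F ⋙ toModule U)} (hc : IsColimit c) {M : Type u}
    [AddCommGroup M] [Module K M] (f : ∀ j, U.obj (F.obj j) →ₗ[K] M)
    (hf : ∀ {i j : J} (a : i ⟶ j), f j ∘ₗ (U.map (F.map a)).lin = f i) : c.pt →ₗ[K] M :=
  (hc.desc
    { pt := ModuleCat.of K M
      ι :=
        { app := fun j => ModuleCat.ofHom (f j)
          naturality := fun _ _ a => ModuleCat.hom_ext (hf a) } }).hom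

theorem colimitDesc_leg {c : Cocone (F ⋙ toModule U)} (hc : IsColimit c) {M : Type u}
    [AddCommGroup M] [Module K M] (f : ∀ j, U.obj (F.obj j) →ₗ[K] M)
    (hf : ∀ {i j : J} (a : i ⟶ j), f j ∘ₗ (U.map (F.map a)).lin = f i) (j : J) :
    colimitDesc hc f hf ∘ₗ leg c j = f j :=
  congrArg ModuleCat.Hom.hom (hc.fac
    { pt := ModuleCat.of K M
      ι :=
        { app := fun j => ModuleCat.ofHom (f j)
          naturality := fun _ _ a => ModuleCat.hom_ext (hf a) } } j)

theorem colimit_hom_ext {c : Cocone (F ⋙ toModule U)} (hc : IsColimit c) {M : Type u}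
    [AddCommGroup M] [Module K M] {f g : c.pt →ₗ[K] M}
    (h : ∀ j, f ∘ₗ leg c j = g ∘ₗ leg c j) : f = g := by
  have : ModuleCat.ofHom f = ModuleCat.ofHom g := hc.hom_ext fun j => ModuleCat.hom_ext (h j)
  exact congrArg ModuleCat.Hom.hom this

/-- The grading of a colimit. -/
abbrev colimitGMod (c : Cocone (F ⋙ toModule U)) : GMod K where
  carrier := c.pt
  gr n := ⨆ j, ((U.obj (F.obj j)).gr n).map (leg c j)

theorem iSup_range_eq_top {c : Cocone (F ⋙ toModule U)} (hc : IsColimit c) :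
    ⨆ j, LinearMap.range (leg c j) = ⊤ := by
  set N := ⨆ j, LinearMap.range (leg c j) with hN
  have h : N.mkQ = 0 := colimit_hom_ext hc fun j => LinearMap.ext fun x => by
    refine (Submodule.Quotient.mk_eq_zero N).2 ?_
    rw [hN]
    exact (le_iSup (fun j => LinearMap.range (leg c j)) j) ⟨x, rfl⟩
  rw [← Submodule.ker_mkQ N, h, LinearMap.ker_zero]

/-- The leg of a colimit cocone, as a map of graded modules. -/
abbrev colimitι (c : Cocone (F ⋙ toModule U)) (j : J) : U.obj (F.obj j) ⟶ colimitGMod c :=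
  ⟨leg c j, fun n _ hx => (le_iSup (fun j => ((U.obj (F.obj j)).gr n).map (leg c j)) j)
    (Submodule.mem_map_of_mem hx)⟩

theorem map_colimitι (c : Cocone (F ⋙ toModule U)) {i j : J} (f : i ⟶ j) :
    U.map (F.map f) ≫ colimitι c j = colimitι c i :=
  GMod.hom_ext (leg_comp c f)

theorem colimitGMod_isGraded (h : CoalgebraicFunctor U T) {c : Cocone (F ⋙ toModule U)}
    (hc : IsColimit c) : (colimitGMod c).IsGraded := by
  -- The projections to the homogeneous parts pass to the colimit.
  let P : ℤ → (c.pt →ₗ[K] c.pt) := fun n =>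
    colimitDesc hc (fun j => leg c j ∘ₗ GMod.proj (h.isGraded (F.obj j)) n) (by
      intro i j a
      refine LinearMap.ext fun x => ?_
      simp only [LinearMap.comp_apply]
      rw [← (U.map (F.map a)).map_proj (h.isGraded _) (h.isGraded _)]
      exact LinearMap.congr_fun (leg_comp c a) _)
  have hP : ∀ n j, ∀ x : U.obj (F.obj j), P n (leg c j x) =
      leg c j (GMod.proj (h.isGraded (F.obj j)) n x) := fun n j x =>
    LinearMap.congr_fun (colimitDesc_leg hc _ _ j) x
  refine GMod.isGraded_of_proj ?_ P ?_ ?_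
  · rw [eq_top_iff, ← iSup_range_eq_top hc]
    refine iSup_le fun j => ?_
    rintro _ ⟨x, rfl⟩
    refine GMod.hom_induction (h.isGraded (F.obj j))
      (p := fun x => leg c j x ∈ iSup (colimitGMod c).gr) (fun n x hx => ?_)
      (by rw [map_zero]; exact Submodule.zero_mem _)
      (fun x y hx hy => by rw [map_add]; exact Submodule.add_mem _ hx hy) x
    exact (le_iSup (colimitGMod c).gr n) ((colimitι c j).map_gr n x hx)
  · intro n x hx
    have : (colimitGMod c).gr n ≤ LinearMap.eqLocus (P n) LinearMap.id := by
      refine iSup_le fun j => ?_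
      rintro _ ⟨y, hy, rfl⟩
      rw [LinearMap.mem_eqLocus, hP, GMod.proj_self _ hy]
      rfl
    exact this hx
  · intro m n x hmn hx
    have : (colimitGMod c).gr n ≤ LinearMap.ker (P m) := by
      refine iSup_le fun j => ?_
      rintro _ ⟨y, hy, rfl⟩
      rw [LinearMap.mem_ker, hP, GMod.proj_apply _ m hy, if_neg hmn.symm, map_zero]
    exact this hx

theorem map_colimitι_str (h : CoalgebraicFunctor U T) (c : Cocone (F ⋙ toModule U)) {i j : J}
    (a : i ⟶ j) : ((T.map (colimitι c j)).hom ∘ₗ h.str (F.obj j)) ∘ₗ (U.map (F.map a)).lin =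
      (T.map (colimitι c i)).hom ∘ₗ h.str (F.obj i) := by
  rw [LinearMap.comp_assoc, h.str_natural, ← LinearMap.comp_assoc, ← ModuleCat.hom_comp,
    ← T.map_comp, map_colimitι]

/-- The structure map of a colimit. -/
noncomputable def colimitStr (h : CoalgebraicFunctor U T) {c : Cocone (F ⋙ toModule U)}
    (hc : IsColimit c) : c.pt →ₗ[K] T.obj (colimitGMod c) :=
  colimitDesc hc (fun j => (T.map (colimitι c j)).hom ∘ₗ h.str (F.obj j)) (h.map_colimitι_str c)

theorem colimitStr_comp (h : CoalgebraicFunctor U T) {c : Cocone (F ⋙ toModule U)}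
    (hc : IsColimit c) (j : J) : h.colimitStr hc ∘ₗ (colimitι c j).lin =
      (T.map (colimitι c j)).hom ∘ₗ h.str (F.obj j) :=
  colimitDesc_leg hc _ (h.map_colimitι_str c) j

/-- Structure maps that are compatible with the composite of two maps, of which the first one is an
isomorphism compatible with them, are compatible with the second one. -/
theorem str_comp_inv (h : CoalgebraicFunctor U T) {X Y : A} {D : GMod K} {s : D →ₗ[K] T.obj D}
    {e : U.obj Y ≅ D} (he : s ∘ₗ e.hom.lin = (T.map e.hom).hom ∘ₗ h.str Y) {f : U.obj X ⟶ D}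
    (hf : s ∘ₗ f.lin = (T.map f).hom ∘ₗ h.str X) :
    h.str Y ∘ₗ (f ≫ e.inv).lin = (T.map (f ≫ e.inv)).hom ∘ₗ h.str X := by
  have h1 : (T.map e.inv).hom ∘ₗ (T.map e.hom).hom = LinearMap.id := by
    rw [← ModuleCat.hom_comp, ← T.map_comp, e.hom_inv_id, T.map_id]; rfl
  have h2 : e.hom.lin ∘ₗ e.inv.lin = LinearMap.id := congrArg (fun f => f.lin) e.inv_hom_id
  have h3 : h.str Y ∘ₗ e.inv.lin = (T.map e.inv).hom ∘ₗ s := by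
    calc h.str Y ∘ₗ e.inv.lin
        = ((T.map e.inv).hom ∘ₗ (T.map e.hom).hom) ∘ₗ h.str Y ∘ₗ e.inv.lin := by rw [h1]; rfl
      _ = (T.map e.inv).hom ∘ₗ ((T.map e.hom).hom ∘ₗ h.str Y) ∘ₗ e.inv.lin := rfl
      _ = (T.map e.inv).hom ∘ₗ s ∘ₗ (e.hom.lin ∘ₗ e.inv.lin) := by rw [← he]; rfl
      _ = _ := by rw [h2]; rfl
  rw [GMod.comp_lin, ← LinearMap.comp_assoc, h3, LinearMap.comp_assoc, hf, T.map_comp]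
  rfl

/-- A colimit of the underlying modules, with the structure map induced by those of the objects, is
a quotient of their sum, hence an object; it is a colimit of the objects. -/
noncomputable def liftsToColimit (h : CoalgebraicFunctor U T) (c : Cocone (F ⋙ toModule U))
    (hc : IsColimit c) : LiftsToColimit F (toModule U) c hc := by
  let hY := h.exists_quotient (colimitGMod c) (h.colimitGMod_isGraded hc) (h.colimitStr hc)
    F.obj (colimitι c) (h.colimitStr_comp hc) (iSup_range_eq_top hc)
  let Y := hY.choose
  let e := hY.choose_spec.choose
  have he := hY.choose_spec.choose_spec
  let ι : ∀ j, F.obj j ⟶ Y := fun j =>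
    (h.full (colimitι c j ≫ e.inv) (h.str_comp_inv he (h.colimitStr_comp hc j))).choose
  have hι : ∀ j, U.map (ι j) = colimitι c j ≫ e.inv := fun j =>
    (h.full (colimitι c j ≫ e.inv) (h.str_comp_inv he (h.colimitStr_comp hc j))).choose_spec
  let c' : Cocone F :=
    { pt := Y
      ι := { app := ι
             naturality := fun i j a => (h.faithful.map_injective (by
              rw [U.map_comp, hι, hι, ← Category.assoc, map_colimitι]) :
                F.map a ≫ ι j = ι i).trans (Category.comp_id _).symm } }
  have hdesc : ∀ t : Cocone F, ∃ g : Y ⟶ t.pt, ∀ j, ι j ≫ g = t.ι.app j := by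
    intro t
    let φ : ∀ j, U.obj (F.obj j) →ₗ[K] U.obj t.pt := fun j => (U.map (t.ι.app j)).lin
    have ht : ∀ {i j : J} (a : i ⟶ j), φ j ∘ₗ (U.map (F.map a)).lin = φ i :=
      fun {i j} a => by
        simp only [φ]
        rw [← t.w a, U.map_comp]; rfl
    let g : colimitGMod c ⟶ U.obj t.pt :=
      ⟨colimitDesc hc φ ht, fun n x hx => by
        have hle : (colimitGMod c).gr n ≤ ((U.obj t.pt).gr n).comap
            (colimitDesc hc φ ht) := by
          refine iSup_le fun j => ?_
          rintro _ ⟨y, hy, rfl⟩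
          rw [Submodule.mem_comap]
          have h1 := LinearMap.congr_fun
            (colimitDesc_leg hc φ ht j) y
          rw [LinearMap.comp_apply] at h1
          rw [h1]
          exact (U.map (t.ι.app j)).map_gr n y hy
        exact hle hx⟩
    have hg : ∀ j, colimitι c j ≫ g = U.map (t.ι.app j) := fun j =>
      GMod.hom_ext (colimitDesc_leg hc φ ht j)
    have hgs : h.str t.pt ∘ₗ g.lin = (T.map g).hom ∘ₗ h.colimitStr hc := by
      refine colimit_hom_ext hc fun j => ?_
      have h1 : g.lin ∘ₗ leg c j = (U.map (t.ι.app j)).lin :=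
        congrArg (fun f => f.lin) (hg j)
      rw [LinearMap.comp_assoc, h1, h.str_natural, ← hg j, LinearMap.comp_assoc, T.map_comp]
      exact congrArg (fun f => (T.map g).hom ∘ₗ f) (h.colimitStr_comp hc j).symm
    obtain ⟨g', hg'⟩ := h.full (e.hom ≫ g) (by
      rw [GMod.comp_lin, ← LinearMap.comp_assoc, hgs, LinearMap.comp_assoc, he, T.map_comp]
      rfl)
    refine ⟨g', fun j => h.faithful.map_injective ?_⟩
    rw [U.map_comp, hι, hg', Category.assoc, Iso.inv_hom_id_assoc, hg]
  let desc : ∀ t : Cocone F, Y ⟶ t.pt := fun t => (hdesc t).choose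
  have hfac : ∀ (t : Cocone F) j, ι j ≫ desc t = t.ι.app j := fun t => (hdesc t).choose_spec
  exact
    { liftedCocone := c'
      validLift := Cocone.ext ((GMod.forgetGrading K).mapIso e) (fun j => by
        have h1 : U.map (ι j) ≫ e.hom = colimitι c j := by
          rw [hι, Category.assoc, e.inv_hom_id, Category.comp_id]
        exact congrArg (GMod.forgetGrading K).map h1)
      makesColimit :=
        { desc := desc
          fac := hfac
          uniq := fun t m hm => h.ext (by
            have h1 : (e.inv ≫ U.map m).lin = (e.inv ≫ U.map (desc t)).lin := by
              refine colimit_hom_ext hc fun j => ?_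
              have h2 : (colimitι c j ≫ e.inv) ≫ U.map m =
                  (colimitι c j ≫ e.inv) ≫ U.map (desc t) := by
                rw [← hι, ← U.map_comp, ← U.map_comp, hfac]
                exact congrArg U.map (hm j)
              exact congrArg (fun f => f.lin) h2
            have h3 : U.map m = U.map (desc t) :=
              (cancel_epi e.inv).1 (GMod.hom_ext h1)
            rw [h3]) } }

/-- The underlying module functor creates colimits. -/
@[reducible]
noncomputable def createsColimits (h : CoalgebraicFunctor U T) : CreatesColimits (toModule U) where
  CreatesColimitsOfShape {J _} := by
    have := h.reflectsIsomorphisms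
    exact { CreatesColimit := fun {F} =>
      createsColimitOfReflectsIso fun c hc => h.liftsToColimit c hc }

end Colimits

end CoalgebraicFunctor

/-! ### Epimorphisms, generators and adjoints -/

namespace CoalgebraicFunctor

open Limits

variable {K : Type u} [Field K] {A : Type (u + 1)} [Category.{u} A] {U : A ⥤ GMod K}
  {T : GMod K ⥤ ModuleCat.{u} K}

theorem hasColimits (h : CoalgebraicFunctor U T) : HasColimits A :=
  have := h.createsColimits
  hasColimits_of_hasColimits_createsColimits (toModule U)

theorem preservesColimits (h : CoalgebraicFunctor U T) : PreservesColimits (toModule U) :=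
  have := h.createsColimits
  inferInstance

theorem reflectsColimits (h : CoalgebraicFunctor U T) : ReflectsColimits (toModule U) :=
  have := h.createsColimits
  inferInstance

/-- As the underlying module functor preserves colimits, it preserves epimorphisms. -/
theorem surjective_of_epi (h : CoalgebraicFunctor U T) {X Y : A} (f : X ⟶ Y) [Epi f] :
    Function.Surjective (U.map f).lin := by
  have := h.preservesColimits
  exact (ModuleCat.epi_iff_surjective ((toModule U).map f)).1 inferInstance

/-- A morphism factors through an epimorphism as soon as it vanishes on its kernel. -/
theorem exists_factorization (h : CoalgebraicFunctor U T) {X Y Z : A} (f : X ⟶ Y) [Epi f]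
    (g : X ⟶ Z) (hfg : LinearMap.ker (U.map f).lin ≤ LinearMap.ker (U.map g).lin) :
    ∃ k : Y ⟶ Z, f ≫ k = g := by
  have hf := h.surjective_of_epi f
  let e := (U.map f).lin.quotKerEquivOfSurjective hf
  let k : U.obj Y →ₗ[K] U.obj Z :=
    (LinearMap.ker (U.map f).lin).liftQ (U.map g).lin hfg ∘ₗ e.symm.toLinearMap
  have hk : ∀ x, k ((U.map f).lin x) = (U.map g).lin x := by
    intro x
    have h1 : e.symm ((U.map f).lin x) = Submodule.Quotient.mk x := by
      rw [LinearEquiv.symm_apply_eq]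
      rfl
    simp only [k, LinearMap.comp_apply, LinearEquiv.coe_coe, h1]
    exact Submodule.liftQ_apply _ _ x
  let k' : U.obj Y ⟶ U.obj Z := ⟨k, fun n y hy => by
    obtain ⟨x, rfl⟩ := hf y
    have h1 := (U.map f).map_proj (h.isGraded X) (h.isGraded Y) n x
    rw [GMod.proj_self (h.isGraded Y) hy] at h1
    rw [← h1, hk]
    exact (U.map g).map_gr n _ (GMod.proj_mem _ n x)⟩
  have hk' : U.map f ≫ k' = U.map g := GMod.hom_ext (LinearMap.ext hk)
  obtain ⟨l, hl⟩ := h.full k' (by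
    refine LinearMap.ext fun y => ?_
    obtain ⟨x, rfl⟩ := hf y
    have h1 := LinearMap.congr_fun (h.str_natural f) x
    have h2 := LinearMap.congr_fun (h.str_natural g) x
    simp only [LinearMap.comp_apply] at h1 h2 ⊢
    rw [h1, ← LinearMap.comp_apply (T.map k').hom, ← ModuleCat.hom_comp, ← T.map_comp, hk', ← h2]
    exact congrArg (h.str Z) (hk x))
  exact ⟨l, h.faithful.map_injective (by rw [U.map_comp, hl, hk'])⟩

/-- The category is well-copowered: quotients are determined by the kernels of the underlying maps.
-/
theorem wellPowered_op (h : CoalgebraicFunctor U T) : WellPowered.{u} Aᵒᵖ where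
  subobject_small X := by
    let k : Subobject X → Submodule K (U.obj X.unop) := fun P =>
      LinearMap.ker (U.map P.arrow.unop).lin
    have hle : ∀ P Q : Subobject X, k Q ≤ k P → P ≤ Q := fun P Q hPQ => by
      obtain ⟨l, hl⟩ := h.exists_factorization Q.arrow.unop P.arrow.unop hPQ
      exact Subobject.le_of_comm l.op (Quiver.Hom.unop_inj hl)
    exact small_of_injective (f := k) fun P Q hPQ => le_antisymm (hle P Q hPQ.ge) (hle Q P hPQ.le)

/-- A grading and a structure map on a quotient of the vector space with a countable basis. Such
data form a type in `Type u`, which makes the family `generators` small. -/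
structure CountableStructure (T : GMod K ⥤ ModuleCat.{u} K) where
  ker : Submodule K (ℕ →₀ K)
  gr : ℤ → Submodule K ((ℕ →₀ K) ⧸ ker)
  str : ((ℕ →₀ K) ⧸ ker) →ₗ[K] T.obj { carrier := (ℕ →₀ K) ⧸ ker, gr := gr }

/-- The underlying graded module. -/
noncomputable abbrev CountableStructure.toGMod (i : CountableStructure T) : GMod K where
  carrier := (ℕ →₀ K) ⧸ i.ker
  gr := i.gr

/-- An identification of the structure of an object with a given one. -/
def CountableStructure.IsModel (h : CoalgebraicFunctor U T) (i : CountableStructure T)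
    (X : A) : Prop :=
  ∃ e : U.obj X ≅ i.toGMod, i.str ∘ₗ e.hom.lin = (T.map e.hom).hom ∘ₗ h.str X

/-- The objects chosen as representatives of those that are spanned by a countable set. -/
def generators (h : CoalgebraicFunctor U T) : ObjectProperty A :=
  ObjectProperty.ofObj fun i : {i : CountableStructure T // ∃ X, i.IsModel h X} => i.2.choose

instance (h : CoalgebraicFunctor U T) : ObjectProperty.Small.{u} h.generators := by
  unfold generators
  infer_instance

theorem exists_isModel (h : CoalgebraicFunctor U T) (X : A) {S : Set (U.obj X)}
    (hS : S.Countable) (hS' : Submodule.span K S = ⊤) :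
    ∃ i : CountableStructure T, i.IsModel h X := by
  obtain ⟨f, hf⟩ : ∃ f : ℕ → U.obj X, S ⊆ Set.range f := by
    obtain rfl | hne := S.eq_empty_or_nonempty
    · exact ⟨fun _ => 0, Set.empty_subset _⟩
    · obtain ⟨f, hf⟩ := hS.exists_eq_range hne
      exact ⟨f, hf.le⟩
  let π : (ℕ →₀ K) →ₗ[K] U.obj X := Finsupp.linearCombination K f
  have hπ : Function.Surjective π := by
    rw [← LinearMap.range_eq_top, Finsupp.range_linearCombination, eq_top_iff, ← hS']
    exact Submodule.span_mono hf
  let e := π.quotKerEquivOfSurjective hπ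
  let Q : GMod K :=
    { carrier := (ℕ →₀ K) ⧸ LinearMap.ker π
      gr := fun n => ((U.obj X).gr n).comap e.toLinearMap }
  let e' : U.obj X ≅ Q :=
    { hom := ⟨e.symm.toLinearMap, fun n x hx => by
        change e (e.symm x) ∈ (U.obj X).gr n
        rwa [e.apply_symm_apply]⟩
      inv := ⟨e.toLinearMap, fun n x hx => hx⟩
      hom_inv_id := GMod.hom_ext (LinearMap.ext fun x => e.apply_symm_apply x)
      inv_hom_id := GMod.hom_ext (LinearMap.ext fun x => e.symm_apply_apply x) }
  refine ⟨⟨LinearMap.ker π, Q.gr, (T.map e'.hom).hom ∘ₗ h.str X ∘ₗ e.toLinearMap⟩, e', ?_⟩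
  refine LinearMap.ext fun x => ?_
  exact congrArg (fun x => (T.map e'.hom).hom (h.str X x)) (e.apply_symm_apply x)

/-- Two objects with identified structures are isomorphic. -/
theorem CountableStructure.IsModel.exists_bijective {h : CoalgebraicFunctor U T}
    {i : CountableStructure T} {X Y : A} (hX : i.IsModel h X) (hY : i.IsModel h Y) :
    ∃ f : X ⟶ Y, Function.Bijective (U.map f).lin := by
  obtain ⟨e, he⟩ := hX
  obtain ⟨e', he'⟩ := hY
  obtain ⟨f, hf⟩ := h.full (e.hom ≫ e'.inv) (h.str_comp_inv he' he)
  refine ⟨f, ?_⟩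
  have : IsIso (U.map f) := by rw [hf]; infer_instance
  have : IsIso ((GMod.forgetGrading K).map (U.map f)) := Functor.map_isIso _ _
  exact (ConcreteCategory.isIso_iff_bijective ((GMod.forgetGrading K).map (U.map f))).1 this

/-- Any set is contained in a set that is stable under a given operation, and which is countable if
the given set and the values of the operation are. -/
theorem exists_countable_closed {M : Type*} (w : M → Set M) (hw : ∀ x, (w x).Countable) (x : M) :
    ∃ S : Set M, S.Countable ∧ x ∈ S ∧ ∀ y ∈ S, w y ⊆ S := by
  let F : ℕ → Set M := fun n => Nat.rec {x} (fun _ S => ⋃ y ∈ S, w y) n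
  have hF : ∀ n, (F n).Countable := by
    intro n
    induction n with
    | zero => exact Set.countable_singleton x
    | succ n ih => exact ih.biUnion fun y _ => hw y
  refine ⟨⋃ n, F n, Set.countable_iUnion hF, Set.mem_iUnion.2 ⟨0, rfl⟩, fun y hy z hz => ?_⟩
  obtain ⟨n, hn⟩ := Set.mem_iUnion.1 hy
  exact Set.mem_iUnion.2 ⟨n + 1, Set.mem_biUnion hn hz⟩

/-- Every element is contained in the image of a generator. -/
theorem isSeparating_generators (h : CoalgebraicFunctor U T) : h.generators.IsSeparating := by
  intro X Y f g hfg
  refine h.ext (LinearMap.ext fun x => ?_)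
  obtain ⟨w, hw, hw'⟩ := h.exists_sub X
  obtain ⟨S, hS, hxS, hSw⟩ := exists_countable_closed w hw x
  obtain ⟨Z, j, hj, hjS⟩ := hw' S hSw
  have hsub : S ⊆ Set.range (U.map j).lin := fun y hy => by
    have : y ∈ LinearMap.range (U.map j).lin := hjS ▸ Submodule.subset_span hy
    exact this
  let S' : Set (U.obj Z) := (U.map j).lin ⁻¹' S
  have hS' : S'.Countable := hS.preimage hj
  have hS'span : Submodule.span K S' = ⊤ := by
    rw [eq_top_iff]
    rintro z -
    have h1 : (U.map j).lin z ∈ Submodule.span K S := hjS ▸ ⟨z, rfl⟩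
    have h2 : Submodule.span K S = (Submodule.span K S').map (U.map j).lin := by
      rw [Submodule.map_span, Set.image_preimage_eq_of_subset hsub]
    rw [h2] at h1
    obtain ⟨z', hz', hz⟩ := h1
    rwa [← hj hz]
  obtain ⟨i, hi⟩ := h.exists_isModel Z hS' hS'span
  have hi' : ∃ X, i.IsModel h X := ⟨Z, hi⟩
  obtain ⟨k, hk⟩ := hi'.choose_spec.exists_bijective hi
  obtain ⟨z, rfl⟩ := hsub hxS
  obtain ⟨y, rfl⟩ := hk.2 z
  have h1 := hfg _ (ObjectProperty.ofObj_apply _ (⟨i, hi'⟩ :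
    {i : CountableStructure T // ∃ X, i.IsModel h X})) (k ≫ j)
  have h2 := congrArg (fun f => (U.map f).lin y) h1
  simpa only [U.map_comp, GMod.comp_lin, LinearMap.comp_apply] using h2

/-- Functors that preserve colimits have a right adjoint, by the special adjoint functor theorem. -/
theorem isLeftAdjoint (h : CoalgebraicFunctor U T) {B : Type (u + 1)} [Category.{u} B]
    (F : A ⥤ B) [PreservesColimits F] : F.IsLeftAdjoint :=
  have := h.hasColimits
  have := h.wellPowered_op
  isLeftAdjoint_of_preservesColimits_of_isSeparating h.isSeparating_generators F

end CoalgebraicFunctor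

/-! ### Quotients and subobjects of coalgebras over a curved cooperad -/

namespace SMod

variable {K : Type u} [Field K]

theorem evalMap_evalMap {V V' V'' : SMod K} {D D' D'' : GMod K} (f : Hom V V') (f' : Hom V' V'')
    (f'' : Hom V V'') (g : GMod.Hom D D') (g' : GMod.Hom D' D'') (g'' : GMod.Hom D D'')
    (hf : ∀ n c, (f''.app n).lin c = (f'.app n).lin ((f.app n).lin c))
    (hg : ∀ x, g''.lin x = g'.lin (g.lin x)) (z : V.eval D) :
    (evalMap f' g').lin ((evalMap f g).lin z) = (evalMap f'' g'').lin z := by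
  refine LinearMap.congr_fun (f := (evalMap f' g').lin ∘ₗ (evalMap f g).lin)
    (eval_hom_ext fun n v x => ?_) z
  rw [LinearMap.comp_apply, evalMap_mk, evalMap_mk, evalMap_mk]
  simp only [hf, hg]

theorem evalMap_mem_assocGraph {V W : SMod K} {D D' : GMod K} (g : GMod.Hom D D')
    {a : eval (comp V W) D} {b : eval V (eval W D)} (h : (a, b) ∈ evalAssocGraph V W D) :
    ((evalMap (Hom.id (comp V W)) g).lin a,
      (evalMap (Hom.id V) (evalMap (Hom.id W) g)).lin b) ∈ evalAssocGraph V W D' := by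
  suffices hle : evalAssocGraph V W D ≤ (evalAssocGraph V W D').comap (LinearMap.prodMap
      (evalMap (Hom.id (comp V W)) g).lin
      (evalMap (Hom.id V) (evalMap (Hom.id W) g)).lin) from hle h
  refine Submodule.span_le.2 ?_
  rintro _ ⟨k, l, m, γ, v, w, x, d, e, hw, hx, rfl⟩
  refine Submodule.subset_span ⟨k, l, m, γ, v, w, fun a => g.lin (x a), d, e, hw,
    fun a => g.map_gr _ _ (hx a), Prod.ext ?_ ?_⟩
  · exact evalMap_mk _ _ _ _
  · refine (map_smul (evalMap (Hom.id V) (evalMap (Hom.id W) g)).lin (assocSign K m γ d e)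
      (evalMk V (eval W D) v fun i => evalMk W D (w i) fun j => x (γ ⟨i, j⟩))).trans ?_
    refine congrArg (HSMul.hSMul (assocSign K m γ d e)) ((evalMap_mk _ _ _ _).trans ?_)
    exact congrArg (fun t => evalMk V (eval W D') v t) (funext fun i => evalMap_mk _ _ _ _)

theorem evalMap_mem_rootGraph {V : SMod K} {D D' : GMod K} {φ : V.obj 1 →ₗ[K] K}
    (g : GMod.Hom D D') {a : eval V D} {b : D} (h : (a, b) ∈ evalRootGraph V D φ) :
    ((evalMap (Hom.id V) g).lin a, g.lin b) ∈ evalRootGraph V D' φ := by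
  suffices hle : evalRootGraph V D φ ≤ (evalRootGraph V D' φ).comap
      (LinearMap.prodMap (evalMap (Hom.id V) g).lin g.lin) from hle h
  refine Submodule.span_le.2 ?_
  rintro _ (⟨v, x, rfl⟩ | ⟨n, v, x, hn, rfl⟩)
  · exact Submodule.subset_span (Or.inl ⟨v, fun a => g.lin (x a),
      Prod.ext (evalMap_mk _ _ _ _) (map_smul g.lin _ _)⟩)
  · exact Submodule.subset_span (Or.inr ⟨n, v, fun a => g.lin (x a), hn,
      Prod.ext (evalMap_mk _ _ _ _) (map_zero g.lin)⟩)

/-- The value of a degree preserving map that commutes with the differentials on a generator of the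
graph of a coderivation. -/
theorem evalMap_coder {V : SMod K} {D D' : GMod K} {d : ∀ n, V.obj n →ₗ[K] V.obj n}
    {d₁ : D →ₗ[K] D} {d₂ : D' →ₗ[K] D'} (g : GMod.Hom D D') (hg : ∀ x, g.lin (d₁ x) = d₂ (g.lin x))
    {n : ℕ} (v : V.obj n) (x : Fin n → D) (c : Fin n → K) :
    (evalMap (Hom.id V) g).lin (evalMk V D (d n v) x +
        ∑ i, c i • evalMk V D v (Function.update x i (d₁ (x i)))) =
      evalMk V D' (d n v) (fun i => g.lin (x i)) +
        ∑ i, c i • evalMk V D' v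
          (Function.update (fun i => g.lin (x i)) i (d₂ (g.lin (x i)))) := by
  rw [map_add, map_sum, evalMap_mk]
  refine congrArg₂ _ rfl (Finset.sum_congr rfl fun i _ => ?_)
  rw [map_smul, evalMap_mk]
  refine congrArg (HSMul.hSMul (c i)) ?_
  refine congrArg (fun t => evalMk V D' v t) (funext fun j => ?_)
  by_cases hj : j = i
  · subst hj; simp [hg]
  · simp [hj]

theorem evalMap_mem_coderGraph {V : SMod K} {D D' : GMod K} {d : ∀ n, V.obj n →ₗ[K] V.obj n}
    {d₁ : D →ₗ[K] D} {d₂ : D' →ₗ[K] D'} (g : GMod.Hom D D') (hg : ∀ x, g.lin (d₁ x) = d₂ (g.lin x))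
    {a b : eval V D} (h : (a, b) ∈ evalCoderGraph V D d d₁) :
    ((evalMap (Hom.id V) g).lin a, (evalMap (Hom.id V) g).lin b) ∈ evalCoderGraph V D' d d₂ := by
  suffices hle : evalCoderGraph V D d d₁ ≤ (evalCoderGraph V D' d d₂).comap
      (LinearMap.prodMap (evalMap (Hom.id V) g).lin (evalMap (Hom.id V) g).lin) from hle h
  refine Submodule.span_le.2 ?_
  rintro _ ⟨n, v, x, e₀, e, hv, hx, rfl⟩
  exact Submodule.subset_span ⟨n, v, fun a => g.lin (x a), e₀, e, hv,
    fun a => g.map_gr _ _ (hx a), Prod.ext (evalMap_mk _ _ _ _) (evalMap_coder g hg v x _)⟩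

/-- The generators of the graph of a coderivation which only involve elements of a given set. -/
def evalCoderGenerators (V : SMod K) (D : GMod K) (d : ∀ n, V.obj n →ₗ[K] V.obj n) (d' : D →ₗ[K] D)
    (F : Set D) : Set (eval V D × eval V D) :=
  {z | ∃ (n : ℕ) (v : V.obj n) (x : Fin n → D) (e₀ : ℤ) (e : Fin n → ℤ), v ∈ (V.obj n).gr e₀ ∧
    (∀ i, x i ∈ D.gr (e i)) ∧ (∀ i, x i ∈ F) ∧
    z = (evalMk V D v x, evalMk V D (d n v) x +
      ∑ i, ksgn K (e₀ + ∑ j ∈ Finset.Iio i, e j) •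
        evalMk V D v (Function.update x i (d' (x i))))}

theorem evalCoderGenerators_mono {V : SMod K} {D : GMod K} {d : ∀ n, V.obj n →ₗ[K] V.obj n}
    {d' : D →ₗ[K] D} {F F' : Set D} (h : F ⊆ F') :
    evalCoderGenerators V D d d' F ⊆ evalCoderGenerators V D d d' F' := by
  rintro _ ⟨n, v, x, e₀, e, hv, hx, hF, rfl⟩
  exact ⟨n, v, x, e₀, e, hv, hx, fun i => h (hF i), rfl⟩

/-- Each relation between a coderivation and an element of `V ∘ D` involves finitely many elements.
-/
theorem exists_finite_of_mem_evalCoderGraph {V : SMod K} {D : GMod K}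
    {d : ∀ n, V.obj n →ₗ[K] V.obj n} {d' : D →ₗ[K] D} {z : eval V D × eval V D}
    (hz : z ∈ evalCoderGraph V D d d') :
    ∃ F : Set D, F.Finite ∧ z ∈ Submodule.span K (evalCoderGenerators V D d d' F) := by
  refine Submodule.span_induction (p := fun z _ => ∃ F : Set D, F.Finite ∧
    z ∈ Submodule.span K (evalCoderGenerators V D d d' F)) ?_ ?_ ?_ ?_ hz
  · rintro _ ⟨n, v, x, e₀, e, hv, hx, rfl⟩
    exact ⟨Set.range x, Set.finite_range x, Submodule.subset_span
      ⟨n, v, x, e₀, e, hv, hx, fun i => ⟨i, rfl⟩, rfl⟩⟩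
  · exact ⟨∅, Set.finite_empty, Submodule.zero_mem _⟩
  · rintro a b _ _ ⟨F, hF, ha⟩ ⟨F', hF', hb⟩
    exact ⟨F ∪ F', hF.union hF', Submodule.add_mem _
      (Submodule.span_mono (evalCoderGenerators_mono Set.subset_union_left) ha)
      (Submodule.span_mono (evalCoderGenerators_mono Set.subset_union_right) hb)⟩
  · rintro c a _ ⟨F, hF, ha⟩
    exact ⟨F, hF, Submodule.smul_mem _ c ha⟩

end SMod

namespace Cog

variable {K : Type u} [Field K] {C : CurvedCooperad K}

/-- The underlying graded module of a coalgebra. -/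
def forget (C : CurvedCooperad K) : Cog C ⥤ GMod K where
  obj D := D.toGMod
  map f := f.toHom

/-- The functor `D ↦ (C ∘ D) × D`. -/
noncomputable def strFunctor (C : CurvedCooperad K) : GMod K ⥤ ModuleCat.{u} K where
  obj D := ModuleCat.of K (C.toSMod.eval D × D)
  map f := ModuleCat.ofHom ((SMod.evalMap (SMod.Hom.id C.toSMod) f).lin.prodMap f.lin)
  map_id D := ModuleCat.hom_ext (LinearMap.ext fun z =>
    Prod.ext (SMod.evalMap_id C.toSMod D z.1) rfl)
  map_comp f g := ModuleCat.hom_ext (LinearMap.ext fun z =>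
    Prod.ext (SMod.evalMap_comp C.toSMod f g _ rfl z.1) rfl)

/-- The coalgebra structure of a quotient of a sum of coalgebras. The axioms are natural linear
conditions on an element, so that they hold on all of `X` as they hold on the images. -/
noncomputable def ofCover {X : GMod K} (hX : X.IsGraded) (Δ : X →ₗ[K] C.toSMod.eval X)
    (d : X →ₗ[K] X) {ι : Type u} (D : ι → Cog C) (f : ∀ i, GMod.Hom (D i).toGMod X)
    (hΔ : ∀ i x, Δ ((f i).lin x) =
      (SMod.evalMap (SMod.Hom.id C.toSMod) (f i)).lin ((D i).Δ.lin x))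
    (hd : ∀ i x, d ((f i).lin x) = (f i).lin ((D i).d x))
    (hf : ⨆ i, LinearMap.range (f i).lin = ⊤) : Cog C :=
  have hmem : ∀ (S : Submodule K X), (∀ i x, (f i).lin x ∈ S) → ∀ x, x ∈ S := fun S h x => by
    have hle : ⨆ i, LinearMap.range (f i).lin ≤ S := iSup_le fun i => by
      rintro _ ⟨x, rfl⟩
      exact h i x
    rw [hf] at hle
    exact hle trivial
  have hgr : ∀ (n : ℤ) {Y : Type u} [AddCommGroup Y] [Module K Y] (g : X →ₗ[K] Y)
      (S : Submodule K Y), (∀ i x, x ∈ (D i).gr n → g ((f i).lin x) ∈ S) →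
      ∀ x ∈ X.gr n, g x ∈ S := fun n Y _ _ g S h x hx => by
    have hle : ⨆ i, ((D i).gr n).map (f i).lin ≤ S.comap g := iSup_le fun i => by
      rintro _ ⟨x, hx, rfl⟩
      exact h i x hx
    exact hle (GMod.gr_le_iSup_map hX (fun i => (D i).isGraded) f hf n hx)
  let Δ' : GMod.Hom X (C.toSMod.eval X) := ⟨Δ, fun n x hx => hgr n Δ _ (fun i x hx => by
    rw [hΔ]
    exact (SMod.evalMap _ _).map_gr _ _ ((D i).Δ.map_gr _ _ hx)) x hx⟩
  { toGMod := X
    isGraded := hX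
    Δ := Δ'
    coassoc := hmem ((SMod.evalAssocGraph C.toSMod C.toSMod X).comap
        (((SMod.evalMap C.Δ (GMod.Hom.id X)).lin.prod
          (SMod.evalMap (SMod.Hom.id C.toSMod) Δ').lin) ∘ₗ Δ)) (fun i x => by
      have h := SMod.evalMap_mem_assocGraph (f i) ((D i).coassoc x)
      rw [Submodule.mem_comap, LinearMap.comp_apply, hΔ]
      convert h using 1
      refine Prod.ext ?_ ?_
      · refine (SMod.evalMap_evalMap _ _ ⟨C.Δ.app, C.Δ.equivariant⟩ _ _ (f i) (fun _ _ => rfl)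
          (fun _ => rfl) _).trans (SMod.evalMap_evalMap _ _ _ _ _ _ (fun _ _ => rfl)
          (fun _ => rfl) _).symm
      · let k : GMod.Hom (D i).toGMod (C.toSMod.eval X) :=
          ⟨Δ ∘ₗ (f i).lin, fun n x hx => Δ'.map_gr n _ ((f i).map_gr n x hx)⟩
        exact (SMod.evalMap_evalMap _ _ (SMod.Hom.id _) _ _ k (fun _ _ => rfl)
          (fun _ => rfl) _).trans (SMod.evalMap_evalMap _ _ (SMod.Hom.id _) _ _ k (fun _ _ => rfl)
          (hΔ i) _).symm)
    counit := hmem ((SMod.evalRootGraph C.toSMod X C.ε).comap (Δ.prod LinearMap.id)) (fun i x => by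
      have h := SMod.evalMap_mem_rootGraph (f i) ((D i).counit x)
      rw [← hΔ] at h
      exact h)
    d := d
    d_gr := fun n x hx => hgr n d _ (fun i x hx => by
      rw [hd]
      exact (f i).map_gr _ _ ((D i).d_gr _ _ hx)) x hx
    Δ_d := hmem ((SMod.evalCoderGraph C.toSMod X C.d d).comap (Δ.prod (Δ ∘ₗ d))) (fun i x => by
      have h := SMod.evalMap_mem_coderGraph (d₂ := d) (f i) (fun x => (hd i x).symm) ((D i).Δ_d x)
      rw [← hΔ, ← hΔ, ← hd] at h
      exact h)
    d_d := hmem ((SMod.evalRootGraph C.toSMod X C.θ).comap (Δ.prod (d ∘ₗ d))) (fun i x => by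
      have h := SMod.evalMap_mem_rootGraph (f i) ((D i).d_d x)
      rw [← hΔ, ← hd, ← hd] at h
      exact h) }

/-- A countable set of elements whose membership in a subspace implies that the decomposition of `x`
and of `d x`, with the compatibility between them, takes place in the subspace. -/
noncomputable def closureSet (D : Cog C) (x : D.toGMod) : Set D.toGMod :=
  Set.range (fun n => GMod.proj D.isGraded n x) ∪ {D.d x} ∪
    (SMod.exists_finite_of_mem_evalCoderGraph (D.Δ_d x)).choose

theorem countable_closureSet (D : Cog C) (x : D.toGMod) : (D.closureSet x).Countable :=
  ((Set.countable_range _).union (Set.countable_singleton _)).union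
    (SMod.exists_finite_of_mem_evalCoderGraph (D.Δ_d x)).choose_spec.1.countable

/-- A subspace spanned by a set closed under `closureSet` is a subcoalgebra. Its decomposition map
is obtained from that of `D` through a retraction `r` onto the subspace. As `r` does not have to
commute with the coderivations, the coderivation property does not follow from that of `D`; this is
what `closureSet` provides for. -/
theorem exists_subcoalgebra (D : Cog C) (S : Set D.toGMod) (hS : ∀ x ∈ S, D.closureSet x ⊆ S) :
    ∃ (Y : Cog C) (g : Y ⟶ D), Function.Injective g.lin ∧
      LinearMap.range g.lin = Submodule.span K S := by
  set N := Submodule.span K S with hNdef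
  have hspan : ∀ (f : D.toGMod →ₗ[K] D.toGMod), (∀ x ∈ S, f x ∈ S) → ∀ x ∈ N, f x ∈ N :=
    fun f hf x hx => by
      have hle : N ≤ N.comap f := Submodule.span_le.2 fun x hx => Submodule.subset_span (hf x hx)
      exact hle hx
  have hproj : ∀ n, ∀ x ∈ N, GMod.proj D.isGraded n x ∈ N := fun n =>
    hspan _ fun x hx => hS x hx (Or.inl (Or.inl ⟨n, rfl⟩))
  have hd : ∀ x ∈ N, D.d x ∈ N := hspan _ fun x hx => hS x hx (Or.inl (Or.inr rfl))
  let X := D.toGMod.sub N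
  have hX : X.IsGraded := GMod.sub_isGraded D.isGraded hproj
  let i : GMod.Hom X D.toGMod := D.toGMod.incl N
  obtain ⟨r, hr⟩ := GMod.exists_retraction D.isGraded hX
  let dN : X →ₗ[K] X := D.d.restrict hd
  have hid : ∀ x, i.lin (dN x) = D.d (i.lin x) := fun x => rfl
  let I := SMod.evalMap (SMod.Hom.id C.toSMod) i
  let R := SMod.evalMap (SMod.Hom.id C.toSMod) r
  have hRI : ∀ z, R.lin (I.lin z) = z := fun z => by
    refine (SMod.evalMap_evalMap (SMod.Hom.id C.toSMod) (SMod.Hom.id C.toSMod)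
      (SMod.Hom.id C.toSMod) i r (GMod.Hom.id X) (fun _ _ => rfl) (fun x => (hr x).symm) z).trans ?_
    exact SMod.evalMap_id _ _ z
  -- Elements of `N` satisfy the coderivation property within `N`. This also shows that the
  -- decomposition of an element of `N` is in the image of `C ∘ N`.
  have hmem : ∀ x : X, ∃ a b, (a, b) ∈ SMod.evalCoderGraph C.toSMod X C.d dN ∧
      I.lin a = D.Δ.lin (i.lin x) ∧ I.lin b = D.Δ.lin (D.d (i.lin x)) := by
    have hle : N ≤ ((SMod.evalCoderGraph C.toSMod X C.d dN).map
        (I.lin.prodMap I.lin)).comap (D.Δ.lin.prod (D.Δ.lin ∘ₗ D.d)) := by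
      refine Submodule.span_le.2 fun x hx => ?_
      have h1 := (SMod.exists_finite_of_mem_evalCoderGraph (D.Δ_d x)).choose_spec.2
      suffices hle' : Submodule.span K (SMod.evalCoderGenerators C.toSMod D.toGMod C.d D.d
          (SMod.exists_finite_of_mem_evalCoderGraph (D.Δ_d x)).choose) ≤
          (SMod.evalCoderGraph C.toSMod X C.d dN).map (I.lin.prodMap I.lin) from hle' h1
      refine Submodule.span_le.2 ?_
      rintro _ ⟨n, v, y, e₀, e, hv, hy, hyF, rfl⟩
      have hyN : ∀ i, y i ∈ N := fun i => Submodule.subset_span (hS x hx (Or.inr (hyF i)))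
      let y' : Fin n → X := fun i => ⟨y i, hyN i⟩
      refine ⟨_, Submodule.subset_span ⟨n, v, y', e₀, e, hv, hy, rfl⟩, Prod.ext ?_ ?_⟩
      · exact SMod.evalMap_mk _ _ _ _
      · exact SMod.evalMap_coder (d₂ := D.d) i hid v y' _
    intro x
    obtain ⟨⟨a, b⟩, hab, h⟩ := hle x.2
    exact ⟨a, b, hab, congrArg Prod.fst h, congrArg Prod.snd h⟩
  let ΔN : GMod.Hom X (C.toSMod.eval X) := ⟨R.lin ∘ₗ D.Δ.lin ∘ₗ i.lin, fun n x hx =>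
    R.map_gr _ _ (D.Δ.map_gr _ _ (i.map_gr _ _ hx))⟩
  have hΔN : ∀ x, I.lin (ΔN.lin x) = D.Δ.lin (i.lin x) := fun x => by
    obtain ⟨a, b, -, ha, -⟩ := hmem x
    have : ΔN.lin x = R.lin (D.Δ.lin (i.lin x)) := rfl
    rw [this, ← ha, hRI]
  let Y : Cog C :=
    { toGMod := X
      isGraded := hX
      Δ := ΔN
      coassoc := fun x => by
        have h := SMod.evalMap_mem_assocGraph r (D.coassoc (i.lin x))
        convert h using 1
        refine Prod.ext ?_ ?_
        · have h1 : ΔN.lin x = R.lin (D.Δ.lin (i.lin x)) := rfl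
          simp only [h1]
          exact (SMod.evalMap_evalMap _ _ ⟨C.Δ.app, C.Δ.equivariant⟩ _ _ r (fun _ _ => rfl)
            (fun _ => rfl) _).trans (SMod.evalMap_evalMap _ _ _ _ _ _ (fun _ _ => rfl)
            (fun _ => rfl) _).symm
        · simp only [← hΔN x]
          let k : GMod.Hom X (C.toSMod.eval D.toGMod) :=
            ⟨D.Δ.lin ∘ₗ i.lin, fun n x hx => D.Δ.map_gr n _ (i.map_gr n x hx)⟩
          refine ((congrArg (SMod.evalMap (SMod.Hom.id C.toSMod) R).lin
            (SMod.evalMap_evalMap _ _ (SMod.Hom.id _) _ _ k (fun _ _ => rfl)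
              (fun _ => rfl) (ΔN.lin x))).trans ?_).symm
          exact SMod.evalMap_evalMap _ _ (SMod.Hom.id _) _ _ ΔN (fun _ _ => rfl)
            (fun _ => rfl) (ΔN.lin x)
      counit := fun x => by
        have h := SMod.evalMap_mem_rootGraph r (D.counit (i.lin x))
        have h1 : r.lin (i.lin x) = x := hr x
        rw [h1] at h
        exact h
      d := dN
      d_gr := fun n x hx => D.d_gr n _ hx
      Δ_d := fun x => by
        obtain ⟨a, b, hab, ha, hb⟩ := hmem x
        have h1 : ΔN.lin x = a := by
          rw [← hRI a, ha]; rfl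
        have h2 : ΔN.lin (dN x) = b := by
          rw [← hRI b, hb]; rfl
        rw [h1, h2]
        exact hab
      d_d := fun x => by
        have h := SMod.evalMap_mem_rootGraph r (D.d_d (i.lin x))
        have h1 : r.lin (D.d (D.d (i.lin x))) = dN (dN x) := hr (dN (dN x))
        rw [h1] at h
        exact h }
  exact ⟨Y, ⟨i, hid, fun x => (hΔN x).symm⟩, N.injective_subtype, N.range_subtype⟩

/-- Coalgebras over `C` are graded modules `D` with a linear map `D → (C ∘ D) × D`. -/
noncomputable def coalgebraicFunctor (C : CurvedCooperad K) :
    CoalgebraicFunctor (forget C) (strFunctor C) where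
  isGraded D := D.isGraded
  faithful := ⟨fun {_ _ _ _} h => hom_ext (congrArg (fun f => GMod.Hom.lin f) h)⟩
  str D := D.Δ.lin.prod D.d
  str_natural f := LinearMap.ext fun x => Prod.ext (f.comm_Δ x) (f.comm_d x).symm
  full f hf := ⟨⟨f, fun x => (congrArg Prod.snd (LinearMap.congr_fun hf x)).symm,
    fun x => congrArg Prod.fst (LinearMap.congr_fun hf x)⟩, rfl⟩
  exists_quotient X hX s ι D f hs hf := by
    let Y := ofCover hX (LinearMap.fst K _ _ ∘ₗ s) (LinearMap.snd K _ _ ∘ₗ s) D f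
      (fun i x => congrArg Prod.fst (LinearMap.congr_fun (hs i) x))
      (fun i x => congrArg Prod.snd (LinearMap.congr_fun (hs i) x)) hf
    refine ⟨Y, Iso.refl X, LinearMap.ext fun x => Prod.ext ?_ rfl⟩
    exact (SMod.evalMap_id C.toSMod X _).symm
  exists_sub D := ⟨D.closureSet, D.countable_closureSet, D.exists_subcoalgebra⟩

end Cog

/-! ### Quotients and subobjects of cocommutative coalgebras -/

namespace GMod

variable {K : Type u} [Field K] {D D' E E' : GMod K}

theorem Hom.map_sgn (hD : D.IsGraded) (hE : E.IsGraded) (f : Hom D E) (k : ℤ) (x : D) :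
    f.lin (sgn hD k x) = sgn hE k (f.lin x) := by
  refine hom_induction hD (p := fun x => f.lin (sgn hD k x) = sgn hE k (f.lin x))
    (fun m x hx => ?_) (by simp) (fun x y hx hy => by simp only [map_add, hx, hy]) x
  rw [sgn_apply hD k hx, sgn_apply hE k (f.map_gr m x hx), map_smul]

theorem map_swap (hD : D.IsGraded) (hD' : D'.IsGraded) (hE : E.IsGraded) (hE' : E'.IsGraded)
    (f : Hom D E) (g : Hom D' E') (t : D ⊗[K] D') :
    TensorProduct.map g.lin f.lin (swap hD hD' t) =
      swap hE hE' (TensorProduct.map f.lin g.lin t) := by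
  refine tensor_induction hD hD' (p := fun t => TensorProduct.map g.lin f.lin (swap hD hD' t) =
    swap hE hE' (TensorProduct.map f.lin g.lin t)) (fun i j x y hx hy => ?_) (by simp)
    (fun s t hs ht => by simp only [map_add, hs, ht]) t
  rw [swap_tmul hD hD' hx hy, TensorProduct.map_tmul,
    swap_tmul hE hE' (f.map_gr _ _ hx) (g.map_gr _ _ hy), map_smul, TensorProduct.map_tmul]

theorem map_tensorD (hD : D.IsGraded) (hE : E.IsGraded) {d : D →ₗ[K] D} {d' : D' →ₗ[K] D'}
    {e : E →ₗ[K] E} {e' : E' →ₗ[K] E'} (f : Hom D E) (g : Hom D' E')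
    (hf : ∀ x, f.lin (d x) = e (f.lin x)) (hg : ∀ x, g.lin (d' x) = e' (g.lin x))
    (t : D ⊗[K] D') :
    TensorProduct.map f.lin g.lin (tensorD hD d d' t) =
      tensorD hE e e' (TensorProduct.map f.lin g.lin t) := by
  induction t using TensorProduct.induction_on with
  | zero => simp
  | add s t hs ht => simp only [map_add, hs, ht]
  | tmul x y =>
    simp only [tensorD, LinearMap.add_apply, TensorProduct.map_tmul, map_add, LinearMap.id_apply,
      hf, hg, f.map_sgn hD hE]

end GMod

namespace UCocom

variable {K : Type u} [Field K]

/-- The axioms of a dg cocommutative coalgebra with structure maps `δ`, `ε` and `d`, evaluated at an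
element `x`. The degrees of the structure maps are expressed through the homogeneous components, so
that every axiom is an equality between natural linear functions of `x`. -/
structure AxiomsAt {X : GMod K} (hX : X.IsGraded) (δ : X →ₗ[K] X ⊗[K] X) (ε : X →ₗ[K] K)
    (d : X →ₗ[K] X) (x : X) : Prop where
  δ_proj : ∀ n, δ (GMod.proj hX n x) = GMod.proj (GMod.tensor_isGraded hX hX) n (δ x)
  ε_proj : ∀ n, n ≠ 0 → ε (GMod.proj hX n x) = 0
  d_proj : ∀ n, d (GMod.proj hX n x) = GMod.proj hX (n - 1) (d x)
  coassoc : TensorProduct.map LinearMap.id δ (δ x) =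
    TensorProduct.assoc K X X X (TensorProduct.map δ LinearMap.id (δ x))
  counit_left : TensorProduct.map ε LinearMap.id (δ x) = (1 : K) ⊗ₜ[K] x
  counit_right : TensorProduct.map LinearMap.id ε (δ x) = x ⊗ₜ[K] (1 : K)
  swap_δ : GMod.swap hX hX (δ x) = δ x
  δ_d : δ (d x) = GMod.tensorD hX d d (δ x)
  ε_d : ε (d x) = 0
  d_d : d (d x) = 0

theorem axiomsAt (E : UCocom K) (x : E.toGMod) :
    AxiomsAt E.isGraded E.comul E.counit E.d x where
  δ_proj n := GMod.Hom.map_proj E.isGraded _ E.obj.comon.comul.toHom n x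
  ε_proj n hn := E.counit_gr hn (GMod.proj_mem _ n x)
  d_proj n := by
    refine GMod.hom_induction E.isGraded (p := fun x => E.d (GMod.proj E.isGraded n x) =
      GMod.proj E.isGraded (n - 1) (E.d x)) (fun m x hx => ?_) (by simp)
      (fun x y hx hy => by simp only [map_add, hx, hy]) x
    rw [GMod.proj_apply _ _ hx, GMod.proj_apply _ _ (E.obj.X.d_gr m x hx)]
    by_cases h : m = n
    · rw [if_pos h, if_pos (by omega)]
    · rw [if_neg h, if_neg (by omega), map_zero]
  coassoc := (E.coassoc_apply x).symm
  counit_left := LinearMap.congr_fun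
    (congrArg (fun f => f.lin) (ComonObj.counit_comul E.obj.X)) x
  counit_right := LinearMap.congr_fun
    (congrArg (fun f => f.lin) (ComonObj.comul_counit E.obj.X)) x
  swap_δ := E.swap_comul x
  δ_d := E.comul_d x
  ε_d := E.counit_d x
  d_d := E.obj.X.d_d x

variable {X Y : GMod K} {δ : X →ₗ[K] X ⊗[K] X} {ε : X →ₗ[K] K} {d : X →ₗ[K] X}
  {δ' : Y →ₗ[K] Y ⊗[K] Y} {ε' : Y →ₗ[K] K} {d' : Y →ₗ[K] Y}

theorem map_comul_id (f : X →ₗ[K] Y) (hδ : ∀ x, δ' (f x) = TensorProduct.map f f (δ x))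
    (t : X ⊗[K] X) :
    TensorProduct.assoc K Y Y Y (TensorProduct.map δ' LinearMap.id (TensorProduct.map f f t)) =
      TensorProduct.map f (TensorProduct.map f f)
        (TensorProduct.assoc K X X X (TensorProduct.map δ LinearMap.id t)) := by
  induction t using TensorProduct.induction_on with
  | zero => simp
  | add s t hs ht => simp only [map_add, hs, ht]
  | tmul x y =>
    simp only [TensorProduct.map_tmul, hδ, LinearMap.id_apply]
    generalize δ x = t
    induction t using TensorProduct.induction_on with
    | zero => simp
    | add s t hs ht => simp only [map_add, TensorProduct.add_tmul, hs, ht]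
    | tmul x y => simp

theorem map_id_comul (f : X →ₗ[K] Y) (hδ : ∀ x, δ' (f x) = TensorProduct.map f f (δ x))
    (t : X ⊗[K] X) :
    TensorProduct.map LinearMap.id δ' (TensorProduct.map f f t) =
      TensorProduct.map f (TensorProduct.map f f) (TensorProduct.map LinearMap.id δ t) := by
  induction t using TensorProduct.induction_on with
  | zero => simp
  | add s t hs ht => simp only [map_add, hs, ht]
  | tmul x y => simp [hδ]

theorem map_counit_id (f : X →ₗ[K] Y) (hε : ∀ x, ε' (f x) = ε x) (t : X ⊗[K] X) :
    TensorProduct.map ε' LinearMap.id (TensorProduct.map f f t) =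
      TensorProduct.map LinearMap.id f (TensorProduct.map ε LinearMap.id t) := by
  induction t using TensorProduct.induction_on with
  | zero => simp
  | add s t hs ht => simp only [map_add, hs, ht]
  | tmul x y => simp [hε]

theorem map_id_counit (f : X →ₗ[K] Y) (hε : ∀ x, ε' (f x) = ε x) (t : X ⊗[K] X) :
    TensorProduct.map LinearMap.id ε' (TensorProduct.map f f t) =
      TensorProduct.map f LinearMap.id (TensorProduct.map LinearMap.id ε t) := by
  induction t using TensorProduct.induction_on with
  | zero => simp
  | add s t hs ht => simp only [map_add, hs, ht]
  | tmul x y => simp [hε]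

/-- The axioms pass to the image of an element. -/
theorem AxiomsAt.map {hX : X.IsGraded} (hY : Y.IsGraded) (f : GMod.Hom X Y)
    (hδ : ∀ x, δ' (f.lin x) = TensorProduct.map f.lin f.lin (δ x))
    (hε : ∀ x, ε' (f.lin x) = ε x) (hd : ∀ x, d' (f.lin x) = f.lin (d x)) {x : X}
    (h : AxiomsAt hX δ ε d x) : AxiomsAt hY δ' ε' d' (f.lin x) where
  δ_proj n := by
    rw [← f.map_proj hX hY, hδ, h.δ_proj, hδ]
    exact (f.tensor f).map_proj _ _ n (δ x)
  ε_proj n hn := by rw [← f.map_proj hX hY, hε, h.ε_proj n hn]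
  d_proj n := by rw [← f.map_proj hX hY, hd, h.d_proj, hd, f.map_proj hX hY]
  coassoc := by rw [hδ, map_id_comul f.lin hδ, map_comul_id f.lin hδ, h.coassoc]
  counit_left := by
    rw [hδ, map_counit_id f.lin hε, h.counit_left, TensorProduct.map_tmul, LinearMap.id_apply]
  counit_right := by
    rw [hδ, map_id_counit f.lin hε, h.counit_right, TensorProduct.map_tmul, LinearMap.id_apply]
  swap_δ := by rw [hδ, ← GMod.map_swap hX hX hY hY, h.swap_δ]
  δ_d := by rw [hd, hδ, h.δ_d, hδ, GMod.map_tensorD hX hY f f (fun x => (hd x).symm)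
    (fun x => (hd x).symm)]
  ε_d := by rw [hd, hε, h.ε_d]
  d_d := by rw [hd, hd, h.d_d, map_zero]

/-- The axioms can be tested after an injective map, as tensor powers of an injective map of vector
spaces are injective. -/
theorem AxiomsAt.of_map (hX : X.IsGraded) {hY : Y.IsGraded} (f : GMod.Hom X Y)
    (hf : Function.Injective f.lin)
    (hδ : ∀ x, δ' (f.lin x) = TensorProduct.map f.lin f.lin (δ x))
    (hε : ∀ x, ε' (f.lin x) = ε x) (hd : ∀ x, d' (f.lin x) = f.lin (d x)) {x : X}
    (h : AxiomsAt hY δ' ε' d' (f.lin x)) : AxiomsAt hX δ ε d x :=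
  have hff := TensorProduct.map_injective_of_flat_flat f.lin f.lin hf hf
  { δ_proj := fun n => hff (by
      rw [← hδ, f.map_proj hX hY, h.δ_proj, hδ]
      exact ((f.tensor f).map_proj _ _ n (δ x)).symm)
    ε_proj := fun n hn => by rw [← hε, f.map_proj hX hY, h.ε_proj n hn]
    d_proj := fun n => hf (by
      rw [← hd, f.map_proj hX hY, h.d_proj, hd, f.map_proj hX hY])
    coassoc := TensorProduct.map_injective_of_flat_flat f.lin _ hf hff (by
      rw [← map_id_comul f.lin hδ, ← map_comul_id f.lin hδ, ← hδ, h.coassoc])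
    counit_left := TensorProduct.map_injective_of_flat_flat (LinearMap.id : K →ₗ[K] K) f.lin
      Function.injective_id hf (by
        rw [← map_counit_id f.lin hε, ← hδ, h.counit_left, TensorProduct.map_tmul,
          LinearMap.id_apply])
    counit_right := TensorProduct.map_injective_of_flat_flat f.lin (LinearMap.id : K →ₗ[K] K)
      hf Function.injective_id (by
        rw [← map_id_counit f.lin hε, ← hδ, h.counit_right, TensorProduct.map_tmul,
          LinearMap.id_apply])
    swap_δ := hff (by rw [GMod.map_swap hX hX hY hY, ← hδ, h.swap_δ])
    δ_d := hff (by rw [← hδ, ← hd, h.δ_d, hδ, GMod.map_tensorD hX hY f f (fun x => (hd x).symm)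
      (fun x => (hd x).symm)])
    ε_d := by rw [← hε, ← hd, h.ε_d]
    d_d := hf (by rw [← hd, ← hd, h.d_d, map_zero]) }

theorem AxiomsAt.zero (hX : X.IsGraded) : AxiomsAt hX δ ε d 0 := by
  constructor <;> simp

theorem AxiomsAt.add {hX : X.IsGraded} {x y : X} (hx : AxiomsAt hX δ ε d x)
    (hy : AxiomsAt hX δ ε d y) : AxiomsAt hX δ ε d (x + y) where
  δ_proj n := by simp only [map_add, hx.δ_proj, hy.δ_proj]
  ε_proj n hn := by simp only [map_add, hx.ε_proj n hn, hy.ε_proj n hn, add_zero]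
  d_proj n := by simp only [map_add, hx.d_proj, hy.d_proj]
  coassoc := by simp only [map_add, hx.coassoc, hy.coassoc]
  counit_left := by simp only [map_add, hx.counit_left, hy.counit_left, TensorProduct.tmul_add]
  counit_right := by simp only [map_add, hx.counit_right, hy.counit_right, TensorProduct.add_tmul]
  swap_δ := by simp only [map_add, hx.swap_δ, hy.swap_δ]
  δ_d := by simp only [map_add, hx.δ_d, hy.δ_d]
  ε_d := by simp only [map_add, hx.ε_d, hy.ε_d, add_zero]
  d_d := by simp only [map_add, hx.d_d, hy.d_d, add_zero]

/-- The cocommutative coalgebra with given structure maps. -/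
noncomputable def ofAxioms (hX : X.IsGraded) (h : ∀ x, AxiomsAt hX δ ε d x) : UCocom K :=
  let Z : DGMod K :=
    { toGMod := X
      isGraded := hX
      d := d
      d_gr := fun n x hx => by
        have h1 := (h x).d_proj n
        rw [GMod.proj_self hX hx] at h1
        exact h1 ▸ GMod.proj_mem hX _ _
      d_d := fun x => (h x).d_d }
  let _ : ComonObj Z :=
    { counit := ⟨⟨ε, fun n x hx => by
        by_cases hn : n = 0
        · subst hn
          exact (Submodule.mem_top : ε x ∈ (⊤ : Submodule K K))
        · have h1 := (h x).ε_proj n hn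
          rw [GMod.proj_self hX hx] at h1
          rw [h1]
          exact Submodule.zero_mem _⟩, fun x => (h x).ε_d⟩
      comul := ⟨⟨δ, fun n x hx => by
        have h1 := (h x).δ_proj n
        rw [GMod.proj_self hX hx] at h1
        exact h1 ▸ GMod.proj_mem _ _ _⟩, fun x => (h x).δ_d⟩
      counit_comul := DGMod.hom_ext (LinearMap.ext fun x => (h x).counit_left)
      comul_counit := DGMod.hom_ext (LinearMap.ext fun x => (h x).counit_right)
      comul_assoc := DGMod.hom_ext (LinearMap.ext fun x => (h x).coassoc) }
  ⟨⟨Z⟩, (⟨DGMod.hom_ext (LinearMap.ext fun x => (h x).swap_δ)⟩ : IsCommComonObj Z)⟩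

/-- The morphism of coalgebras with a given underlying map. -/
noncomputable def ofLin {E F : UCocom K} (f : GMod.Hom E.toGMod F.toGMod)
    (hδ : ∀ x, F.comul (f.lin x) = TensorProduct.map f.lin f.lin (E.comul x))
    (hε : ∀ x, F.counit (f.lin x) = E.counit x) (hd : ∀ x, F.d (f.lin x) = f.lin (E.d x)) :
    E ⟶ F :=
  let g : E.obj.X ⟶ F.obj.X := ⟨f, fun x => (hd x).symm⟩
  ObjectProperty.homMk (Comon.Hom.mk' g (DGMod.hom_ext (LinearMap.ext hε))
    (DGMod.hom_ext (LinearMap.ext hδ)))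

theorem hom_ext {E F : UCocom K} {f g : E ⟶ F} (h : lin f = lin g) : f = g := by
  apply ObjectProperty.hom_ext
  apply Comon.Hom.ext
  exact DGMod.hom_ext h

theorem d_lin {E F : UCocom K} (f : E ⟶ F) (x : E.toGMod) : F.d (lin f x) = lin f (E.d x) :=
  (f.hom.hom.comm x).symm

/-- The underlying graded module of a coalgebra. -/
def forget (K : Type u) [Field K] : UCocom K ⥤ GMod K where
  obj E := E.toGMod
  map f := f.hom.hom.toHom

/-- The functor `X ↦ (X ⊗ X) × K × X`. -/
noncomputable def strFunctor (K : Type u) [Field K] : GMod K ⥤ ModuleCat.{u} K where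
  obj X := ModuleCat.of K ((X ⊗[K] X) × K × X)
  map f := ModuleCat.ofHom
    ((TensorProduct.map f.lin f.lin).prodMap (LinearMap.id.prodMap f.lin))
  map_id _ := ModuleCat.hom_ext (LinearMap.ext fun z =>
    Prod.ext (LinearMap.congr_fun TensorProduct.map_id z.1) rfl)
  map_comp f g := ModuleCat.hom_ext (LinearMap.ext fun z =>
    Prod.ext (LinearMap.congr_fun (TensorProduct.map_comp g.lin g.lin f.lin f.lin) z.1) rfl)

/-- A countable set of elements whose membership in a subspace implies that the homogeneous
components, the differential and the coproduct of `x` are in the subspace. -/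
noncomputable def closureSet (E : UCocom K) (x : E.toGMod) : Set E.toGMod :=
  Set.range (fun n => GMod.proj E.isGraded n x) ∪ {E.d x} ∪
    ((Prod.fst '' ((TensorProduct.exists_finset (E.comul x)).choose : Set (E.toGMod × E.toGMod))) ∪
      Prod.snd '' ((TensorProduct.exists_finset (E.comul x)).choose : Set (E.toGMod × E.toGMod)))

theorem countable_closureSet (E : UCocom K) (x : E.toGMod) : (E.closureSet x).Countable :=
  ((Set.countable_range _).union (Set.countable_singleton _)).union
    (((Finset.finite_toSet _).image _).union ((Finset.finite_toSet _).image _)).countable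

/-- A subspace spanned by a set closed under `closureSet` is a subcoalgebra. -/
theorem exists_subcoalgebra (E : UCocom K) (S : Set E.toGMod) (hS : ∀ x ∈ S, E.closureSet x ⊆ S) :
    ∃ (F : UCocom K) (g : F ⟶ E), Function.Injective (lin g) ∧
      LinearMap.range (lin g) = Submodule.span K S := by
  set N := Submodule.span K S with hNdef
  have hspan : ∀ (f : E.toGMod →ₗ[K] E.toGMod), (∀ x ∈ S, f x ∈ S) → ∀ x ∈ N, f x ∈ N :=
    fun f hf x hx => by
      have hle : N ≤ N.comap f := Submodule.span_le.2 fun x hx => Submodule.subset_span (hf x hx)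
      exact hle hx
  have hproj : ∀ n, ∀ x ∈ N, GMod.proj E.isGraded n x ∈ N := fun n =>
    hspan _ fun x hx => hS x hx (Or.inl (Or.inl ⟨n, rfl⟩))
  have hd : ∀ x ∈ N, E.d x ∈ N := hspan _ fun x hx => hS x hx (Or.inl (Or.inr rfl))
  let X := E.toGMod.sub N
  have hX : X.IsGraded := GMod.sub_isGraded E.isGraded hproj
  let i : GMod.Hom X E.toGMod := E.toGMod.incl N
  obtain ⟨r, hr⟩ := GMod.exists_retraction E.isGraded hX
  have hle : N ≤ (LinearMap.range (TensorProduct.map i.lin i.lin)).comap E.comul := by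
    refine Submodule.span_le.2 fun x hx => ?_
    rw [SetLike.mem_coe, Submodule.mem_comap,
      (TensorProduct.exists_finset (E.comul x)).choose_spec]
    refine Submodule.sum_mem _ fun p hp => ?_
    have h1 : p.1 ∈ N := Submodule.subset_span
      (hS x hx (Or.inr (Or.inl (Set.mem_image_of_mem Prod.fst (Finset.mem_coe.2 hp)))))
    have h2 : p.2 ∈ N := Submodule.subset_span
      (hS x hx (Or.inr (Or.inr (Set.mem_image_of_mem Prod.snd (Finset.mem_coe.2 hp)))))
    exact ⟨(⟨p.1, h1⟩ : N) ⊗ₜ (⟨p.2, h2⟩ : N), TensorProduct.map_tmul _ _ _ _⟩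
  let δ : X →ₗ[K] X ⊗[K] X := TensorProduct.map r.lin r.lin ∘ₗ E.comul ∘ₗ i.lin
  have hδ : ∀ x, E.comul (i.lin x) = TensorProduct.map i.lin i.lin (δ x) := fun x => by
    obtain ⟨t, ht⟩ := hle x.2
    have hrt : TensorProduct.map r.lin r.lin (TensorProduct.map i.lin i.lin t) = t := by
      have hri : r.lin ∘ₗ i.lin = LinearMap.id := LinearMap.ext hr
      rw [← LinearMap.comp_apply, ← TensorProduct.map_comp, hri, TensorProduct.map_id,
        LinearMap.id_apply]
    have h1 : δ x = TensorProduct.map r.lin r.lin (E.comul (x : E.toGMod)) := rfl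
    rw [h1, ← ht, hrt]
    exact ht.symm
  let F : UCocom K := ofAxioms (δ := δ) (ε := E.counit ∘ₗ i.lin) (d := E.d.restrict hd) hX
    fun x => AxiomsAt.of_map hX i N.injective_subtype hδ (fun _ => rfl) (fun _ => rfl)
      (E.axiomsAt (i.lin x))
  exact ⟨F, ofLin (E := F) i hδ (fun _ => rfl) (fun _ => rfl), N.injective_subtype,
    N.range_subtype⟩

/-- Cocommutative coalgebras are graded modules `X` with a linear map `X → (X ⊗ X) × K × X`. -/
noncomputable def coalgebraicFunctor (K : Type u) [Field K] :
    CoalgebraicFunctor (forget K) (strFunctor K) where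
  isGraded E := E.isGraded
  faithful := ⟨fun {_ _ _ _} h => hom_ext (congrArg (fun f => GMod.Hom.lin f) h)⟩
  str E := E.comul.prod (E.counit.prod E.d)
  str_natural f := LinearMap.ext fun x =>
    Prod.ext (comul_lin f x) (Prod.ext (counit_lin f x) (d_lin f x))
  full f hf := ⟨ofLin f (fun x => congrArg Prod.fst (LinearMap.congr_fun hf x))
    (fun x => congrArg (fun z => z.2.1) (LinearMap.congr_fun hf x))
    (fun x => congrArg (fun z => z.2.2) (LinearMap.congr_fun hf x)), rfl⟩
  exists_quotient X hX s ι E f hs hf := by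
    have hδ : ∀ i x, (s ((f i).lin x)).1 = TensorProduct.map (f i).lin (f i).lin ((E i).comul x) :=
      fun i x => congrArg Prod.fst (LinearMap.congr_fun (hs i) x)
    have hε : ∀ i x, (s ((f i).lin x)).2.1 = (E i).counit x :=
      fun i x => congrArg (fun z => z.2.1) (LinearMap.congr_fun (hs i) x)
    have hd : ∀ i x, (s ((f i).lin x)).2.2 = (f i).lin ((E i).d x) :=
      fun i x => congrArg (fun z => z.2.2) (LinearMap.congr_fun (hs i) x)
    let δ : X →ₗ[K] X ⊗[K] X := LinearMap.fst K _ _ ∘ₗ s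
    let ε : X →ₗ[K] K := LinearMap.fst K _ _ ∘ₗ LinearMap.snd K _ _ ∘ₗ s
    let d : X →ₗ[K] X := LinearMap.snd K _ _ ∘ₗ LinearMap.snd K _ _ ∘ₗ s
    have hax : ∀ x, AxiomsAt hX δ ε d x := fun x => by
      have hx : x ∈ ⨆ i, LinearMap.range (f i).lin := by rw [hf]; trivial
      refine Submodule.iSup_induction _ (motive := AxiomsAt hX δ ε d) hx ?_ (AxiomsAt.zero hX)
        fun _ _ => AxiomsAt.add
      rintro i _ ⟨y, rfl⟩
      exact AxiomsAt.map hX (f i) (hδ i) (hε i) (hd i) ((E i).axiomsAt y)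
    refine ⟨ofAxioms hX hax, Iso.refl X, LinearMap.ext fun x => Prod.ext ?_ rfl⟩
    exact (LinearMap.congr_fun TensorProduct.map_id _).symm
  exists_sub E := ⟨E.closureSet, E.countable_closureSet, E.exists_subcoalgebra⟩

end UCocom

/-! ### Adjunctions with a parameter -/

namespace CategoryTheory.ParametrizedAdjunction

variable {C₁ C₂ C₃ : Type*} [Category* C₁] [Category* C₂] [Category* C₃]

theorem homEquiv_naturality {F : C₁ ⥤ C₂ ⥤ C₃} {G : C₁ᵒᵖ ⥤ C₃ ⥤ C₂} (adj : F ⊣₂ G)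
    {X₁ Y₁ : C₁} {X₂ Y₂ : C₂} {X₃ Y₃ : C₃} (f₁ : X₁ ⟶ Y₁) (f₂ : X₂ ⟶ Y₂) (f₃ : X₃ ⟶ Y₃)
    (g : (F.obj Y₁).obj Y₂ ⟶ X₃) :
    adj.homEquiv ((F.obj X₁).map f₂ ≫ (F.map f₁).app Y₂ ≫ g ≫ f₃) =
      f₂ ≫ adj.homEquiv g ≫ (G.map f₁.op).app X₃ ≫ (G.obj (op X₁)).map f₃ := by
  rw [adj.homEquiv_naturality_two, adj.homEquiv_naturality_one, adj.homEquiv_naturality_three,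
    Category.assoc, NatTrans.naturality]

variable (F : C₁ ⥤ C₂ ⥤ C₃) [∀ X, (F.obj X).IsLeftAdjoint]

/-- The right adjoints of the functors `F X`, as a functor of `X`. -/
noncomputable def rightAdjoint : C₁ᵒᵖ ⥤ C₃ ⥤ C₂ where
  obj X := (F.obj X.unop).rightAdjoint
  map f := conjugateEquiv (Adjunction.ofIsLeftAdjoint _) (Adjunction.ofIsLeftAdjoint _)
    (F.map f.unop)
  map_id X := by rw [unop_id, F.map_id, conjugateEquiv_id]
  map_comp f g := by rw [unop_comp, F.map_comp, conjugateEquiv_comp]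

/-- The adjunction between `F` and `rightAdjoint F`. -/
noncomputable def ofIsLeftAdjoint : F ⊣₂ rightAdjoint F where
  adj X := Adjunction.ofIsLeftAdjoint (F.obj X)
  unit_whiskerRight_map f := by
    ext X
    exact (unit_conjugateEquiv _ _ _ _).symm

end CategoryTheory.ParametrizedAdjunction

namespace TensoredCotensoredEnriched

variable {E : Type*} [Category* E] [MonoidalCategory E] {C : Type*} [Category* C]
  [MonoidalRightAction E C]

/-- A right action which has right adjoints in both variables. -/
noncomputable def ofIsLeftAdjoint [∀ X : C, (actionLeft E X).IsLeftAdjoint]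
    [∀ A : E, (actionRight C A).IsLeftAdjoint] : TensoredCotensoredEnriched E C :=
  have : ∀ X, ((curriedAction E C).flip.obj X).IsLeftAdjoint :=
    fun X => inferInstanceAs (actionLeft E X).IsLeftAdjoint
  have : ∀ A, ((curriedAction E C).obj A).IsLeftAdjoint :=
    fun A => inferInstanceAs (actionRight C A).IsLeftAdjoint
  let adj := ParametrizedAdjunction.ofIsLeftAdjoint (curriedAction E C).flip
  let adj' := ParametrizedAdjunction.ofIsLeftAdjoint (curriedAction E C)
  { action := inferInstance
    hom := _
    cot := _
    homEquiv := fun X A Y => adj.homEquiv (X₁ := X) (X₂ := A) (X₃ := Y)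
    cotEquiv := fun X A Y => adj'.homEquiv (X₁ := A) (X₂ := X) (X₃ := Y)
    homEquiv_natural := fun {X X' A A' Y Y'} f a g h => by
      rw [actionHom_def', Category.assoc]
      exact adj.homEquiv_naturality f a g h
    cotEquiv_natural := fun {X X' A A' Y Y'} f a g h => by
      rw [actionHom_def, Category.assoc]
      exact adj'.homEquiv_naturality a f g h }

end TensoredCotensoredEnriched

/-! ### The adjoints of the tensor product -/

namespace Cog

open Limits

variable {K : Type u} [Field K] {C : CurvedCooperad K}

/-- On underlying modules, `D ⊗ -` is a tensor product of vector spaces, which preserves colimits.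
-/
theorem preservesColimits_actionLeft (D : Cog C) :
    PreservesColimits (actionLeft (UCocom K) D) := by
  have := (coalgebraicFunctor C).reflectsColimits
  have := (UCocom.coalgebraicFunctor K).preservesColimits
  have : PreservesColimits (actionLeft (UCocom K) D ⋙ CoalgebraicFunctor.toModule (forget C)) :=
    inferInstanceAs (PreservesColimits (CoalgebraicFunctor.toModule (UCocom.forget K) ⋙
      tensorLeft (ModuleCat.of K D.toGMod)))
  exact preservesColimits_of_reflects_of_preserves (actionLeft (UCocom K) D)
    (CoalgebraicFunctor.toModule (forget C))

theorem preservesColimits_actionRight (E : UCocom K) :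
    PreservesColimits (actionRight (Cog C) E) := by
  have := (coalgebraicFunctor C).reflectsColimits
  have := (coalgebraicFunctor C).preservesColimits
  have : PreservesColimits (actionRight (Cog C) E ⋙ CoalgebraicFunctor.toModule (forget C)) :=
    inferInstanceAs (PreservesColimits (CoalgebraicFunctor.toModule (forget C) ⋙
      tensorRight (ModuleCat.of K E.toGMod)))
  exact preservesColimits_of_reflects_of_preserves (actionRight (Cog C) E)
    (CoalgebraicFunctor.toModule (forget C))

instance isLeftAdjoint_actionLeft (D : Cog C) : (actionLeft (UCocom K) D).IsLeftAdjoint :=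
  have := preservesColimits_actionLeft D
  (UCocom.coalgebraicFunctor K).isLeftAdjoint _

instance isLeftAdjoint_actionRight (E : UCocom K) : (actionRight (Cog C) E).IsLeftAdjoint :=
  have := preservesColimits_actionRight (C := C) E
  (coalgebraicFunctor C).isLeftAdjoint _

end Cog

/-! ### Atoms and morphisms -/

namespace TensoredCotensoredEnriched

variable {E : Type*} [Category* E] [MonoidalCategory E] {C : Type*} [Category* C]

/-- Any morphism `X ⊗ A → Y` is obtained from the evaluation. -/
theorem homEquiv_symm_eq (T : TensoredCotensoredEnriched E C) {X Y : C} {A : E}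
    (p : A ⟶ (T.hom.obj (op X)).obj Y) :
    (T.homEquiv X A Y).symm p = T.action.actionHom (𝟙 X) p ≫ T.ev X Y := by
  let _ := T.action
  rw [Equiv.symm_apply_eq]
  have h := T.homEquiv_natural (𝟙 X) p (𝟙 Y) (T.ev X Y)
  rw [Category.comp_id] at h
  refine Eq.trans ?_ h.symm
  rw [ev, Equiv.apply_symm_apply, op_id, T.hom.map_id, NatTrans.id_app,
    CategoryTheory.Functor.map_id, Category.comp_id, Category.comp_id, Category.comp_id]

end TensoredCotensoredEnriched

namespace GMod

variable {K : Type u} [Field K] {D : GMod K}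

theorem finite_support_proj (hD : D.IsGraded) (x : D) : {n | proj hD n x ≠ 0}.Finite := by
  refine hom_induction hD (p := fun x => {n | proj hD n x ≠ 0}.Finite) (fun m x hx => ?_)
    (by simp) (fun x y hx hy => (hx.union hy).subset fun n hn => ?_) x
  · refine (Set.finite_singleton m).subset fun n hn => ?_
    by_contra h
    exact hn ((proj_apply hD n hx).trans (if_neg fun h' => h h'.symm))
  · by_contra h
    simp only [Set.mem_union, Set.mem_ofPred_eq, not_or, not_not] at h
    exact hn (by rw [map_add, h.1, h.2, add_zero])

/-- The component of bidegree `(m, n)` of a tensor is that of its component of degree `m + n`. -/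
theorem map_proj_proj {E : GMod K} (hD : D.IsGraded) (hE : E.IsGraded) (m n : ℤ) (t : D ⊗[K] E) :
    TensorProduct.map (proj hD m) (proj hE n) (proj (tensor_isGraded hD hE) (m + n) t) =
      TensorProduct.map (proj hD m) (proj hE n) t := by
  refine tensor_induction hD hE (p := fun t => TensorProduct.map (proj hD m) (proj hE n)
    (proj (tensor_isGraded hD hE) (m + n) t) = TensorProduct.map (proj hD m) (proj hE n) t)
    (fun i j x y hx hy => ?_) (by simp) (fun s t hs ht => by simp only [map_add, hs, ht]) t
  rw [proj_apply (D := D.tensor E) (tensor_isGraded hD hE) (m + n) (tmul_mem hx hy rfl)]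
  split_ifs with h
  · rfl
  · rw [TensorProduct.map_tmul, proj_apply hD m hx, proj_apply hE n hy]
    by_cases hi : i = m
    · rw [if_neg (by omega : j ≠ n), TensorProduct.tmul_zero, map_zero]
    · rw [if_neg hi, TensorProduct.zero_tmul, map_zero]

end GMod

namespace UCocom

variable {K : Type u} [Field K] {E : UCocom K} {a : E.toGMod}

/-- Counitality gives `ε(a) a = a`. -/
theorem IsDGAtom.counit_eq (ha : E.IsDGAtom a) : E.counit a = 1 := by
  have h := E.counit_comul_apply a
  rw [ha.2.1, TensorProduct.map_tmul, LinearMap.id_apply, TensorProduct.lid_tmul] at h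
  have h' : (E.counit a - 1) • a = 0 := by rw [sub_smul, one_smul, h, sub_self]
  exact sub_eq_zero.1 ((smul_eq_zero.1 h').resolve_right ha.1)

/-- Atoms have degree `0`: if the component of degree `n` of an atom `a` does not vanish, then
`a ⊗ a = Δ a` shows that its component of degree `2 n` does not vanish either. -/
theorem IsDGAtom.mem_gr_zero (ha : E.IsDGAtom a) : a ∈ E.toGMod.gr 0 := by
  have hdouble : ∀ n, GMod.proj E.isGraded n a ≠ 0 → GMod.proj E.isGraded (n + n) a ≠ 0 := by
    intro n hn h0
    have h1 := GMod.map_proj_proj E.isGraded E.isGraded n n (E.comul a)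
    rw [← (E.axiomsAt a).δ_proj, h0, map_zero, map_zero, ha.2.1, TensorProduct.map_tmul] at h1
    -- `p ⊗ p = 0` implies `f p * f p = 0` for each functional `f`, hence `p = 0`.
    refine hn ((Module.forall_dual_apply_eq_zero_iff K _).1 fun f => ?_)
    have h2 := congrArg (fun t => TensorProduct.lid K K (TensorProduct.map f f t)) h1
    simpa using h2.symm
  refine GMod.mem_of_proj_mem E.isGraded fun n => ?_
  by_cases hn : n = 0
  · exact hn ▸ GMod.proj_mem E.isGraded n a
  by_cases h : GMod.proj E.isGraded n a = 0
  · rw [h]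
    exact Submodule.zero_mem _
  -- Otherwise there is a degree `m ≠ 0` with a non-vanishing component and maximal absolute value.
  obtain ⟨m, ⟨hm, hm0⟩, hmax⟩ := Set.exists_max_image
    ({n | GMod.proj E.isGraded n a ≠ 0} ∩ {n | n ≠ 0}) (fun n => |n|)
    ((GMod.finite_support_proj E.isGraded a).inter_of_left _) ⟨n, h, hn⟩
  have hm0 : m ≠ 0 := hm0
  have h1 : |m + m| ≤ |m| := hmax (m + m) ⟨hdouble m hm, by
    simp only [Set.mem_ofPred_eq]
    omega⟩
  have h2 : 0 < |m| := abs_pos.2 hm0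
  rw [← two_mul, abs_mul, abs_two] at h1
  omega

/-- The degree preserving map `K → E` with value `a` at `1`. -/
noncomputable def IsDGAtom.unitHom (ha : E.IsDGAtom a) : GMod.Hom (GMod.unit K) E.toGMod where
  lin := LinearMap.toSpanSingleton K E.toGMod a
  map_gr n r hr := by
    by_cases hn : n = 0
    · exact hn ▸ Submodule.smul_mem _ _ ha.mem_gr_zero
    · have h0 : r = 0 := by simpa [hn] using hr
      rw [h0, map_zero]
      exact Submodule.zero_mem _

/-- Atoms are the images of `1` under the morphisms from the unit. -/
noncomputable def atomEquiv (E : UCocom K) :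
    {a : E.toGMod // E.IsDGAtom a} ≃ (𝟙_ (UCocom K) ⟶ E) where
  toFun a := ofLin (E := 𝟙_ (UCocom K)) a.2.unitHom
    (fun (r : K) => by
      rw [comul_unit]
      change E.comul (r • a.1) = (r • a.1) ⊗ₜ[K] ((1 : K) • a.1)
      rw [map_smul, a.2.2.1, one_smul, TensorProduct.smul_tmul'])
    (fun (r : K) => by
      rw [counit_unit]
      change E.counit (r • a.1) = r
      rw [map_smul, a.2.counit_eq, smul_eq_mul, mul_one])
    (fun (r : K) => by
      change E.d (r • a.1) = (0 : K) • a.1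
      rw [map_smul, a.2.2.2, smul_zero, zero_smul])
  invFun p := ⟨lin p (1 : K), by
    have hε := counit_lin p (1 : K)
    rw [counit_unit] at hε
    have hδ := comul_lin p (1 : K)
    rw [comul_unit] at hδ
    refine ⟨fun h => ?_, hδ, (d_lin p (1 : K)).trans (map_zero (lin p))⟩
    rw [h, map_zero] at hε
    exact zero_ne_one hε⟩
  left_inv a := Subtype.ext (one_smul K a.1)
  right_inv p := hom_ext (LinearMap.ext_ring (one_smul K _))

theorem lin_atomEquiv (E : UCocom K) (a : {a : E.toGMod // E.IsDGAtom a}) :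
    lin (E.atomEquiv a) (1 : K) = a.1 := one_smul K a.1

end UCocom

namespace Cog

variable {K : Type u} [Field K] {C : CurvedCooperad K}

/-- The atoms of `{D, D'}` correspond to the morphisms `D ≃ D ⊗ K → D'`. -/
theorem exists_atomEquiv (T : TensoredCotensoredEnriched (UCocom K) (Cog C))
    (D D' : Cog C) :
    ∃ e : {a : ((T.hom.obj (op D)).obj D').toGMod // UCocom.IsDGAtom _ a} ≃ (D ⟶ D'),
      ∀ a x, (e a).lin x = (T.action.actionHom (𝟙 D) (UCocom.atomEquiv _ a) ≫ T.ev D D').lin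
        ((T.action.actionUnitIso D).inv.lin x) :=
  ⟨((UCocom.atomEquiv _).trans (T.homEquiv D (𝟙_ (UCocom K)) D').symm).trans
    ((T.action.actionUnitIso D).homCongr (Iso.refl D')), fun a x => by
    rw [← T.homEquiv_symm_eq]
    simp⟩

end Cog

theorem mainTheorem7 {K : Type u} [Field K] (C : CurvedCooperad K) :
    ∃ (T : TensoredCotensoredEnriched (UCocom K) (Cog C))
      (φ : ∀ (D : Cog C) (E : UCocom K),
        (T.action.actionObj D E).toGMod ≃ₗ[K] D.toGMod ⊗[K] E.toGMod),
      Cog.IsTensorAction T.action φ ∧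
      ∀ D D' : Cog C,
        ∃ e : {a : ((T.hom.obj (op D)).obj D').toGMod // UCocom.IsDGAtom _ a} ≃ (D ⟶ D'),
          ∀ a x, (e a).lin x = (T.ev D D').lin ((φ D _).symm (x ⊗ₜ[K] a.1)) := by
  let T : TensoredCotensoredEnriched (UCocom K) (Cog C) :=
    TensoredCotensoredEnriched.ofIsLeftAdjoint
  refine ⟨T, fun D E => LinearEquiv.refl K _, Cog.isTensorAction_tensor, fun D D' => ?_⟩
  obtain ⟨e, he⟩ := Cog.exists_atomEquiv T D D'
  refine ⟨e, fun a x => (he a x).trans ?_⟩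
  refine congrArg (fun t => (T.ev D D').lin t) ?_
  exact congrArg (fun b => x ⊗ₜ[K] b) (UCocom.lin_atomEquiv _ a)
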